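/- Let $k$ be a finite field, let $a,b$ be positive integers with $ab\ge 4$, and let $n_i,m_i,s_i,t_i$ ($i=1,2$) be integers with $$\begin{pmatrix}s_1&t_1\\ s_2&t_2\end{pmatrix}\begin{pmatrix}n_1&n_2\\ m_1&m_2\end{pmatrix}=A=\begin{pmatrix}2&-a\\-b&2\end{pmatrix}.$$ Let $\Lambda=\mathbb Z e_1\oplus\mathbb Z e_2$, $\alpha_i=n_ie_1+m_ie_2\in\Lambda$, $h_i=s_ie_1^\vee+t_ie_2^\vee\in\Lambda^\vee$, and let $G=G_{\mathcal D}(k)$ be the (Tits) Kac--Moody group over $k$ of the datum $\mathcal D=(A,\Lambda,(\alpha_i),(h_i))$, with its torus $\eta\colon T=\operatorname{Hom}(\Lambda,k^\times)\to G$ and its homomorphisms $\phi_i\colon SL_2(k)\to G$. Identify $t\in T$ with $(\zeta,\tau)=(t(e_1),t(e_2))\in k^\times\times k^\times$. Fix $i$, let $H=\langle \eta(T),\phi_i(SL_2(k))\rangle\le G$ be the corresponding Lévi subgroup, let $\omega(\lambda)=\lambda-\langle h_i,\lambda\rangle\alpha_i$ on $\Lambda$, and write $n,m,s,t$ for $n_i,m_i,s_i,t_i$.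 Assume that $H$ is monic, that is, $\phi_i$ is injective. Call $H$ split if $n$ and $m$ are both even. If $H$ is split, put $\overline H=SL_2(k)\times k^\times$, $\overline\eta(\zeta,\tau)=\left(\begin{pmatrix}\zeta&0\\0&\zeta^{-1}\end{pmatrix},\tau\right)$, $\overline\omega(e,v)=(-e,v)$ and $M=\begin{pmatrix}n/2&-t\\ m/2&s\end{pmatrix}$. If $H$ is not split, put $\overline H=GL_2(k)$, $\overline\eta(\zeta,\tau)=\begin{pmatrix}\zeta&0\\0&\tau\end{pmatrix}$, $\overline\omega(e,v)=(v,e)$ and $M=\frac12\begin{pmatrix}n-t&-n-t\\ m+s&-m+s\end{pmatrix}$. Then: 1. There are an isomorphism $\gamma\colon H\to\overline H$ and an automorphism $\gamma|_T$ of $T$ such that $\gamma\circ\eta=\overline\eta\circ\gamma|_T$. 2. $\gamma|_T$ is induced by $M$. Precisely: if $H$ is split, or if $s,t$ are relatively prime, then $M$ has integer entries and $\gamma|_T(x)=x\circ M$ for $x\in T$. Otherwise $k$ has characteristic $2$, $s,t$ are both even, $2M$ has integer entries, and $\gamma|_T(x)=(x\circ 2M)^{1/2}$, where the square root is the unique one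 in $T$. 3. $\det M=1$ and $M^{-1}\omega M=\overline\omega$. -/

import Mathlib

open scoped Matrix MatrixGroups

noncomputable section

/-! Kac-Moody groups over a field, after Tits: a group `G_D(k)` is built from a datum `D`
(generalized Cartan matrix, lattice, simple roots and coroots) by generators and relations. -/

namespace KacMoody

/-- A Kac-Moody datum with index set `ι` and lattice `Λ`: a generalized Cartan matrix `A`, elements
`α i` of `Λ` and `h i` of its dual, with `⟨h i, α j⟩ = A i j`. -/
structure Datum (ι Λ : Type) [AddCommGroup Λ] where
  A : Matrix ι ι ℤ
  diag : ∀ i, A i i = 2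
  offDiag : ∀ i j, i ≠ j → A i j ≤ 0
  zero_symm : ∀ i j, A i j = 0 → A j i = 0
  α : ι → Λ
  h : ι → Λ →+ ℤ
  pairing : ∀ i j, h i (α j) = A i j

section LieAlgebra

variable {ι : Type} [DecidableEq ι] (A : Matrix ι ι ℤ)

/-- The (derived) Kac-Moody Lie algebra over `ℚ`, given by the Chevalley-Serre presentation. -/
abbrev LieAlg : Type := Matrix.ToLieAlgebra ℚ A

/-- The Chevalley generator `e i`. -/
def lieE (i : ι) : LieAlg A :=
  (LieSubmodule.Quotient.mk (FreeLieAlgebra.of ℚ (CartanMatrix.Generators.E i)) :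
    FreeLieAlgebra ℚ (CartanMatrix.Generators ι) ⧸ CartanMatrix.Relations.toIdeal ℚ A)

/-- The Chevalley generator `f i`, with `⁅e i, f i⁆ = h i`. -/
def lieF (i : ι) : LieAlg A :=
  (LieSubmodule.Quotient.mk (FreeLieAlgebra.of ℚ (CartanMatrix.Generators.F i)) :
    FreeLieAlgebra ℚ (CartanMatrix.Generators ι) ⧸ CartanMatrix.Relations.toIdeal ℚ A)

/-- `exp (ad x) y = ∑ (ad x)^n y / n!`. It is used only for the ad-locally nilpotent elements
`x = e i` and `x = -f i`, where the sum is finite. -/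
def expAd (x y : LieAlg A) : LieAlg A :=
  ∑ᶠ n : ℕ, ((n.factorial : ℚ)⁻¹) • ((LieAlgebra.ad ℚ (LieAlg A) x ^ n) y)

/-- The lift `s i * = exp (ad e i) exp (- ad f i) exp (ad e i)` of the `i`-th simple reflection to
the Lie algebra. -/
def reflLie (i : ι) (y : LieAlg A) : LieAlg A :=
  expAd A (lieE A i) (expAd A (-lieF A i) (expAd A (lieE A i) y))

variable [Fintype ι]

/-- The simple reflection `ω i` on the root lattice `⊕ ℤ a j`, with
`ω i (a j) = a j - A i j • a i`. -/
def reflRoot (i : ι) (v : ι → ℤ) : ι → ℤ :=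
  v - (∑ j, A i j * v j) • Pi.single i 1

/-- `IsRealRootVec A v x`: the vector `v` is a real root and `x` is one of the two opposite
generators of the standard `ℤ`-form of its root space, that is, `(v, x)` lies in the
orbit of the pairs `(a i, e i)` under the simple reflections, up to the sign of `x`. -/
inductive IsRealRootVec : (ι → ℤ) → LieAlg A → Prop
  | simple (i : ι) : IsRealRootVec (Pi.single i 1) (lieE A i)
  | neg (v : ι → ℤ) (x : LieAlg A) : IsRealRootVec v x → IsRealRootVec v (-x)
  | refl (i : ι) (v : ι → ℤ) (x : LieAlg A) :
      IsRealRootVec v x → IsRealRootVec (reflRoot A i v) (reflLie A i x)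

/-- The action of the word `ω i₁ ω i₂ ⋯` in the Weyl group on the root lattice. -/
def wordAct (w : List ι) (v : ι → ℤ) : ι → ℤ := w.foldr (reflRoot A) v

/-- The pair of roots `v, w` is prenilpotent: some Weyl group element makes both positive and some
Weyl group element makes both negative. -/
def Prenilpotent (v w : ι → ℤ) : Prop :=
  (∃ g : List ι, 0 ≤ wordAct A g v ∧ 0 ≤ wordAct A g w) ∧
  (∃ g : List ι, wordAct A g v ≤ 0 ∧ wordAct A g w ≤ 0)

/-- The formal exponential `exp (u X^p Y^q) = ∑ u^n X^{np} Y^{nq} / n!` for `(p, q) ≠ (0, 0)`, a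
power series in two central variables with coefficients in an associative algebra. -/
def expSeries {U : Type} [Ring U] [Algebra ℚ U] (u : U) (p q : ℕ) : MvPowerSeries (Fin 2) U :=
  fun d => ∑ n ∈ Finset.range (d 0 + d 1 + 1),
    if d 0 = n * p ∧ d 1 = n * q then ((n.factorial : ℚ)⁻¹) • u ^ n else 0

/-- The image in the universal enveloping algebra. -/
def toU (x : LieAlg A) : UniversalEnvelopingAlgebra ℚ (LieAlg A) :=
  UniversalEnvelopingAlgebra.ι ℚ x

/-- A factor `exp (c X^p Y^q z)` on the right of a commutator formula. -/
structure Factor where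
  p : ℕ
  q : ℕ
  c : ℤ
  z : LieAlg A

/-- `CommFormula A v x w y l`: for root vectors `x`, `y` of roots `v`, `w`, the factors in `l`
belong to real roots `p v + q w` with `p, q ≥ 1`, and Chevalley's commutator formula
`exp(Xx) exp(Yy) exp(-Xx) exp(-Yy) = ∏ exp (c X^p Y^q z)`
holds in the ring of formal power series over the universal enveloping algebra. -/
def CommFormula (v : ι → ℤ) (x : LieAlg A) (w : ι → ℤ) (y : LieAlg A)
    (l : List (Factor A)) : Prop :=
  (∀ f ∈ l, 0 < f.p ∧ 0 < f.q ∧ IsRealRootVec A ((f.p : ℤ) • v + (f.q : ℤ) • w) f.z) ∧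
  expSeries (toU A x) 1 0 * expSeries (toU A y) 0 1 *
      expSeries (-toU A x) 1 0 * expSeries (-toU A y) 0 1 =
    (l.map fun f => expSeries ((f.c : ℚ) • toU A f.z) f.p f.q).prod

end LieAlgebra

section Torus

variable {ι Λ : Type} [AddCommGroup Λ] (D : Datum ι Λ)

/-- The torus `T = Hom (Λ, kˣ)`. -/
abbrev Torus (Λ : Type) [AddCommGroup Λ] (k : Type*) [Field k] : Type _ := Multiplicative Λ →* kˣ

variable {k : Type*} [Field k]

/-- The value `t(v)`. -/
def Torus.val (t : Torus Λ k) (v : Λ) : kˣ := t (Multiplicative.ofAdd v)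

/-- The element `r^h` of the torus, `v ↦ r^{h(v)}`. -/
def coweightPow (h : Λ →+ ℤ) (r : kˣ) : Torus Λ k :=
  (zpowersHom kˣ r).comp (AddMonoidHom.toMultiplicative h)

/-- The simple reflection `ω i (v) = v - ⟨h i, v⟩ α i` of the lattice `Λ`. -/
def Datum.omega (i : ι) : Λ →+ Λ :=
  AddMonoidHom.id Λ - (AddMonoidHom.flip (zmultiplesHom (Λ →+ Λ) (AddMonoidHom.id Λ)) (D.α i)).comp (D.h i)

/-- The simple reflection on the torus. -/
def Datum.omegaTorus (i : ι) (t : Torus Λ k) : Torus Λ k :=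
  t.comp (AddMonoidHom.toMultiplicative (D.omega i))

end Torus

/-- The matrix `(r 0; 0 r⁻¹)` in `SL₂`. -/
def slDiag {k : Type*} [Field k] (r : kˣ) : SL(2, k) :=
  ⟨!![(r : k), 0; 0, ((r⁻¹ : kˣ) : k)], by simp [Matrix.det_fin_two]⟩

/-- The matrix `(1 r; 0 1)` in `SL₂`. -/
def slUpper {k : Type*} [Field k] (r : k) : SL(2, k) :=
  ⟨!![1, r; 0, 1], by simp [Matrix.det_fin_two]⟩

/-- The matrix `(1 0; r 1)` in `SL₂`. -/
def slLower {k : Type*} [Field k] (r : k) : SL(2, k) :=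
  ⟨!![1, 0; r, 1], by simp [Matrix.det_fin_two]⟩

/-- The matrix `(0 1; -1 0)` in `SL₂`. -/
def slWeyl {k : Type*} [Field k] : SL(2, k) :=
  ⟨!![0, 1; -1, 0], by simp [Matrix.det_fin_two]⟩

section Group

variable {ι Λ : Type} [Fintype ι] [DecidableEq ι] [AddCommGroup Λ]
variable (D : Datum ι Λ) (k : Type*) [Field k]

/-- Generators of `G_D(k)`: the torus, a copy of `SL₂(k)` for each simple root, and elements
`x_z(r)` for every real root vector `z` and every `r` in `k`. -/
inductive Gen
  | torus (t : Torus Λ k)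
  | sl (i : ι) (g : SL(2, k))
  | root (z : LieAlg D.A) (hz : ∃ v, IsRealRootVec D.A v z) (r : k)

variable {k}

/-- The word `x_z(r)`, for a real root vector `z`. -/
def wordX (z : LieAlg D.A) (hz : ∃ v, IsRealRootVec D.A v z) (r : k) : FreeGroup (Gen D k) :=
  FreeGroup.of (Gen.root z hz r)

/-- The word of an element of the torus. -/
def wordT (t : Torus Λ k) : FreeGroup (Gen D k) := FreeGroup.of (Gen.torus t)

/-- The word of an element of the `i`-th copy of `SL₂(k)`. -/
def wordS (i : ι) (g : SL(2, k)) : FreeGroup (Gen D k) := FreeGroup.of (Gen.sl i g)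

/-- The defining relations `u = u'` of `G_D(k)`. -/
inductive Rel : FreeGroup (Gen D k) → FreeGroup (Gen D k) → Prop
  /-- The torus is a subgroup. -/
  | torus_mul (t t' : Torus Λ k) : Rel (wordT D t * wordT D t') (wordT D (t * t'))
  /-- `SL₂(k)` maps homomorphically, for every simple root. -/
  | sl_mul (i : ι) (g g' : SL(2, k)) : Rel (wordS D i g * wordS D i g') (wordS D i (g * g'))
  /-- Root groups are additive. -/
  | root_add (z : LieAlg D.A) (hz) (r r' : k) :
      Rel (wordX D z hz r * wordX D z hz r') (wordX D z hz (r + r'))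
  /-- Opposite root vectors parametrize the same root group. -/
  | root_neg (z : LieAlg D.A) (hz) (hz') (r : k) :
      Rel (wordX D (-z) hz' r) (wordX D z hz (-r))
  /-- Commutator relations for prenilpotent pairs of real roots. -/
  | comm (v w : ι → ℤ) (x y : LieAlg D.A) (hx : IsRealRootVec D.A v x)
      (hy : IsRealRootVec D.A w y) (hvw : Prenilpotent D.A v w)
      (l : List (Factor D.A)) (hl : CommFormula D.A v x w y l) (r s : k) :
      Rel (wordX D x ⟨v, hx⟩ r * wordX D y ⟨w, hy⟩ s *
            (wordX D x ⟨v, hx⟩ r)⁻¹ * (wordX D y ⟨w, hy⟩ s)⁻¹)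
        (l.attach.map fun f => wordX D f.1.z ⟨_, (hl.1 f.1 f.2).2.2⟩
            ((f.1.c : k) * r ^ f.1.p * s ^ f.1.q)).prod
  /-- `SL₂(k)` contains the root groups of a simple root and its opposite. -/
  | sl_upper (i : ι) (hz) (r : k) : Rel (wordS D i (slUpper r)) (wordX D (lieE D.A i) hz r)
  | sl_lower (i : ι) (hz) (r : k) : Rel (wordS D i (slLower r)) (wordX D (lieF D.A i) hz r)
  /-- Diagonal matrices lie in the torus. -/
  | sl_diag (i : ι) (r : kˣ) : Rel (wordS D i (slDiag r)) (wordT D (coweightPow (D.h i) r))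
  /-- The torus acts on simple root groups and their opposites through the simple roots. -/
  | torus_upper (t : Torus Λ k) (i : ι) (hz) (r : k) :
      Rel (wordT D t * wordX D (lieE D.A i) hz r * (wordT D t)⁻¹)
        (wordX D (lieE D.A i) hz ((t.val (D.α i) : k) * r))
  | torus_lower (t : Torus Λ k) (i : ι) (hz) (r : k) :
      Rel (wordT D t * wordX D (lieF D.A i) hz r * (wordT D t)⁻¹)
        (wordX D (lieF D.A i) hz ((((t.val (D.α i))⁻¹ : kˣ) : k) * r))
  /-- The matrix `(0 1; -1 0)` acts on the torus as the simple reflection. -/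
  | weyl_torus (i : ι) (t : Torus Λ k) :
      Rel (wordS D i slWeyl * wordT D t * (wordS D i slWeyl)⁻¹) (wordT D (D.omegaTorus i t))
  /-- The matrix `(0 1; -1 0)` permutes the root groups through the lift of the reflection. -/
  | weyl_root (i : ι) (z : LieAlg D.A) (hz) (hz') (r : k) :
      Rel (wordS D i slWeyl * wordX D z hz r * (wordS D i slWeyl)⁻¹)
        (wordX D (reflLie D.A i z) hz' r)

variable (k)

/-- The Kac-Moody group `G_D(k)` over the field `k`. -/
abbrev Grp : Type _ :=
  PresentedGroup {w : FreeGroup (Gen D k) | ∃ u u', Rel D u u' ∧ w = u * u'⁻¹}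

variable {k} in
lemma Grp.rel {u u' : FreeGroup (Gen D k)} (h : Rel D u u') :
    (PresentedGroup.mk _ u : Grp D k) = PresentedGroup.mk _ u' := by
  have : (PresentedGroup.mk _ (u * u'⁻¹) : Grp D k) = 1 :=
    (QuotientGroup.eq_one_iff _).2 (Subgroup.subset_normalClosure ⟨u, u', h, rfl⟩)
  rw [map_mul, map_inv] at this
  exact mul_inv_eq_one.1 this

/-- The homomorphism `η : T → G_D(k)`. -/
def eta : Torus Λ k →* Grp D k :=
  MonoidHom.mk' (fun t => PresentedGroup.mk _ (wordT D t)) fun t t' => by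
    rw [← Grp.rel D (Rel.torus_mul t t'), map_mul]

/-- The homomorphism `φ i : SL₂(k) → G_D(k)`. -/
def phi (i : ι) : SL(2, k) →* Grp D k :=
  MonoidHom.mk' (fun g => PresentedGroup.mk _ (wordS D i g)) fun g g' => by
    rw [← Grp.rel D (Rel.sl_mul i g g'), map_mul]

/-- The Lévi subgroup `H i`, generated by the torus and the image of `φ i`. -/
def levi (i : ι) : Subgroup (Grp D k) := (eta D k).range ⊔ (phi D k i).range

/-- `η` with values in the Lévi subgroup. -/
def etaLevi (i : ι) : Torus Λ k →* levi D k i :=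
  (eta D k).codRestrict (levi D k i) fun t => (le_sup_left : _ ≤ levi D k i) ⟨t, rfl⟩

/-- The Lévi subgroup `H i` is monic: `φ i` is injective. -/
def IsMonic (i : ι) : Prop := Function.Injective (phi D k i)

end Group

section RankTwo

/-- The lattice `Λ = ℤ e₁ ⊕ ℤ e₂`. -/
abbrev Lat : Type := Fin 2 → ℤ

/-- The rank two datum with `α i = n i e₁ + m i e₂` and `h i = s i e₁ᵛ + t i e₂ᵛ`. -/
def rankTwo (a b : ℤ) (ha : 0 < a) (hb : 0 < b) (n m s t : Fin 2 → ℤ)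
    (hA : !![s 0, t 0; s 1, t 1] * !![n 0, n 1; m 0, m 1] = !![2, -a; -b, 2]) :
    Datum (Fin 2) Lat where
  A := !![2, -a; -b, 2]
  diag i := by fin_cases i <;> simp
  offDiag i j hij := by fin_cases i <;> fin_cases j <;> simp at hij ⊢ <;> omega
  zero_symm i j hij := by fin_cases i <;> fin_cases j <;> simp at hij ⊢ <;> omega
  α i := ![n i, m i]
  h i := s i • Pi.evalAddMonoidHom (fun _ : Fin 2 => ℤ) 0 +
    t i • Pi.evalAddMonoidHom (fun _ : Fin 2 => ℤ) 1
  pairing i j := by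
    rw [← hA]
    fin_cases i <;> fin_cases j <;> simp [Matrix.mul_apply, Fin.sum_univ_two]

variable {k : Type*} [Field k]

/-- The homomorphism `(ζ, τ) ↦ diag (ζ, τ)` from `T` to `GL₂(k)`, where `t` in `T` is identified
with `(ζ, τ) = (t(e₁), t(e₂))`. -/
def etaGL : Torus Lat k →* GL (Fin 2) k :=
  MonoidHom.mk'
    (fun t => Matrix.GeneralLinearGroup.mkOfDetNeZero
      !![(t.val (Pi.single 0 1) : k), 0; 0, (t.val (Pi.single 1 1) : k)]
      (by simp [Matrix.det_fin_two]))
    fun t t' => by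
      ext i j
      fin_cases i <;> fin_cases j <;>
        simp [Matrix.GeneralLinearGroup.mkOfDetNeZero, Matrix.mul_apply, Fin.sum_univ_two,
          Torus.val]

/-- The homomorphism `(ζ, τ) ↦ (diag (ζ, ζ⁻¹), τ)` from `T` to `SL₂(k) × kˣ`. -/
def etaSL : Torus Lat k →* SL(2, k) × kˣ :=
  MonoidHom.mk' (fun t => (slDiag (t.val (Pi.single 0 1)), t.val (Pi.single 1 1)))
    fun t t' => by
      refine Prod.ext ?_ ?_
      · apply Subtype.ext
        rw [Prod.fst_mul, Matrix.SpecialLinearGroup.coe_mul]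
        simp [slDiag, Torus.val, mul_comm]
      · simp [Torus.val]

/-- The map `ω̄(e, v) = (v, e)` of `Λ` as a matrix. -/
def omegaGL : Matrix (Fin 2) (Fin 2) ℚ := !![0, 1; 1, 0]

/-- The map `ω̄(e, v) = (-e, v)` of `Λ` as a matrix. -/
def omegaSL : Matrix (Fin 2) (Fin 2) ℚ := !![-1, 0; 0, 1]

/-- The matrix of the simple reflection `ω i` of `Λ`. -/
def omegaMatrix {ι : Type} (D : Datum ι Lat) (i : ι) : Matrix (Fin 2) (Fin 2) ℚ :=
  Matrix.of fun r c => (D.omega i (Pi.single c 1) r : ℚ)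

/-- The matrix `M` in the split case. -/
def matSplit (n m s t : ℤ) : Matrix (Fin 2) (Fin 2) ℚ :=
  !![(n : ℚ) / 2, -(t : ℚ); (m : ℚ) / 2, (s : ℚ)]

/-- The matrix `M` in the non-split case. -/
def matNonsplit (n m s t : ℤ) : Matrix (Fin 2) (Fin 2) ℚ :=
  (1 / 2 : ℚ) • !![(n : ℚ) - t, -(n : ℚ) - t; (m : ℚ) + s, -(m : ℚ) + s]

/-- The map `f` of `T = Hom (Λ, kˣ)` is induced by the integral matrix `M`: `f(t) = t ∘ M`. -/
def InducedBy (M : Matrix (Fin 2) (Fin 2) ℚ) (f : Torus Lat k ≃* Torus Lat k) : Prop :=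
  ∃ N : Matrix (Fin 2) (Fin 2) ℤ, M = N.map (Int.cast : ℤ → ℚ) ∧
    ∀ (t : Torus Lat k) (v : Lat), (f t).val v = t.val (N *ᵥ v)

/-- The map `f` of `T = Hom (Λ, kˣ)` is induced by the half-integral matrix `M`:
`f(t)(v) ^ 2 = t(2 M v)`. This determines `f` when square roots in `k` are unique, that is, in
characteristic two. -/
def HalfInducedBy (M : Matrix (Fin 2) (Fin 2) ℚ) (f : Torus Lat k ≃* Torus Lat k) : Prop :=
  ∃ N : Matrix (Fin 2) (Fin 2) ℤ, (2 : ℚ) • M = N.map (Int.cast : ℤ → ℚ) ∧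
    ∀ (t : Torus Lat k) (v : Lat), (f t).val v ^ 2 = t.val (N *ᵥ v)

end RankTwo

end KacMoody

end

/-!
The Lévi subgroup `H` is generated by the torus `T` and a copy of `SL₂(k)`, on which `T` acts by
conjugation with `diag (t(α), 1)`. So `H` is a quotient of a semidirect product of `SL₂(k)` by `T`,
and it is determined by the pairs `(t, g)` with `η(t) = φ(g)`. If `φ` and `η` are injective, such
a `g` acts on `SL₂(k)` as a diagonal matrix, hence is diagonal, and the pairs are exactly those with
`g = diag (r, r⁻¹)` and `t = r^h` (`eta_eq_phi_iff`). The groups `SL₂(k) × kˣ` and `GL₂(k)` are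
quotients of the same semidirect product by the same kernel, through the automorphism `x ↦ x ∘ M` of
the torus, or the square root of `x ∘ 2M` if `M` is only half-integral (`exists_mulEquiv_split`,
`exists_mulEquiv_nonsplit`). This is a computation with the identity `s n + t m = 2`. Parity
considerations show that `M` is integral if `s, t` are coprime. Otherwise `s, t` are even, and the
central matrix `-1` of `SL₂(k)` is mapped to the trivial element `(-1)^h`, so that injectivity
of `φ` forces characteristic two.

The main point is the injectivity of `η` (`rankTwo_eta_injective`), as the Kac-Moody group is given
by generators and relations. A lower bound for the group comes from its integrable representations:
for a dominant weight `λ`, the Kac-Moody algebra acts on a highest weight module with a lattice `L`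
that is stable under the divided powers of the Chevalley generators; reducing exponentials of real
root vectors modulo the lattice, one obtains an action of the group on `k ⊗ L`, where `η(t)` acts on
the highest weight vector as the scalar `t(λ)` (`IntegrableLattice.rep`, `val_eq_one_of_dominant`).
The highest weight module is realized inside the space of functions on words in the index set, a
vector being recorded by the coefficients of the highest weight vector in its images under products
of the `e i` (`WordFun`, `highestWeight`). Commutator formulas in formal power series over the
enveloping algebra carry over to the operators on `k ⊗ L` coefficient by coefficient
(`CommFormula.redExp_eq`), and `SL₂(k)` acts because its presentation by root groups, torus and Weyl
element can be checked there (`SL2Relations.hom`).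

If the two coroots are linearly independent, every weight is a difference of dominant ones, and `η`
is injective for every field (`eta_injective_of_regular`). If they are proportional, there may be no
regular dominant weight; but sending `SL₂(k)` and the root groups to one shows that the kernel of
`η` is contained in the subgroup of `T` generated by the `r^h` for the simple coroots `h`. This
subgroup is the image of the diagonal matrices of the monic Lévi subgroup, where `η` is injective
(`eta_injective_of_proportional`).
-/

open scoped Matrix MatrixGroups TensorProduct

noncomputable section

namespace KacMoody

attribute [local instance] LieRing.ofAssociativeRing

/-! ### Generation and a presentation of `SL₂(k)` -/

section SL2

variable {k : Type*} [Field k]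

lemma coe_slUpper (r : k) : (slUpper r : Matrix (Fin 2) (Fin 2) k) = !![1, r; 0, 1] := rfl

lemma coe_slLower (r : k) : (slLower r : Matrix (Fin 2) (Fin 2) k) = !![1, 0; r, 1] := rfl

lemma coe_slDiag (r : kˣ) :
    (slDiag r : Matrix (Fin 2) (Fin 2) k) = !![(r : k), 0; 0, ((r⁻¹ : kˣ) : k)] := rfl

lemma coe_slWeyl : ((slWeyl : SL(2, k)) : Matrix (Fin 2) (Fin 2) k) = !![0, 1; -1, 0] := rfl

lemma slLower_eq_conj (x : k) : slLower x = slWeyl * slUpper (-x) * slWeyl⁻¹ := by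
  rw [eq_mul_inv_iff_mul_eq]
  ext i j
  fin_cases i <;> fin_cases j <;>
    simp [coe_slWeyl, coe_slUpper, coe_slLower, Matrix.SpecialLinearGroup.coe_mul,
      Matrix.mul_apply, Fin.sum_univ_two]

/-- A matrix with nonzero lower left entry, in the form given by the big Bruhat cell. -/
lemma eq_slUpper_mul_slLower_mul_slUpper (g : SL(2, k)) (hc : g 1 0 ≠ 0) :
    g = slUpper ((g 0 0 - 1) / g 1 0) * slLower (g 1 0) * slUpper ((g 1 1 - 1) / g 1 0) := by
  have hdet := Matrix.det_fin_two g.1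
  rw [g.2] at hdet
  ext i j
  fin_cases i <;> fin_cases j <;>
    simp [coe_slUpper, coe_slLower, Matrix.SpecialLinearGroup.coe_mul,
      Matrix.mul_apply, Fin.sum_univ_two, hc] <;> field_simp <;>
    grind

/-- `SL₂(k)` is generated by the unipotent triangular matrices. -/
lemma closure_slUpper_slLower (S : Subgroup SL(2, k)) (hu : ∀ x, slUpper x ∈ S)
    (hl : ∀ x, slLower x ∈ S) (g : SL(2, k)) : g ∈ S := by
  have key : ∀ g : SL(2, k), g 1 0 ≠ 0 → g ∈ S := fun g hc => by
    rw [eq_slUpper_mul_slLower_mul_slUpper g hc]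
    exact S.mul_mem (S.mul_mem (hu _) (hl _)) (hu _)
  by_cases hc : g 1 0 = 0
  · have ha : g 0 0 ≠ 0 := fun ha => by
      have hdet := Matrix.det_fin_two g.1
      rw [g.2] at hdet
      simp [ha, hc] at hdet
    have := key (slLower 1 * g) (by
      simpa [coe_slLower, Matrix.SpecialLinearGroup.coe_mul,
      Matrix.mul_apply, Fin.sum_univ_two, hc] using ha)
    exact (S.mul_mem_cancel_left (hl 1)).1 this
  · exact key g hc

lemma SL2.hom_ext {Γ : Type*} [Group Γ] {f f' : SL(2, k) →* Γ}
    (hu : ∀ x, f (slUpper x) = f' (slUpper x)) (hl : ∀ x, f (slLower x) = f' (slLower x)) :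
    f = f' := by
  ext g
  exact closure_slUpper_slLower (f.eqLocus f') hu hl g

variable {Γ : Type*} [Group Γ]

/-- Elements of a group `Γ` that satisfy the relations of the unipotent triangular matrices, the
diagonal matrices and the matrix `(0 1; -1 0)` in `SL₂(k)`. -/
structure SL2Relations (k : Type*) [Field k] (Γ : Type*) [Group Γ] where
  u : k → Γ
  l : k → Γ
  h : kˣ →* Γ
  w : Γ
  u_add : ∀ x y, u (x + y) = u x * u y
  h_conj_u : ∀ r x, h r * u x * (h r)⁻¹ = u ((r : k) ^ 2 * x)
  w_conj_u : ∀ x, w * u x * w⁻¹ = l (-x)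
  w_conj_h : ∀ r, w * h r * w⁻¹ = (h r)⁻¹
  ulu : ∀ r : kˣ, u r * l (-(r⁻¹ : kˣ)) * u r = h r * w

namespace SL2Relations

variable (R : SL2Relations k Γ)

lemma u_zero : R.u 0 = 1 := by simpa using R.u_add 0 0

lemma u_neg (x : k) : R.u (-x) = (R.u x)⁻¹ := by
  rw [eq_inv_iff_mul_eq_one, ← R.u_add, neg_add_cancel, R.u_zero]

lemma l_eq (x : k) : R.l x = R.w * (R.u x)⁻¹ * R.w⁻¹ := by
  rw [← u_neg, R.w_conj_u, neg_neg]

lemma w_sq : R.w * R.w = R.h (-1) := by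
  have h1 := R.ulu 1
  have h2 := R.ulu (-1)
  simp only [Units.val_one, inv_one, map_one, one_mul, Units.val_neg, inv_neg, neg_neg,
    l_eq, u_neg] at h1 h2
  -- `h2` is the inverse of `h1` up to the factor `h (-1)`
  have h3 : R.w⁻¹ = R.h (-1) * R.w := by
    rw [← h2]
    nth_rewrite 1 [← h1]
    group
  have h4 : R.w * R.w = (R.h (-1))⁻¹ := by
    rw [eq_inv_iff_mul_eq_one, mul_assoc]
    have : R.w * R.h (-1) = R.h (-1) * R.w := by
      have := R.w_conj_h (-1)
      rw [← map_inv, inv_neg, inv_one] at this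
      rw [← mul_inv_eq_iff_eq_mul, this]
    rw [this, ← h3, mul_inv_cancel]
  rw [h4, ← map_inv, inv_neg, inv_one]

lemma h_u (r : kˣ) (x : k) : R.h r * R.u x = R.u ((r : k) ^ 2 * x) * R.h r := by
  rw [← R.h_conj_u, inv_mul_cancel_right]

lemma w_h (r : kˣ) : R.w * R.h r = R.h r⁻¹ * R.w := by
  rw [map_inv, ← R.w_conj_h, inv_mul_cancel_right]

/-- The product `w u w`, in the big cell. -/
lemma w_u_w (r : kˣ) : R.w * R.u r * R.w =
    R.u (-(r⁻¹ : kˣ)) * R.h (-r⁻¹) * R.w * R.u (-(r⁻¹ : kˣ)) := by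
  have h1 := R.ulu r⁻¹
  rw [inv_inv] at h1
  have h2 : R.l (-(r : k)) = (R.u (r⁻¹ : kˣ))⁻¹ * R.h r⁻¹ * R.w * (R.u (r⁻¹ : kˣ))⁻¹ := by
    rw [eq_mul_inv_iff_mul_eq, mul_assoc _ _ R.w, eq_inv_mul_iff_mul_eq, ← mul_assoc, h1]
  rw [← R.w_conj_u] at h2
  have h3 : R.w * R.u r * R.w = R.w * R.u r * R.w⁻¹ * (R.w * R.w) := by group
  have h4 : ∀ x, R.u x * R.h (-1) = R.h (-1) * R.u x := fun x => by
    rw [h_u]; simp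
  have h5 : R.w * R.h (-1) = R.h (-1) * R.w := by
    rw [w_h, inv_neg, inv_one]
  rw [h3, h2, w_sq, ← u_neg, mul_assoc _ (R.u _) (R.h _), h4, ← mul_assoc, mul_assoc _ R.w, h5,
    ← mul_assoc, mul_assoc _ (R.h r⁻¹), ← map_mul]
  simp

/-- The homomorphism on matrices, through the Bruhat decomposition. -/
def fn (g : SL(2, k)) : Γ :=
  open Classical in
  if hc : g 1 0 = 0 then
    if ha : g 0 0 = 0 then 1 else R.h (Units.mk0 _ ha) * R.u (g 0 1 / g 0 0)
  else R.u (g 0 0 / g 1 0) * R.h (-(Units.mk0 _ hc)⁻¹) * R.w * R.u (g 1 1 / g 1 0)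

lemma fn_of_eq_zero {g : SL(2, k)} (hc : g 1 0 = 0) (a : kˣ) (ha : g 0 0 = a) :
    R.fn g = R.h a * R.u (g 0 1 / a) := by
  have ha' : g 0 0 ≠ 0 := by simp [ha]
  have : Units.mk0 _ ha' = a := Units.ext ha
  rw [fn, dif_pos hc, dif_neg ha', this, ha]

lemma fn_of_ne_zero {g : SL(2, k)} (c : kˣ) (hc : g 1 0 = c) :
    R.fn g = R.u (g 0 0 / c) * R.h (-c⁻¹) * R.w * R.u (g 1 1 / c) := by
  have hc' : g 1 0 ≠ 0 := by simp [hc]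
  have : Units.mk0 _ hc' = c := Units.ext hc
  rw [fn, dif_neg hc', this, hc]

lemma fn_slUpper (x : k) : R.fn (slUpper x) = R.u x := by
  rw [R.fn_of_eq_zero (by simp [coe_slUpper]) 1 (by simp [coe_slUpper])]
  simp [coe_slUpper]

lemma fn_slDiag (r : kˣ) : R.fn (slDiag r) = R.h r := by
  rw [R.fn_of_eq_zero (by simp [coe_slDiag]) r (by simp [coe_slDiag])]
  simp [coe_slDiag, u_zero]

lemma fn_slWeyl : R.fn slWeyl = R.w := by
  rw [R.fn_of_ne_zero (-1) (by simp [coe_slWeyl])]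
  simp [coe_slWeyl, u_zero]

lemma fn_slUpper_mul (x : k) (g : SL(2, k)) : R.fn (slUpper x * g) = R.u x * R.fn g := by
  have h10 : (slUpper x * g) 1 0 = g 1 0 := by
    simp [coe_slUpper, Matrix.SpecialLinearGroup.coe_mul,
      Matrix.mul_apply, Fin.sum_univ_two]
  have h11 : (slUpper x * g) 1 1 = g 1 1 := by
    simp [coe_slUpper, Matrix.SpecialLinearGroup.coe_mul,
      Matrix.mul_apply, Fin.sum_univ_two]
  have h00 : (slUpper x * g) 0 0 = g 0 0 + x * g 1 0 := by
    simp [coe_slUpper, Matrix.SpecialLinearGroup.coe_mul,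
      Matrix.mul_apply, Fin.sum_univ_two]
  have h01 : (slUpper x * g) 0 1 = g 0 1 + x * g 1 1 := by
    simp [coe_slUpper, Matrix.SpecialLinearGroup.coe_mul,
      Matrix.mul_apply, Fin.sum_univ_two]
  have hdet := Matrix.det_fin_two g.1
  rw [g.2] at hdet
  by_cases hc : g 1 0 = 0
  · have hd : g 0 0 * g 1 1 = 1 := by simpa [hc] using hdet.symm
    obtain ⟨a, ha⟩ : ∃ a : kˣ, g 0 0 = a := ⟨Units.mk0 _ (left_ne_zero_of_mul_eq_one hd), rfl⟩
    rw [R.fn_of_eq_zero (g := g) hc a ha,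
      R.fn_of_eq_zero (g := slUpper x * g) (h10.trans hc) a (by rw [h00, hc, ha]; simp), h01,
      h_u, h_u, ← mul_assoc, ← R.u_add]
    congr 2
    rw [ha] at hd
    field_simp
    linear_combination x * hd
  · obtain ⟨c, hc'⟩ : ∃ c : kˣ, g 1 0 = c := ⟨Units.mk0 _ hc, rfl⟩
    rw [R.fn_of_ne_zero (g := g) c hc', R.fn_of_ne_zero (g := slUpper x * g) c (h10.trans hc'),
      h00, h11, hc', ← mul_assoc, ← mul_assoc, ← mul_assoc, ← R.u_add]
    congr 4
    field_simp
    ring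

lemma fn_slWeyl_mul (g : SL(2, k)) : R.fn (slWeyl * g : SL(2, k)) = R.w * R.fn g := by
  have h10 : (slWeyl * g : SL(2, k)) 1 0 = - g 0 0 := by
    simp [coe_slWeyl, Matrix.SpecialLinearGroup.coe_mul,
      Matrix.mul_apply, Fin.sum_univ_two]
  have h11 : (slWeyl * g : SL(2, k)) 1 1 = - g 0 1 := by
    simp [coe_slWeyl, Matrix.SpecialLinearGroup.coe_mul,
      Matrix.mul_apply, Fin.sum_univ_two]
  have h00 : (slWeyl * g : SL(2, k)) 0 0 = g 1 0 := by
    simp [coe_slWeyl, Matrix.SpecialLinearGroup.coe_mul,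
      Matrix.mul_apply, Fin.sum_univ_two]
  have h01 : (slWeyl * g : SL(2, k)) 0 1 = g 1 1 := by
    simp [coe_slWeyl, Matrix.SpecialLinearGroup.coe_mul,
      Matrix.mul_apply, Fin.sum_univ_two]
  have hdet := Matrix.det_fin_two g.1
  rw [g.2] at hdet
  by_cases hc : g 1 0 = 0
  · have hd : g 0 0 * g 1 1 = 1 := by simpa [hc] using hdet.symm
    obtain ⟨a, ha⟩ : ∃ a : kˣ, g 0 0 = a := ⟨Units.mk0 _ (left_ne_zero_of_mul_eq_one hd), rfl⟩
    rw [R.fn_of_eq_zero (g := g) hc a ha,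
      R.fn_of_ne_zero (g := slWeyl * g) (-a) (by rw [h10, ha]; simp), h00, h11, hc, zero_div,
      u_zero, one_mul, ← mul_assoc, w_h]
    simp
  · obtain ⟨c, hc'⟩ : ∃ c : kˣ, g 1 0 = c := ⟨Units.mk0 _ hc, rfl⟩
    rw [R.fn_of_ne_zero (g := g) c hc']
    by_cases ha : g 0 0 = 0
    · have hd : g 1 0 * g 0 1 = -1 := by
        have : (1 : k) = -(g 0 1 * g 1 0) := by simpa [ha] using hdet
        linear_combination this
      rw [R.fn_of_eq_zero (g := slWeyl * g) (by rw [h10, ha, neg_zero]) c (h00.trans hc'), h01,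
        ha, zero_div, u_zero, one_mul, ← mul_assoc, ← mul_assoc, w_h, mul_assoc _ R.w R.w, w_sq,
        ← map_mul]
      simp
    · obtain ⟨a, ha'⟩ : ∃ a : kˣ, g 0 0 = a := ⟨Units.mk0 _ ha, rfl⟩
      rw [R.fn_of_ne_zero (g := slWeyl * g) (-a) (by rw [h10, ha']; simp), h00, h11, hc', ha']
      have e1 : (a : k) / c = ((a * c⁻¹ : kˣ) : k) := by
        simp [div_eq_mul_inv]
      have e2 : ∀ x y z, R.w * (x * R.h (-c⁻¹) * R.w * R.u z) * y =
          R.w * x * R.w * (R.h (-c) * R.u z) * y := fun x y z => by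
        have h3 := R.w_h (-c)
        rw [inv_neg] at h3
        rw [mul_assoc x, ← h3]
        group
      have e3 := e2 (R.u ((a : k) / c)) 1 (g 1 1 / c)
      rw [mul_one, mul_one] at e3
      rw [e3, e1, w_u_w, h_u, mul_assoc _ (R.u _) (R.u _ * _), ← mul_assoc (R.u _) (R.u _),
        ← R.u_add, ← mul_assoc]
      -- move `h (-c)` to the left, next to the other diagonal factor
      have e4 : ∀ y, R.u y * R.h (-c) = R.h (-c) * R.u (((c⁻¹ : kˣ) : k) ^ 2 * y) := fun y => by
        rw [h_u]
        congr 2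
        simp
      rw [mul_assoc _ (R.u _) (R.h (-c)), e4, ← mul_assoc, mul_assoc _ R.w (R.h (-c)), w_h,
        ← mul_assoc, mul_assoc _ (R.h _) (R.h _), ← map_mul]
      have hd : (a : k) * g 1 1 - g 0 1 * c = 1 := by rw [← ha', ← hc']; exact hdet.symm
      congr 2
      · congr 2
        · congr 1
          simp [div_eq_mul_inv, mul_comm]
        · congr 1
          simp [mul_comm]
      · congr 1
        simp only [mul_inv_rev, inv_inv, Units.val_mul, Units.val_inv_eq_inv_val, Units.val_neg]
        field_simp
        linear_combination (-1 : k) * hd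

/-- The elements in `R` are images of matrices under a homomorphism from `SL₂(k)`. -/
def hom : SL(2, k) →* Γ :=
  MonoidHom.mk' R.fn fun g g' => by
    have h1 : R.fn 1 = 1 := by
      have := R.fn_slDiag 1
      rw [map_one] at this
      rw [← this]
      congr 1
      ext i j
      fin_cases i <;> fin_cases j <;> simp [coe_slDiag]
    let S : Subgroup SL(2, k) :=
      { carrier := {s | ∀ g, R.fn (s * g) = R.fn s * R.fn g}
        one_mem' := fun g => by rw [h1, one_mul, one_mul]
        mul_mem' := fun {s s'} hs hs' g => by
          rw [mul_assoc, hs, hs', hs, mul_assoc]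
        inv_mem' := fun {s} hs g => by
          have e1 := hs s⁻¹
          have e2 := hs (s⁻¹ * g)
          rw [mul_inv_cancel, h1] at e1
          rw [mul_inv_cancel_left] at e2
          rw [e2, ← mul_assoc, eq_inv_of_mul_eq_one_right e1.symm, inv_mul_cancel, one_mul] }
    have hu : ∀ x, slUpper x ∈ S := fun x g => by rw [fn_slUpper_mul, fn_slUpper]
    have hw : slWeyl ∈ S := fun g => by rw [fn_slWeyl_mul, fn_slWeyl]
    exact closure_slUpper_slLower S hu (fun x => by
      rw [slLower_eq_conj]
      exact S.mul_mem (S.mul_mem hw (hu _)) (S.inv_mem hw)) g g'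

lemma hom_slUpper (x : k) : R.hom (slUpper x) = R.u x := R.fn_slUpper x

lemma hom_slDiag (r : kˣ) : R.hom (slDiag r) = R.h r := R.fn_slDiag r

lemma hom_slWeyl : R.hom slWeyl = R.w := R.fn_slWeyl

lemma hom_slLower (x : k) : R.hom (slLower x) = R.l x := by
  rw [slLower_eq_conj, map_mul, map_mul, map_inv, hom_slWeyl, hom_slUpper, R.w_conj_u, neg_neg]

end SL2Relations

end SL2

/-! ### Locally finite families of operators and divided powers -/

section LocallyFinite

variable {I R M : Type*} [CommRing R] [AddCommGroup M] [Module R M]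

/-- A family of operators is locally finite if only finitely many of them are nonzero on any given
vector. -/
def LocFin (D : I → Module.End R M) : Prop := ∀ x, {i | D i x ≠ 0}.Finite

lemma LocFin.support {D : I → Module.End R M} (hD : LocFin D) (x : M) :
    (Function.support fun i => D i x).Finite := hD x

open Classical in
/-- The sum of a locally finite family of operators, and zero for other families. -/
def sumEnd (D : I → Module.End R M) : Module.End R M :=
  if hD : LocFin D then
    { toFun := fun x => ∑ᶠ i, D i x
      map_add' := fun x y => by
        simp only [map_add]
        exact finsum_add_distrib (hD.support x) (hD.support y)
      map_smul' := fun r x => by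
        simp only [map_smul, RingHom.id_apply]
        exact (smul_finsum' r (hD.support x)).symm }
  else 0

lemma sumEnd_apply {D : I → Module.End R M} (hD : LocFin D) (x : M) :
    sumEnd D x = ∑ᶠ i, D i x := by
  rw [sumEnd, dif_pos hD]
  rfl

lemma sumEnd_apply_eq_sum {D : I → Module.End R M} (hD : LocFin D) (x : M) (s : Finset I)
    (hs : ∀ i, D i x ≠ 0 → i ∈ s) : sumEnd D x = ∑ i ∈ s, D i x := by
  rw [sumEnd_apply hD, finsum_eq_sum_of_support_subset]
  exact fun i hi => hs i hi

lemma LocFin.mul_left {D : I → Module.End R M} (hD : LocFin D) (B : Module.End R M) :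
    LocFin fun i => B * D i := fun x =>
  (hD x).subset fun i hi h => hi (by simp [h])

lemma LocFin.mul_right {D : I → Module.End R M} (hD : LocFin D) (B : Module.End R M) :
    LocFin fun i => D i * B := fun x => hD (B x)

lemma sumEnd_mul_left {D : I → Module.End R M} (hD : LocFin D) (B : Module.End R M) :
    sumEnd (fun i => B * D i) = B * sumEnd D := by
  ext x
  have h1 := sumEnd_apply_eq_sum hD x (hD x).toFinset (fun i hi => by simpa using hi)
  have h2 := sumEnd_apply_eq_sum (hD.mul_left B) x (hD x).toFinset
    (fun i hi => by
      simp only [Set.Finite.mem_toFinset, Set.mem_ofPred_eq]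
      exact fun h => hi (by simp [h]))
  rw [h2, Module.End.mul_apply, h1, map_sum]
  rfl

lemma sumEnd_mul_right {D : I → Module.End R M} (hD : LocFin D) (B : Module.End R M) :
    sumEnd (fun i => D i * B) = sumEnd D * B := by
  ext x
  rw [sumEnd_apply (hD.mul_right B), Module.End.mul_apply, sumEnd_apply hD]
  rfl

/-- The product of two families as formal series indexed by `I`. -/
def seriesMul [AddCommMonoid I] [Finset.HasAntidiagonal I] {U : Type*} [Semiring U] (D D' : I → U) :
    I → U :=
  fun d => ∑ p ∈ Finset.HasAntidiagonal.antidiagonal d, D p.1 * D' p.2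

section Conv

variable [AddCommMonoid I] [Finset.HasAntidiagonal I]

/-- A finite box that contains all pairs of indices for which a product of two locally finite
families does not vanish on `x`. -/
lemma LocFin.exists_box {D D' : I → Module.End R M} (hD : LocFin D) (hD' : LocFin D') (x : M) :
    ∃ s s' : Finset I, ∀ i j, D i (D' j x) ≠ 0 → i ∈ s ∧ j ∈ s' := by
  classical
  refine ⟨(hD' x).toFinset.biUnion fun j => (hD (D' j x)).toFinset, (hD' x).toFinset,
    fun i j h => ?_⟩
  have hj : j ∈ (hD' x).toFinset := by
    simp only [Set.Finite.mem_toFinset, Set.mem_ofPred_eq]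
    exact fun h0 => h (by simp [h0])
  refine ⟨?_, hj⟩
  simp only [Finset.mem_biUnion]
  exact ⟨j, hj, by simpa using h⟩

lemma seriesMul_apply (D D' : I → Module.End R M) (d : I) (x : M) :
    seriesMul D D' d x = ∑ p ∈ Finset.HasAntidiagonal.antidiagonal d, D p.1 (D' p.2 x) := by
  simp [seriesMul, LinearMap.sum_apply]

lemma LocFin.seriesMul {D D' : I → Module.End R M} (hD : LocFin D) (hD' : LocFin D') :
    LocFin (seriesMul D D') := by
  classical
  intro x
  obtain ⟨s, s', h⟩ := hD.exists_box hD' x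
  refine ((s ×ˢ s').image fun p => p.1 + p.2).finite_toSet.subset fun d hd => ?_
  rw [Set.mem_ofPred_eq, seriesMul_apply] at hd
  obtain ⟨p, hp, hp0⟩ := Finset.exists_ne_zero_of_sum_ne_zero hd
  have := h _ _ hp0
  simp only [Finset.coe_image, Set.mem_image, Finset.mem_coe, Finset.mem_product]
  exact ⟨p, this, Finset.HasAntidiagonal.mem_antidiagonal.1 hp⟩

lemma sumEnd_seriesMul {D D' : I → Module.End R M} (hD : LocFin D) (hD' : LocFin D') :
    sumEnd (seriesMul D D') = sumEnd D * sumEnd D' := by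
  classical
  ext x
  obtain ⟨s, s', h⟩ := hD.exists_box hD' x
  have hs' : ∀ j, D' j x ≠ 0 → j ∈ s' ∪ (hD' x).toFinset := fun j hj =>
    Finset.mem_union_right _ (by simpa using hj)
  set t' := s' ∪ (hD' x).toFinset
  have h' : ∀ i j, D i (D' j x) ≠ 0 → (i, j) ∈ s ×ˢ t' := fun i j hij =>
    Finset.mem_product.2 ⟨(h i j hij).1, Finset.mem_union_left _ (h i j hij).2⟩
  rw [Module.End.mul_apply, sumEnd_apply_eq_sum hD' x t' hs',
    sumEnd_apply_eq_sum hD _ s, sumEnd_apply_eq_sum (hD.seriesMul hD') x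
      ((s ×ˢ t').image fun p => p.1 + p.2)]
  · have h1 : ∑ i ∈ s, D i (∑ j ∈ t', D' j x) = ∑ p ∈ s ×ˢ t', D p.1 (D' p.2 x) := by
      rw [Finset.sum_product]
      exact Finset.sum_congr rfl fun i _ => map_sum _ _ _
    rw [h1, ← Finset.sum_fiberwise_of_maps_to
      (fun p hp => Finset.mem_image_of_mem (fun p : I × I => p.1 + p.2) hp)]
    refine Finset.sum_congr rfl fun d _ => ?_
    rw [seriesMul_apply]
    symm
    refine Finset.sum_subset_zero_on_sdiff (fun p hp => ?_) (fun p hp => ?_) fun _ _ => rfl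
    · simpa using (Finset.mem_filter.1 hp).2
    · by_contra h0
      rw [Finset.mem_sdiff, Finset.mem_filter, Finset.HasAntidiagonal.mem_antidiagonal] at hp
      exact hp.2 ⟨h' _ _ h0, hp.1⟩
  · intro d hd
    rw [seriesMul_apply] at hd
    obtain ⟨p, hp, hp0⟩ := Finset.exists_ne_zero_of_sum_ne_zero hd
    exact Finset.mem_image.2 ⟨p, h' _ _ hp0, Finset.HasAntidiagonal.mem_antidiagonal.1 hp⟩
  · intro i hi
    rw [map_sum] at hi
    obtain ⟨j, _, hj0⟩ := Finset.exists_ne_zero_of_sum_ne_zero hi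
    exact (h i j hj0).1

end Conv

end LocallyFinite

section DivPow

variable {U : Type*} [Ring U] [Algebra ℚ U]

/-- The divided power `u ^ n / n!`. -/
def divPow (u : U) (n : ℕ) : U := (n.factorial : ℚ)⁻¹ • u ^ n

@[simp] lemma divPow_zero (u : U) : divPow u 0 = 1 := by simp [divPow]

@[simp] lemma divPow_one (u : U) : divPow u 1 = u := by simp [divPow]

lemma divPow_smul (c : ℚ) (u : U) (n : ℕ) : divPow (c • u) n = c ^ n • divPow u n := by
  rw [divPow, divPow, smul_pow, smul_comm]

lemma succ_smul_divPow (u : U) (n : ℕ) :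
    ((n : ℚ) + 1) • divPow u (n + 1) = u * divPow u n := by
  rw [divPow, divPow, smul_smul, mul_smul_comm, pow_succ']
  congr 1
  rw [Nat.factorial_succ]
  push_cast
  have : (n.factorial : ℚ) ≠ 0 := by positivity
  field_simp

lemma divPow_mul (u : U) (i j : ℕ) :
    divPow u i * divPow u j = ((i + j).choose i : ℚ) • divPow u (i + j) := by
  rw [divPow, divPow, divPow, smul_mul_smul_comm, ← pow_add, smul_smul,
    Nat.choose_symm_add, Nat.add_choose]
  congr 1
  rw [Nat.cast_div (Nat.factorial_mul_factorial_dvd_factorial_add i j) (by positivity)]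
  have h1 : (i.factorial : ℚ) ≠ 0 := by positivity
  have h2 : (j.factorial : ℚ) ≠ 0 := by positivity
  have h3 : ((i + j).factorial : ℚ) ≠ 0 := by positivity
  push_cast
  field_simp

lemma divPow_add {u v : U} (h : Commute u v) (n : ℕ) :
    divPow (u + v) n = seriesMul (divPow u) (divPow v) n := by
  rw [divPow, h.add_pow', seriesMul, Finset.smul_sum]
  refine Finset.sum_congr rfl fun p hp => ?_
  rw [divPow, divPow, smul_mul_smul_comm, ← Nat.cast_smul_eq_nsmul ℚ, smul_smul]
  congr 1
  obtain rfl := Finset.HasAntidiagonal.mem_antidiagonal.1 hp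
  rw [Nat.choose_symm_add, Nat.add_choose,
    Nat.cast_div (Nat.factorial_mul_factorial_dvd_factorial_add _ _) (by positivity)]
  have h1 : (p.1.factorial : ℚ) ≠ 0 := by positivity
  have h2 : (p.2.factorial : ℚ) ≠ 0 := by positivity
  have h3 : ((p.1 + p.2).factorial : ℚ) ≠ 0 := by positivity
  push_cast
  field_simp

/-- The series of `ad u` applied to `y` is the conjugate of `y` by the exponential series of
`u`. -/
lemma divPow_ad (u y : U) (n : ℕ) :
    (n.factorial : ℚ)⁻¹ • ((LieAlgebra.ad ℚ U u) ^ n) y =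
      seriesMul (fun i => divPow u i * y) (divPow (-u)) n := by
  have h1 : LieAlgebra.ad ℚ U u = LinearMap.mulLeft ℚ u + LinearMap.mulRight ℚ (-u) := by
    ext z
    simp [LieRing.of_associative_ring_bracket, sub_eq_add_neg]
  have h2 : Commute (LinearMap.mulLeft ℚ u) (LinearMap.mulRight ℚ (-u)) :=
    LinearMap.commute_mulLeft_right u (-u)
  have h3 := congrArg (fun f : Module.End ℚ U => f y) (divPow_add h2 n)
  rw [← h1] at h3
  simp only [divPow, LinearMap.smul_apply, seriesMul, LinearMap.sum_apply, Module.End.mul_apply,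
    LinearMap.pow_mulLeft, LinearMap.pow_mulRight, LinearMap.mulLeft_apply,
    LinearMap.mulRight_apply] at h3
  rw [h3, seriesMul]
  refine Finset.sum_congr rfl fun p _ => ?_
  simp only [divPow, mul_assoc, smul_mul_assoc, mul_smul_comm]
  rw [smul_comm]

end DivPow

section Exp

variable {V : Type*} [AddCommGroup V] [Module ℚ V]

/-- An operator is locally nilpotent if every vector is killed by some power of it. -/
def LocNil (a : Module.End ℚ V) : Prop := ∀ x, ∃ n : ℕ, (a ^ n) x = 0

lemma LocNil.neg {a : Module.End ℚ V} (ha : LocNil a) : LocNil (-a) := fun x => by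
  obtain ⟨n, hn⟩ := ha x
  refine ⟨n, ?_⟩
  rw [neg_pow, Module.End.mul_apply, hn, map_zero]

lemma LocNil.smul {a : Module.End ℚ V} (ha : LocNil a) (c : ℚ) : LocNil (c • a) := fun x => by
  obtain ⟨n, hn⟩ := ha x
  refine ⟨n, ?_⟩
  rw [smul_pow, LinearMap.smul_apply, hn, smul_zero]

lemma LocNil.locFin {a : Module.End ℚ V} (ha : LocNil a) : LocFin (divPow a) := fun x => by
  obtain ⟨n, hn⟩ := ha x
  refine (Finset.range n).finite_toSet.subset fun i hi => ?_
  by_contra h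
  simp only [Finset.coe_range, Set.mem_Iio, not_lt] at h
  refine hi ?_
  rw [divPow, LinearMap.smul_apply, Module.End.pow_map_zero_of_le h hn, smul_zero]

/-- The exponential of a locally nilpotent operator. -/
def expEnd (a : Module.End ℚ V) : Module.End ℚ V := sumEnd (divPow a)

lemma expEnd_zero : expEnd (0 : Module.End ℚ V) = 1 := by
  have h0 : LocNil (0 : Module.End ℚ V) := fun x => ⟨1, by simp⟩
  ext x
  rw [expEnd, sumEnd_apply_eq_sum h0.locFin x {0}]
  · simp
  · intro i hi
    by_contra h
    refine hi ?_
    rw [divPow, zero_pow (by simpa using h)]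
    simp

lemma expEnd_mul_neg {a : Module.End ℚ V} (ha : LocNil a) : expEnd a * expEnd (-a) = 1 := by
  rw [expEnd, expEnd, ← sumEnd_seriesMul ha.locFin ha.neg.locFin, ← expEnd_zero, expEnd]
  congr 1
  ext1 n
  rw [← divPow_add (Commute.neg_right (Commute.refl a)), add_neg_cancel]

lemma expEnd_neg_mul {a : Module.End ℚ V} (ha : LocNil a) : expEnd (-a) * expEnd a = 1 := by
  simpa using expEnd_mul_neg ha.neg

lemma expEnd_conj {a : Module.End ℚ V} (ha : LocNil a) (y : Module.End ℚ V) :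
    expEnd a * y * expEnd (-a) =
      sumEnd fun n : ℕ => (n.factorial : ℚ)⁻¹ • ((LieAlgebra.ad ℚ (Module.End ℚ V) a) ^ n) y := by
  rw [expEnd, expEnd, ← sumEnd_mul_right ha.locFin,
    ← sumEnd_seriesMul (ha.locFin.mul_right y) ha.neg.locFin]
  congr 1
  ext1 n
  rw [divPow_ad]

lemma Commute.expEnd_right {a b : Module.End ℚ V} (ha : LocNil a) (h : Commute b a) :
    Commute b (expEnd a) := by
  rw [Commute, SemiconjBy, expEnd, ← sumEnd_mul_left ha.locFin, ← sumEnd_mul_right ha.locFin]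
  congr 1
  ext1 n
  rw [divPow, mul_smul_comm, smul_mul_assoc, (h.pow_right n).eq]

lemma divPow_conj {w w' : Module.End ℚ V} (h : w' * w = 1) (h' : w * w' = 1)
    (b : Module.End ℚ V) (n : ℕ) : divPow (w * b * w') n = w * divPow b n * w' := by
  have : ∀ n : ℕ, (w * b * w') ^ n = w * b ^ n * w' := fun n => by
    induction n with
    | zero => simp [h']
    | succ n ih =>
      rw [pow_succ, ih, pow_succ]
      calc w * b ^ n * w' * (w * b * w') = w * b ^ n * (w' * w) * b * w' := by noncomm_ring
        _ = w * (b ^ n * b) * w' := by rw [h]; noncomm_ring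
  rw [divPow, this, divPow, mul_smul_comm, smul_mul_assoc]

lemma LocNil.conj {b w w' : Module.End ℚ V} (hb : LocNil b) (h : w' * w = 1) (h' : w * w' = 1) :
    LocNil (w * b * w') := fun x => by
  obtain ⟨n, hn⟩ := hb (w' x)
  refine ⟨n, ?_⟩
  have := divPow_conj h h' b n
  rw [divPow, divPow, mul_smul_comm, smul_mul_assoc] at this
  have h2 := smul_right_injective _ (by positivity : ((n.factorial : ℚ)⁻¹) ≠ 0) this
  rw [h2, Module.End.mul_apply, Module.End.mul_apply, hn, map_zero]

end Exp

/-! ### Reduction of operators on a lattice to a field -/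

section Reduction

open TensorProduct

variable {I V : Type*} [AddCommGroup V] [Module ℚ V] (L : Submodule ℤ V) (k : Type*) [Field k]

/-- The operator `D` maps the lattice `L` into itself. -/
def Stab (D : Module.End ℚ V) : Prop := ∀ x ∈ L, D x ∈ L

open Classical in
/-- The restriction of an operator to a lattice that it stabilizes, and zero for other operators. -/
def restr (D : Module.End ℚ V) : Module.End ℤ L :=
  if h : Stab L D then (D.restrictScalars ℤ).restrict h else 0

/-- The operator on `k ⊗ L` induced by an operator that stabilizes the lattice `L`. -/
def redOp (D : Module.End ℚ V) : Module.End k (k ⊗[ℤ] L) := (restr L D).baseChange k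

variable {L k}

lemma restr_apply {D : Module.End ℚ V} (h : Stab L D) (x : L) : restr L D x = ⟨D x, h x x.2⟩ := by
  rw [restr, dif_pos h]
  rfl

lemma coe_restr_apply {D : Module.End ℚ V} (h : Stab L D) (x : L) : (restr L D x : V) = D x := by
  rw [restr_apply h]

lemma Stab.one : Stab L (1 : Module.End ℚ V) := fun _ hx => hx

lemma Stab.mul {D D' : Module.End ℚ V} (h : Stab L D) (h' : Stab L D') : Stab L (D * D') :=
  fun x hx => h _ (h' x hx)

lemma Stab.sum {J : Type*} {s : Finset J} {D : J → Module.End ℚ V} (h : ∀ j ∈ s, Stab L (D j)) :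
    Stab L (∑ j ∈ s, D j) := fun x hx => by
  rw [LinearMap.sum_apply]
  exact L.sum_mem fun j hj => h j hj x hx

lemma Stab.intCast_smul {D : Module.End ℚ V} (h : Stab L D) (c : ℤ) : Stab L ((c : ℚ) • D) :=
  fun x hx => by
  rw [LinearMap.smul_apply, Int.cast_smul_eq_zsmul]
  exact L.smul_mem c (h x hx)

lemma restr_one : restr L (1 : Module.End ℚ V) = 1 := by
  ext x
  rw [coe_restr_apply Stab.one]
  rfl

lemma restr_mul {D D' : Module.End ℚ V} (h : Stab L D) (h' : Stab L D') :
    restr L (D * D') = restr L D * restr L D' := by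
  ext x
  rw [coe_restr_apply (h.mul h'), Module.End.mul_apply, Module.End.mul_apply, coe_restr_apply h,
    coe_restr_apply h']

lemma restr_sum {J : Type*} {s : Finset J} {D : J → Module.End ℚ V}
    (h : ∀ j ∈ s, Stab L (D j)) : restr L (∑ j ∈ s, D j) = ∑ j ∈ s, restr L (D j) := by
  ext x
  rw [coe_restr_apply (Stab.sum h), LinearMap.sum_apply, LinearMap.sum_apply,
    AddSubmonoidClass.coe_finsetSum]
  exact Finset.sum_congr rfl fun j hj => (coe_restr_apply (h j hj) x).symm

lemma redOp_one : redOp L k (1 : Module.End ℚ V) = 1 := by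
  rw [redOp, restr_one]
  exact LinearMap.baseChange_id

lemma redOp_mul {D D' : Module.End ℚ V} (h : Stab L D) (h' : Stab L D') :
    redOp L k (D * D') = redOp L k D * redOp L k D' := by
  rw [redOp, restr_mul h h']
  exact LinearMap.baseChange_comp _ _

lemma redOp_sum {J : Type*} {s : Finset J} {D : J → Module.End ℚ V}
    (h : ∀ j ∈ s, Stab L (D j)) : redOp L k (∑ j ∈ s, D j) = ∑ j ∈ s, redOp L k (D j) := by
  simp only [redOp, restr_sum h]
  exact map_sum (LinearMap.baseChangeHom ℤ k L L) _ _

lemma redOp_tmul {D : Module.End ℚ V} (h : Stab L D) (a : k) (x : L) :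
    redOp L k D (a ⊗ₜ x) = a ⊗ₜ ⟨D x, h x x.2⟩ := by
  rw [redOp, LinearMap.baseChange_tmul, restr_apply h]

lemma redOp_intCast_smul {D : Module.End ℚ V} (h : Stab L D) (c : ℤ) :
    redOp L k ((c : ℚ) • D) = (c : k) • redOp L k D := by
  refine TensorProduct.AlgebraTensorModule.ext fun a x => ?_
  have h1 : (⟨((c : ℚ) • D) x, h.intCast_smul c x x.2⟩ : L) = c • ⟨D x, h x x.2⟩ :=
    Subtype.ext (by simp [Int.cast_smul_eq_zsmul])
  rw [LinearMap.smul_apply, redOp_tmul h, redOp_tmul (h.intCast_smul c), h1, ← smul_tmul,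
    smul_tmul', smul_eq_mul, zsmul_eq_mul]

variable (L) in
/-- A locally finite family of operators that stabilize the lattice `L`. -/
structure LatFin (D : I → Module.End ℚ V) : Prop where
  stab : ∀ i, Stab L (D i)
  locFin : LocFin D

variable (L k) in
/-- The operator `∑ c i • D i` on `k ⊗ L`. -/
def red (c : I → k) (D : I → Module.End ℚ V) : Module.End k (k ⊗[ℤ] L) :=
  sumEnd fun i => c i • redOp L k (D i)

lemma LatFin.red_locFin {D : I → Module.End ℚ V} (hD : LatFin L D) (c : I → k) :
    LocFin fun i => c i • redOp L k (D i) := fun x => by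
  induction x with
  | zero => simp
  | tmul a x =>
    refine (hD.locFin x).subset fun i hi h => hi ?_
    have h0 : (⟨D i x, hD.stab i x x.2⟩ : L) = 0 := Subtype.ext h
    rw [LinearMap.smul_apply, redOp_tmul (hD.stab i), h0, tmul_zero, smul_zero]
  | add x y hx hy =>
    refine (hx.union hy).subset fun i hi => ?_
    by_contra h
    simp only [Set.mem_union, Set.mem_ofPred_eq, not_or, not_not] at h
    exact hi (by rw [map_add, h.1, h.2, add_zero])

lemma LatFin.red_tmul {D : I → Module.End ℚ V} (hD : LatFin L D) (c : I → k) (a : k) (x : L)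
    (s : Finset I) (hs : ∀ i, D i x ≠ 0 → i ∈ s) :
    red L k c D (a ⊗ₜ x) = ∑ i ∈ s, (c i * a) ⊗ₜ ⟨D i x, hD.stab i x x.2⟩ := by
  rw [red, sumEnd_apply_eq_sum (hD.red_locFin c) _ s]
  · refine Finset.sum_congr rfl fun i _ => ?_
    rw [LinearMap.smul_apply, redOp_tmul (hD.stab i), smul_tmul', smul_eq_mul]
  · refine fun i hi => hs i fun h => hi ?_
    have h0 : (⟨D i x, hD.stab i x x.2⟩ : L) = 0 := Subtype.ext h
    rw [LinearMap.smul_apply, redOp_tmul (hD.stab i), h0, tmul_zero, smul_zero]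

lemma LatFin.stab_sumEnd {D : I → Module.End ℚ V} (hD : LatFin L D) : Stab L (sumEnd D) :=
  fun x hx => by
  rw [sumEnd_apply_eq_sum hD.locFin x (hD.locFin x).toFinset (fun i hi => by simpa using hi)]
  exact L.sum_mem fun i _ => hD.stab i x hx

lemma LatFin.red_one {D : I → Module.End ℚ V} (hD : LatFin L D) :
    red L k (fun _ => 1) D = redOp L k (sumEnd D) := by
  refine TensorProduct.AlgebraTensorModule.ext fun a x => ?_
  have hs : ∀ i, D i x ≠ 0 → i ∈ (hD.locFin x).toFinset := fun i hi => by simpa using hi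
  rw [hD.red_tmul _ _ _ _ hs, redOp_tmul hD.stab_sumEnd]
  simp only [one_mul]
  rw [← tmul_sum]
  congr 1
  ext
  rw [AddSubmonoidClass.coe_finsetSum]
  exact (sumEnd_apply_eq_sum hD.locFin _ _ hs).symm

lemma LatFin.mul_left {D : I → Module.End ℚ V} (hD : LatFin L D) {B : Module.End ℚ V}
    (hB : Stab L B) : LatFin L fun i => B * D i :=
  ⟨fun i => hB.mul (hD.stab i), hD.locFin.mul_left B⟩

lemma LatFin.red_mul_left {D : I → Module.End ℚ V} (hD : LatFin L D) {B : Module.End ℚ V}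
    (hB : Stab L B) (c : I → k) :
    red L k c (fun i => B * D i) = redOp L k B * red L k c D := by
  rw [red, red, ← sumEnd_mul_left (hD.red_locFin c)]
  congr 1
  ext1 i
  rw [redOp_mul hB (hD.stab i), mul_smul_comm]

lemma LatFin.red_mul_right {D : I → Module.End ℚ V} (hD : LatFin L D) {B : Module.End ℚ V}
    (hB : Stab L B) (c : I → k) :
    red L k c (fun i => D i * B) = red L k c D * redOp L k B := by
  rw [red, red, ← sumEnd_mul_right (hD.red_locFin c)]
  congr 1
  ext1 i
  rw [redOp_mul (hD.stab i) hB, smul_mul_assoc]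

section SeriesMul

variable [AddCommMonoid I] [Finset.HasAntidiagonal I]

lemma LatFin.seriesMul {D D' : I → Module.End ℚ V} (hD : LatFin L D) (hD' : LatFin L D') :
    LatFin L (seriesMul D D') :=
  ⟨fun _ => Stab.sum fun p _ => (hD.stab p.1).mul (hD'.stab p.2), hD.locFin.seriesMul hD'.locFin⟩

lemma LatFin.red_seriesMul {D D' : I → Module.End ℚ V} (hD : LatFin L D) (hD' : LatFin L D')
    {c : I → k} (hc : ∀ i j, c (i + j) = c i * c j) :
    red L k c (KacMoody.seriesMul D D') = red L k c D * red L k c D' := by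
  rw [red, red, red, ← sumEnd_seriesMul (hD.red_locFin c) (hD'.red_locFin c)]
  congr 1
  ext1 d
  rw [KacMoody.seriesMul, KacMoody.seriesMul,
    redOp_sum fun p _ => (hD.stab p.1).mul (hD'.stab p.2), Finset.smul_sum]
  refine Finset.sum_congr rfl fun p hp => ?_
  rw [redOp_mul (hD.stab _) (hD'.stab _), smul_mul_smul_comm, ← hc,
    Finset.HasAntidiagonal.mem_antidiagonal.1 hp]

end SeriesMul

end Reduction

/-! ### One-parameter groups over a field -/

section OneParameter

open TensorProduct

variable {V : Type*} [AddCommGroup V] [Module ℚ V] (L : Submodule ℤ V) {k : Type*} [Field k]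

/-- The operators `a` on `V` for which `exp (r a)` makes sense on `k ⊗ L`: they are locally
nilpotent, and their divided powers stabilize `L`. -/
structure Integrable (a : Module.End ℚ V) : Prop where
  locNil : LocNil a
  stab : ∀ n, Stab L (divPow a n)

/-- The operator `exp (r a) = ∑ r ^ n a ^ n / n!` on `k ⊗ L`. -/
def redExp (a : Module.End ℚ V) (r : k) : Module.End k (k ⊗[ℤ] L) :=
  red L k (fun n => r ^ n) (divPow a)

variable {L}

lemma Integrable.latFin {a : Module.End ℚ V} (ha : Integrable L a) : LatFin L (divPow a) :=
  ⟨ha.stab, ha.locNil.locFin⟩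

lemma Integrable.intCast_smul {a : Module.End ℚ V} (ha : Integrable L a) (c : ℤ) :
    Integrable L ((c : ℚ) • a) :=
  ⟨ha.locNil.smul c, fun n => by
    rw [divPow_smul, ← Int.cast_pow]
    exact (ha.stab n).intCast_smul _⟩

lemma Integrable.neg {a : Module.End ℚ V} (ha : Integrable L a) : Integrable L (-a) := by
  simpa using ha.intCast_smul (-1)

lemma Integrable.conj {a w w' : Module.End ℚ V} (ha : Integrable L a) (h : w' * w = 1)
    (h' : w * w' = 1) (hw : Stab L w) (hw' : Stab L w') : Integrable L (w * a * w') :=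
  ⟨ha.locNil.conj h h', fun n => by
    rw [divPow_conj h h']
    exact (hw.mul (ha.stab n)).mul hw'⟩

lemma redExp_intCast_smul {a : Module.End ℚ V} (ha : Integrable L a) (c : ℤ) (r : k) :
    redExp L ((c : ℚ) • a) r = redExp L a (c * r) := by
  rw [redExp, redExp, red, red]
  congr 1
  ext1 n
  rw [divPow_smul, ← Int.cast_pow, redOp_intCast_smul (ha.stab n), smul_smul, mul_pow]
  push_cast
  rw [mul_comm]

lemma redExp_neg {a : Module.End ℚ V} (ha : Integrable L a) (r : k) :
    redExp L (-a) r = redExp L a (-r) := by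
  simpa using redExp_intCast_smul ha (-1) r

lemma redExp_one {a : Module.End ℚ V} (ha : Integrable L a) :
    redExp L a (1 : k) = redOp L k (expEnd a) := by
  simp only [redExp, one_pow]
  exact ha.latFin.red_one

lemma Integrable.stab_expEnd {a : Module.End ℚ V} (ha : Integrable L a) : Stab L (expEnd a) :=
  ha.latFin.stab_sumEnd

lemma redExp_zero {a : Module.End ℚ V} (ha : Integrable L a) : redExp L a (0 : k) = 1 := by
  refine TensorProduct.AlgebraTensorModule.ext fun b x => ?_
  obtain ⟨n, hn⟩ := ha.locNil x
  rw [redExp, ha.latFin.red_tmul _ _ _ (Finset.range (n + 1)), Finset.sum_range_succ']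
  · simp
  · intro i hi
    by_contra h
    refine hi ?_
    simp only [Finset.mem_range, not_lt] at h
    rw [divPow, LinearMap.smul_apply, Module.End.pow_map_zero_of_le (by omega) hn, smul_zero]

lemma redExp_add {a : Module.End ℚ V} (ha : Integrable L a) (r s : k) :
    redExp L a (r + s) = redExp L a r * redExp L a s := by
  rw [redExp, redExp, redExp, red, red, red,
    ← sumEnd_seriesMul (ha.latFin.red_locFin _) (ha.latFin.red_locFin _)]
  congr 1
  ext1 n
  rw [seriesMul, add_pow, Finset.Nat.sum_antidiagonal_eq_sum_range_succ_mk, Finset.sum_smul]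
  refine Finset.sum_congr rfl fun i hi => ?_
  have hi' : i + (n - i) = n := by
    have := Finset.mem_range.1 hi
    omega
  rw [smul_mul_smul_comm, ← redOp_mul (ha.stab _) (ha.stab _), divPow_mul, hi']
  have := redOp_intCast_smul (k := k) (ha.stab n) (n.choose i)
  push_cast at this
  rw [this, smul_smul]

lemma redExp_conj {a w w' : Module.End ℚ V} (ha : Integrable L a) (h : w' * w = 1)
    (h' : w * w' = 1) (hw : Stab L w) (hw' : Stab L w') (r : k) :
    redExp L (w * a * w') r = redOp L k w * redExp L a r * redOp L k w' := by
  rw [redExp, redExp, ← ha.latFin.red_mul_left hw, ← (ha.latFin.mul_left hw).red_mul_right hw']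
  congr 1
  ext1 n
  rw [divPow_conj h h']

/-- The operator `exp (r a)` as an invertible operator. -/
def redExpUnit {a : Module.End ℚ V} (ha : Integrable L a) (r : k) :
    (Module.End k (k ⊗[ℤ] L))ˣ where
  val := redExp L a r
  inv := redExp L a (-r)
  val_inv := by rw [← redExp_add ha, add_neg_cancel, redExp_zero ha]
  inv_val := by rw [← redExp_add ha, neg_add_cancel, redExp_zero ha]

end OneParameter

/-! ### The Chevalley generators of the Kac-Moody Lie algebra -/

section LieAlgebra

open CartanMatrix

variable {ι : Type} [DecidableEq ι] (A : Matrix ι ι ℤ)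

/-- The quotient map from the free Lie algebra. -/
def lieMk : FreeLieAlgebra ℚ (Generators ι) →ₗ⁅ℚ⁆ LieAlg A :=
  { toFun := fun x => (LieSubmodule.Quotient.mk x :
      FreeLieAlgebra ℚ (Generators ι) ⧸ Relations.toIdeal ℚ A)
    map_add' := fun _ _ => rfl
    map_smul' := fun _ _ => rfl
    map_lie' := fun {_ _} => rfl }

lemma lieMk_surjective : Function.Surjective (lieMk A) :=
  fun y => Quot.inductionOn y fun x => ⟨x, rfl⟩

lemma lieMk_eq_zero {x : FreeLieAlgebra ℚ (Generators ι)} (hx : x ∈ Relations.toSet ℚ A) :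
    lieMk A x = 0 :=
  (LieSubmodule.Quotient.mk_eq_zero' (N := Relations.toIdeal ℚ A)).2
    (LieSubmodule.subset_lieSpan hx)

lemma lieMk_E (i : ι) : lieMk A (FreeLieAlgebra.of ℚ (Generators.E i)) = lieE A i := rfl

lemma lieMk_F (i : ι) : lieMk A (FreeLieAlgebra.of ℚ (Generators.F i)) = lieF A i := rfl

/-- The Cartan element `h i`. -/
def lieH (i : ι) : LieAlg A := lieMk A (FreeLieAlgebra.of ℚ (Generators.H i))

lemma lie_lieE_lieF (i : ι) : ⁅lieE A i, lieF A i⁆ = lieH A i := by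
  have := lieMk_eq_zero A (x := Relations.EF ℚ (i, i)) (by
    simp only [Relations.toSet]
    refine Or.inl (Or.inl (Or.inl (Or.inl (Or.inr ⟨(i, i), rfl⟩))))
  )
  simp only [Relations.EF, Function.uncurry_apply_pair, if_true, map_sub, LieHom.map_lie,
    Function.comp_apply, lieMk_E, lieMk_F] at this
  exact sub_eq_zero.1 this

lemma lie_lieE_lieF_of_ne {i j : ι} (hij : i ≠ j) : ⁅lieE A i, lieF A j⁆ = 0 := by
  have := lieMk_eq_zero A (x := Relations.EF ℚ (i, j)) (by
    simp only [Relations.toSet]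
    refine Or.inl (Or.inl (Or.inl (Or.inl (Or.inr ⟨(i, j), rfl⟩)))))
  simpa only [Relations.EF, Function.uncurry_apply_pair, if_neg hij, LieHom.map_lie,
    Function.comp_apply, lieMk_E, lieMk_F] using this

lemma lie_lieH_lieE (i j : ι) : ⁅lieH A i, lieE A j⁆ = A i j • lieE A j := by
  have := lieMk_eq_zero A (x := Relations.HE ℚ A (i, j)) (by
    simp only [Relations.toSet]
    refine Or.inl (Or.inl (Or.inl (Or.inr ⟨(i, j), rfl⟩))))
  simp only [Relations.HE, Function.uncurry_apply_pair, map_sub, LieHom.map_lie, map_zsmul,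
    Function.comp_apply, lieMk_E] at this
  exact sub_eq_zero.1 this

lemma lie_lieH_lieF (i j : ι) : ⁅lieH A i, lieF A j⁆ = -(A i j • lieF A j) := by
  have := lieMk_eq_zero A (x := Relations.HF ℚ A (i, j)) (by
    simp only [Relations.toSet]
    refine Or.inl (Or.inl (Or.inr ⟨(i, j), rfl⟩)))
  simp only [Relations.HF, Function.uncurry_apply_pair, map_add, LieHom.map_lie, map_zsmul,
    Function.comp_apply, lieMk_F] at this
  exact eq_neg_of_add_eq_zero_left this

lemma map_ad_pow {L L' : Type*} [LieRing L] [LieAlgebra ℚ L] [LieRing L'] [LieAlgebra ℚ L']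
    (f : L →ₗ⁅ℚ⁆ L') (x y : L) (n : ℕ) :
    f ((LieAlgebra.ad ℚ L x ^ n) y) = (LieAlgebra.ad ℚ L' (f x) ^ n) (f y) := by
  induction n with
  | zero => simp
  | succ n ih =>
    rw [pow_succ', Module.End.mul_apply, pow_succ', Module.End.mul_apply, ← ih]
    simp

lemma ad_lieE_pow (i j : ι) :
    (LieAlgebra.ad ℚ (LieAlg A) (lieE A i) ^ ((-A i j).toNat + 1)) (lieE A j) = 0 := by
  have := lieMk_eq_zero A (x := Relations.adE ℚ A (i, j)) (by
    simp only [Relations.toSet]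
    refine Or.inl (Or.inr ⟨(i, j), rfl⟩))
  simp only [Relations.adE, Function.uncurry_apply_pair, map_ad_pow, LieHom.map_lie,
    Function.comp_apply, lieMk_E] at this
  rwa [pow_succ, Module.End.mul_apply, LieAlgebra.ad_apply]

lemma ad_lieF_pow (i j : ι) :
    (LieAlgebra.ad ℚ (LieAlg A) (lieF A i) ^ ((-A i j).toNat + 1)) (lieF A j) = 0 := by
  have := lieMk_eq_zero A (x := Relations.adF ℚ A (i, j)) (by
    simp only [Relations.toSet]
    refine Or.inr ⟨(i, j), rfl⟩)
  simp only [Relations.adF, Function.uncurry_apply_pair, map_ad_pow, LieHom.map_lie,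
    Function.comp_apply, lieMk_F] at this
  rwa [pow_succ, Module.End.mul_apply, LieAlgebra.ad_apply]

/-- The Kac-Moody Lie algebra is generated by the `e i` and the `f i`. -/
lemma lieSubalgebra_eq_top (K : LieSubalgebra ℚ (LieAlg A)) (hE : ∀ i, lieE A i ∈ K)
    (hF : ∀ i, lieF A i ∈ K) : K = ⊤ := by
  have hg : ∀ x : Generators ι, lieMk A (FreeLieAlgebra.of ℚ x) ∈ K := by
    rintro (i | i | i)
    · have := K.lie_mem (hE i) (hF i)
      rwa [lie_lieE_lieF] at this
    · exact hE i
    · exact hF i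
  have h : lieMk A = K.incl.comp (FreeLieAlgebra.lift ℚ fun x => (⟨_, hg x⟩ : K)) := by
    refine FreeLieAlgebra.hom_ext fun x => ?_
    rw [LieHom.comp_apply, FreeLieAlgebra.lift_of_apply]
    rfl
  rw [eq_top_iff]
  rintro y -
  obtain ⟨x, rfl⟩ := lieMk_surjective A y
  rw [h]
  exact Subtype.property _

variable {A}

lemma ad_lieE_nilpotent (h2 : ∀ i, A i i = 2) (i : ι) (y : LieAlg A) :
    ∃ n : ℕ, (LieAlgebra.ad ℚ (LieAlg A) (lieE A i) ^ n) y = 0 := by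
  have : LieSubalgebra.engel ℚ (lieE A i) = ⊤ := by
    refine lieSubalgebra_eq_top A _ (fun j => ?_) fun j => ?_
    · exact (LieSubalgebra.mem_engel_iff ..).2 ⟨_, ad_lieE_pow A i j⟩
    · refine (LieSubalgebra.mem_engel_iff ..).2 ⟨3, ?_⟩
      rcases eq_or_ne i j with rfl | hij
      · have h3 : ⁅lieE A i, lieH A i⁆ = -((2 : ℤ) • lieE A i) := by
          rw [← lie_skew, lie_lieH_lieE, h2]
        simp [pow_succ, Module.End.mul_apply, lie_lieE_lieF, h3]
      · simp [pow_succ, Module.End.mul_apply, lie_lieE_lieF_of_ne A hij]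
  exact (LieSubalgebra.mem_engel_iff ..).1 (this ▸ LieSubalgebra.mem_top y)

lemma ad_lieF_nilpotent (h2 : ∀ i, A i i = 2) (i : ι) (y : LieAlg A) :
    ∃ n : ℕ, (LieAlgebra.ad ℚ (LieAlg A) (lieF A i) ^ n) y = 0 := by
  have : LieSubalgebra.engel ℚ (lieF A i) = ⊤ := by
    refine lieSubalgebra_eq_top A _ (fun j => ?_) fun j => ?_
    · refine (LieSubalgebra.mem_engel_iff ..).2 ⟨3, ?_⟩
      have h4 : ⁅lieF A i, lieE A j⁆ = -⁅lieE A j, lieF A i⁆ := by rw [lie_skew]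
      rcases eq_or_ne i j with rfl | hij
      · have h3 : ⁅lieF A i, lieH A i⁆ = (2 : ℤ) • lieF A i := by
          rw [← lie_skew, lie_lieH_lieF, h2, neg_neg]
        simp [pow_succ, Module.End.mul_apply, h4, lie_lieE_lieF, h3]
      · simp [pow_succ, Module.End.mul_apply, h4, lie_lieE_lieF_of_ne A hij.symm]
    · exact (LieSubalgebra.mem_engel_iff ..).2 ⟨_, ad_lieF_pow A i j⟩
  exact (LieSubalgebra.mem_engel_iff ..).1 (this ▸ LieSubalgebra.mem_top y)

lemma expAd_eq_sum {x y : LieAlg A} {n : ℕ} (h : (LieAlgebra.ad ℚ (LieAlg A) x ^ n) y = 0) :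
    expAd A x y = ∑ m ∈ Finset.range n,
      ((m.factorial : ℚ)⁻¹) • ((LieAlgebra.ad ℚ (LieAlg A) x ^ m) y) := by
  rw [expAd, finsum_eq_sum_of_support_subset]
  intro m hm
  by_contra h'
  simp only [Finset.coe_range, Set.mem_Iio, not_lt] at h'
  exact hm (by simp [Module.End.pow_map_zero_of_le h' h])

lemma expAd_eq_of_cube {x y : LieAlg A} (h : ⁅x, ⁅x, ⁅x, y⁆⁆⁆ = 0) :
    expAd A x y = y + ⁅x, y⁆ + (2 : ℚ)⁻¹ • ⁅x, ⁅x, y⁆⁆ := by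
  rw [expAd_eq_sum (n := 3) (by simp [pow_succ, Module.End.mul_apply, h])]
  simp [Finset.sum_range_succ, pow_succ, Module.End.mul_apply]

section SL2Triple

variable (h2 : ∀ i, A i i = 2) (i : ι)
include h2

lemma lie_lieE_lieH : ⁅lieE A i, lieH A i⁆ = -((2 : ℚ) • lieE A i) := by
  rw [← lie_skew, lie_lieH_lieE, h2, ← Int.cast_smul_eq_zsmul ℚ]
  simp

lemma lie_lieF_lieH : ⁅lieF A i, lieH A i⁆ = (2 : ℚ) • lieF A i := by
  rw [← lie_skew, lie_lieH_lieF, h2, neg_neg, ← Int.cast_smul_eq_zsmul ℚ]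
  simp

lemma reflLie_lieE : reflLie A i (lieE A i) = -lieF A i := by
  have hEH := lie_lieE_lieH h2 i
  have hFH := lie_lieF_lieH h2 i
  have hEF := lie_lieE_lieF A i
  have hFE : ⁅lieF A i, lieE A i⁆ = -lieH A i := by rw [← lie_skew, hEF]
  have h1 : expAd A (lieE A i) (lieE A i) = lieE A i := by
    rw [expAd_eq_of_cube] <;> simp
  have h3 : expAd A (-lieF A i) (lieE A i) = lieE A i + lieH A i - lieF A i := by
    rw [expAd_eq_of_cube]
    · simp only [neg_lie, lie_neg, hFE, hFH]
      module
    · simp [hFE, hFH]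
  have h4 : ⁅lieE A i, lieE A i + lieH A i - lieF A i⁆ = -((2 : ℚ) • lieE A i) - lieH A i := by
    rw [lie_sub, lie_add, lie_self, hEH, hEF, zero_add]
  have h5 : ⁅lieE A i, -((2 : ℚ) • lieE A i) - lieH A i⁆ = (2 : ℚ) • lieE A i := by
    rw [lie_sub, lie_neg, lie_smul, lie_self, hEH]
    simp
  rw [reflLie, h1, h3, expAd_eq_of_cube] <;> rw [h4, h5]
  · module
  · simp

lemma reflLie_lieH : reflLie A i (lieH A i) = -lieH A i := by
  have hEH := lie_lieE_lieH h2 i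
  have hFH := lie_lieF_lieH h2 i
  have hEF := lie_lieE_lieF A i
  have hFE : ⁅lieF A i, lieE A i⁆ = -lieH A i := by rw [← lie_skew, hEF]
  have h1 : expAd A (lieE A i) (lieH A i) = lieH A i - (2 : ℚ) • lieE A i := by
    rw [expAd_eq_of_cube] <;> simp [hEH, sub_eq_add_neg]
  have h3 : ⁅-lieF A i, lieH A i - (2 : ℚ) • lieE A i⁆ =
      -((2 : ℚ) • lieF A i) - (2 : ℚ) • lieH A i := by
    rw [neg_lie, lie_sub, lie_smul, hFH, hFE]
    module
  have h4 : ⁅-lieF A i, -((2 : ℚ) • lieF A i) - (2 : ℚ) • lieH A i⁆ = (4 : ℚ) • lieF A i := by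
    rw [neg_lie, lie_sub, lie_neg, lie_smul, lie_smul, hFH, lie_self]
    module
  have h5 : expAd A (-lieF A i) (lieH A i - (2 : ℚ) • lieE A i) =
      -lieH A i - (2 : ℚ) • lieE A i := by
    rw [expAd_eq_of_cube] <;> rw [h3, h4]
    · module
    · simp
  have h6 : ⁅lieE A i, -lieH A i - (2 : ℚ) • lieE A i⁆ = (2 : ℚ) • lieE A i := by
    rw [lie_sub, lie_neg, lie_smul, lie_self, hEH]
    simp
  rw [reflLie, h1, h5, expAd_eq_of_cube] <;> rw [h6]
  · simp
  · simp

end SL2Triple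

lemma map_expAd {V : Type*} [AddCommGroup V] [Module ℚ V] (ρ : LieAlg A →ₗ⁅ℚ⁆ Module.End ℚ V)
    {x y : LieAlg A} (hx : LocNil (ρ x))
    (h : ∃ n : ℕ, (LieAlgebra.ad ℚ (LieAlg A) x ^ n) y = 0) :
    ρ (expAd A x y) = expEnd (ρ x) * ρ y * expEnd (-ρ x) := by
  obtain ⟨n, hn⟩ := h
  have h0 : ∀ m, n ≤ m → (LieAlgebra.ad ℚ (Module.End ℚ V) (ρ x) ^ m) (ρ y) = 0 := fun m hm => by
    rw [← map_ad_pow, Module.End.pow_map_zero_of_le hm hn, map_zero]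
  have hmem : ∀ m v, ((m.factorial : ℚ)⁻¹ •
      (LieAlgebra.ad ℚ (Module.End ℚ V) (ρ x) ^ m) (ρ y)) v ≠ 0 → m ∈ Finset.range n :=
    fun m v hm => by
    by_contra h'
    simp only [Finset.mem_range, not_lt] at h'
    exact hm (by rw [h0 m h', smul_zero, LinearMap.zero_apply])
  rw [expEnd_conj hx, expAd_eq_sum hn, map_sum]
  ext v
  rw [sumEnd_apply_eq_sum (fun v => (Finset.range n).finite_toSet.subset fun m hm => hmem m v hm)
    v (Finset.range n) fun m hm => hmem m v hm, LinearMap.sum_apply]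
  refine Finset.sum_congr rfl fun m _ => ?_
  rw [map_smul, map_ad_pow]

end LieAlgebra

/-! ### Commutator formulas and reduction to a field -/

section PowerSeries

variable {V : Type*} [AddCommGroup V] [Module ℚ V] {L : Submodule ℤ V} {k : Type*} [Field k]

lemma sumEnd_reindex {I J R M : Type*} [CommRing R] [AddCommGroup M] [Module R M] {f : J → I}
    (hf : Function.Injective f) {D : I → Module.End R M} {D' : J → Module.End R M}
    (hD' : LocFin D') (h : ∀ j, D (f j) = D' j) (h0 : ∀ i, i ∉ Set.range f → D i = 0) :
    LocFin D ∧ sumEnd D = sumEnd D' := by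
  classical
  have key : ∀ x i, D i x ≠ 0 → i ∈ ((hD' x).toFinset.map ⟨f, hf⟩) := fun x i hi => by
    by_cases hr : i ∈ Set.range f
    · obtain ⟨j, rfl⟩ := hr
      rw [h] at hi
      exact Finset.mem_map.2 ⟨j, by simpa using hi, rfl⟩
    · rw [h0 i hr] at hi
      exact absurd rfl hi
  have hD : LocFin D := fun x =>
    ((hD' x).toFinset.map ⟨f, hf⟩).finite_toSet.subset fun i hi => key x i hi
  refine ⟨hD, ?_⟩
  ext x
  rw [sumEnd_apply_eq_sum hD x _ (key x), Finset.sum_map,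
    sumEnd_apply_eq_sum hD' x (hD' x).toFinset fun i hi => by simpa using hi]
  exact Finset.sum_congr rfl fun j _ => by rw [Function.Embedding.coeFn_mk, h]

/-- A power series in two variables as a family of coefficients. -/
def coeffs {U : Type*} (f : MvPowerSeries (Fin 2) U) : (Fin 2 →₀ ℕ) → U := f

lemma coeffs_mul {U : Type*} [Semiring U] (f g : MvPowerSeries (Fin 2) U) :
    coeffs (f * g) = seriesMul (coeffs f) (coeffs g) := by
  ext1 d
  exact MvPowerSeries.coeff_mul _ _ _

lemma map_expSeries {U : Type} [Ring U] [Algebra ℚ U] {U' : Type*} [Ring U'] [Algebra ℚ U']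
    (f : U →ₐ[ℚ] U') (u : U) (p q : ℕ) (d : Fin 2 →₀ ℕ) :
    f (coeffs (expSeries u p q) d) = ∑ n ∈ Finset.range (d 0 + d 1 + 1),
      if d 0 = n * p ∧ d 1 = n * q then divPow (f u) n else 0 := by
  rw [coeffs, expSeries, map_sum]
  refine Finset.sum_congr rfl fun n _ => ?_
  split_ifs
  · rw [map_smul, map_pow, divPow]
  · rw [map_zero]

variable {U : Type} [Ring U] [Algebra ℚ U] (f : U →ₐ[ℚ] Module.End ℚ V)

/-- The coefficients of the image of a power series in the operators on `V`. -/
def opCoeffs (P : MvPowerSeries (Fin 2) U) (d : Fin 2 →₀ ℕ) : Module.End ℚ V := f (coeffs P d)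

lemma opCoeffs_mul (P Q : MvPowerSeries (Fin 2) U) :
    opCoeffs f (P * Q) = seriesMul (opCoeffs f P) (opCoeffs f Q) := by
  ext1 d
  rw [opCoeffs, coeffs_mul, seriesMul, map_sum, seriesMul]
  exact Finset.sum_congr rfl fun p _ => map_mul _ _ _

/-- The value of the monomial `X^i Y^j` at `(r, s)`. -/
def monomialValue (r s : k) (d : Fin 2 →₀ ℕ) : k := r ^ d 0 * s ^ d 1

lemma monomialValue_add (r s : k) (d d' : Fin 2 →₀ ℕ) :
    monomialValue r s (d + d') = monomialValue r s d * monomialValue r s d' := by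
  simp only [monomialValue, Finsupp.add_apply, pow_add]
  ring

lemma opCoeffs_one : LatFin L (opCoeffs f 1) ∧
    ∀ r s : k, red L k (monomialValue r s) (opCoeffs f 1) = 1 := by
  classical
  have h1 : ∀ d, opCoeffs f 1 d = if d = 0 then 1 else 0 := fun d => by
    have : coeffs (1 : MvPowerSeries (Fin 2) U) d = if d = 0 then 1 else 0 :=
      MvPowerSeries.coeff_one d
    rw [opCoeffs, this]
    split_ifs <;> simp
  have hfin : LatFin L (opCoeffs f 1) := by
    refine ⟨fun d x hx => ?_, fun x => (Set.finite_singleton 0).subset fun d hd => ?_⟩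
    · rw [h1]
      split_ifs
      · exact hx
      · exact L.zero_mem
    · by_contra h
      refine hd ?_
      rw [h1, if_neg (by simpa using h), LinearMap.zero_apply]
  refine ⟨hfin, fun r s => TensorProduct.AlgebraTensorModule.ext fun a x => ?_⟩
  rw [hfin.red_tmul _ _ _ {0} fun d hd => ?_]
  · simp [monomialValue, h1]
  · by_contra h
    refine hd ?_
    rw [h1, if_neg (by simpa using h), LinearMap.zero_apply]

lemma opCoeffs_expSeries {u : U} (hu : Integrable L (f u)) {p q : ℕ} (hpq : 0 < p ∨ 0 < q) :
    LatFin L (opCoeffs f (expSeries u p q)) ∧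
    ∀ r s : k, red L k (monomialValue r s) (opCoeffs f (expSeries u p q)) =
      redExp L (f u) (r ^ p * s ^ q) := by
  classical
  let e : ℕ → Fin 2 →₀ ℕ := fun n => Finsupp.equivFunOnFinite.symm ![n * p, n * q]
  have e0 : ∀ n, e n 0 = n * p := fun n => rfl
  have e1 : ∀ n, e n 1 = n * q := fun n => rfl
  have he : Function.Injective e := fun m n hmn => by
    have h0 := DFunLike.congr_fun hmn 0
    have h1 := DFunLike.congr_fun hmn 1
    rw [e0, e0] at h0
    rw [e1, e1] at h1
    rcases hpq with h | h
    · exact Nat.eq_of_mul_eq_mul_right h h0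
    · exact Nat.eq_of_mul_eq_mul_right h h1
  have hcoef : ∀ n, opCoeffs f (expSeries u p q) (e n) = divPow (f u) n := fun n => by
    rw [opCoeffs, map_expSeries, Finset.sum_eq_single n]
    · rw [if_pos ⟨e0 n, e1 n⟩]
    · intro m _ hm
      rw [if_neg]
      rintro ⟨h0, h1⟩
      refine hm (he (Finsupp.ext fun j => ?_)).symm
      fin_cases j
      · exact h0
      · exact h1
    · intro hn
      refine absurd (Finset.mem_range.2 ?_) hn
      rw [e0, e1]
      rcases hpq with h | h <;> nlinarith
  have hzero : ∀ d, d ∉ Set.range e → opCoeffs f (expSeries u p q) d = 0 := fun d hd => by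
    rw [opCoeffs, map_expSeries]
    refine Finset.sum_eq_zero fun n _ => ?_
    rw [if_neg]
    rintro ⟨h0, h1⟩
    refine hd ⟨n, Finsupp.ext fun j => ?_⟩
    fin_cases j
    · exact h0.symm
    · exact h1.symm
  refine ⟨⟨fun d => ?_, (sumEnd_reindex he hu.locNil.locFin hcoef hzero).1⟩, fun r s => ?_⟩
  · by_cases hd : d ∈ Set.range e
    · obtain ⟨n, rfl⟩ := hd
      rw [hcoef]
      exact hu.stab n
    · rw [hzero d hd]
      exact fun _ _ => L.zero_mem
  · rw [red, redExp, red]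
    refine (sumEnd_reindex he (hu.latFin.red_locFin _) (fun n => ?_) fun d hd => ?_).2
    · rw [hcoef, monomialValue, e0, e1, mul_pow, ← pow_mul, ← pow_mul, mul_comm p, mul_comm q]
    · have h0 : redOp L k (0 : Module.End ℚ V) = 0 := by
        have hs : Stab L (0 : Module.End ℚ V) := fun _ _ => L.zero_mem
        simpa using redOp_intCast_smul (k := k) hs 0
      rw [hzero d hd, h0, smul_zero]

end PowerSeries

section CommFormula

variable {ι : Type} [DecidableEq ι] [Fintype ι] {A : Matrix ι ι ℤ}
variable {V : Type*} [AddCommGroup V] [Module ℚ V] {L : Submodule ℤ V} {k : Type*} [Field k]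

/-- A commutator formula in the power series over the enveloping algebra holds for the operators
`exp (r z)` on `k ⊗ L`. -/
lemma CommFormula.redExp_eq {ρ : LieAlg A →ₗ⁅ℚ⁆ Module.End ℚ V} {v w : ι → ℤ} {x y : LieAlg A}
    {l : List (Factor A)} (hl : CommFormula A v x w y l) (hx : Integrable L (ρ x))
    (hy : Integrable L (ρ y)) (hz : ∀ g ∈ l, Integrable L (ρ g.z)) (r s : k) :
    redExp L (ρ x) r * redExp L (ρ y) s * redExp L (ρ x) (-r) * redExp L (ρ y) (-s) =
      (l.map fun g => redExp L (ρ g.z) ((g.c : k) * r ^ g.p * s ^ g.q)).prod := by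
  let f : UniversalEnvelopingAlgebra ℚ (LieAlg A) →ₐ[ℚ] Module.End ℚ V :=
    UniversalEnvelopingAlgebra.lift ℚ ρ
  have hf : ∀ z, f (toU A z) = ρ z := fun z => UniversalEnvelopingAlgebra.lift_ι_apply ℚ ρ z
  have hf' : ∀ z, f (-toU A z) = -ρ z := fun z => by rw [map_neg, hf]
  have hc := monomialValue_add r s
  obtain ⟨hx1, hx2⟩ := opCoeffs_expSeries (k := k) f (u := toU A x) (by rwa [hf])
    (Or.inl Nat.one_pos : 0 < 1 ∨ 0 < 0)
  obtain ⟨hy1, hy2⟩ := opCoeffs_expSeries (k := k) f (u := toU A y) (by rwa [hf])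
    (Or.inr Nat.one_pos : 0 < 0 ∨ 0 < 1)
  obtain ⟨hx3, hx4⟩ := opCoeffs_expSeries (k := k) f (u := -toU A x)
    (by rw [hf']; exact hx.neg) (Or.inl Nat.one_pos : 0 < 1 ∨ 0 < 0)
  obtain ⟨hy3, hy4⟩ := opCoeffs_expSeries (k := k) f (u := -toU A y)
    (by rw [hf']; exact hy.neg) (Or.inr Nat.one_pos : 0 < 0 ∨ 0 < 1)
  have hprod : ∀ l : List (Factor A),
      (∀ g ∈ l, (0 < g.p) ∧ Integrable L (ρ g.z)) →
      LatFin L (opCoeffs f (l.map fun g => expSeries ((g.c : ℚ) • toU A g.z) g.p g.q).prod) ∧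
      red L k (monomialValue r s)
        (opCoeffs f (l.map fun g => expSeries ((g.c : ℚ) • toU A g.z) g.p g.q).prod) =
      (l.map fun g => redExp L (ρ g.z) ((g.c : k) * r ^ g.p * s ^ g.q)).prod := by
    intro l hl
    induction l with
    | nil =>
      have := opCoeffs_one (L := L) (k := k) f
      exact ⟨this.1, this.2 r s⟩
    | cons g l ih =>
      have hg := hl g (List.mem_cons_self ..)
      have ih := ih fun g' hg' => hl g' (List.mem_cons_of_mem _ hg')
      obtain ⟨hg1, hg2⟩ := opCoeffs_expSeries (k := k) f (u := (g.c : ℚ) • toU A g.z)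
        (by rw [map_smul, hf]; exact hg.2.intCast_smul g.c) (Or.inl hg.1 : 0 < g.p ∨ 0 < g.q)
      rw [List.map_cons, List.prod_cons, List.map_cons, List.prod_cons, opCoeffs_mul]
      refine ⟨hg1.seriesMul ih.1, ?_⟩
      rw [hg1.red_seriesMul ih.1 hc, ih.2, hg2, map_smul, hf, redExp_intCast_smul hg.2, mul_assoc]
  rw [← (hprod l fun g hg => ⟨(hl.1 g hg).1, hz g hg⟩).2, ← hl.2, opCoeffs_mul, opCoeffs_mul,
    opCoeffs_mul, LatFin.red_seriesMul ((hx1.seriesMul hy1).seriesMul hx3) hy3 hc,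
    LatFin.red_seriesMul (hx1.seriesMul hy1) hx3 hc, LatFin.red_seriesMul hx1 hy1 hc,
    hx2, hy2, hx4, hy4, hf, hf, hf', hf', redExp_neg hx, redExp_neg hy]
  simp

end CommFormula

/-! ### Integrable lattices and the action of the Kac-Moody group -/

section IntegrableLattice

variable {ι : Type} [Fintype ι] [DecidableEq ι]

/-- A representation of the Kac-Moody Lie algebra on a rational vector space `V`, graded by
multidegrees `d : ι → ℤ` where `e i` lowers and `f i` raises the `i`-th degree by one, with a graded
lattice `L` that is stable under the divided powers of the Chevalley generators. Vectors of
multidegree `d` have weight `wt i - ∑ A i j * d j` for the coroot `h i`. The operator `deg j` is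
multiplication by the `j`-th degree, and `π d` is the projection to multidegree `d`. -/
structure IntegrableLattice (A : Matrix ι ι ℤ) (V : Type*) [AddCommGroup V] [Module ℚ V] where
  diag : ∀ i, A i i = 2
  ρ : LieAlg A →ₗ⁅ℚ⁆ Module.End ℚ V
  L : Submodule ℤ V
  wt : ι → ℤ
  deg : ι → Module.End ℚ V
  π : (ι → ℤ) → Module.End ℚ V
  integrable_e : ∀ i, Integrable L (ρ (lieE A i))
  integrable_f : ∀ i, Integrable L (ρ (lieF A i))
  latFin_π : LatFin L π
  sum_π : sumEnd π = 1
  deg_π : ∀ (d : ι → ℤ) j x, deg j (π d x) = (d j : ℚ) • π d x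
  π_of_deg : ∀ (d d' : ι → ℤ) x, (∀ j, deg j x = (d j : ℚ) • x) → π d' x = if d' = d then x else 0
  deg_e : ∀ i j, deg j * ρ (lieE A i) = ρ (lieE A i) * deg j - if j = i then ρ (lieE A i) else 0
  deg_f : ∀ i j, deg j * ρ (lieF A i) = ρ (lieF A i) * deg j + if j = i then ρ (lieF A i) else 0
  h_of_deg : ∀ i (d : ι → ℤ) x, (∀ j, deg j x = (d j : ℚ) • x) →
    ρ (lieH A i) x = ((wt i - ∑ j, A i j * d j : ℤ) : ℚ) • x

namespace IntegrableLattice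

variable {A : Matrix ι ι ℤ} {V : Type*} [AddCommGroup V] [Module ℚ V] (X : IntegrableLattice A V)

/-- The vector `x` has multidegree `d`. -/
def Homog (d : ι → ℤ) (x : V) : Prop := ∀ j, X.deg j x = (d j : ℚ) • x

/-- The weight of vectors of multidegree `d` for the coroot `h i`. -/
def weight (i : ι) (d : ι → ℤ) : ℤ := X.wt i - ∑ j, A i j * d j

/-- The action of the simple reflection on multidegrees. -/
def refl (i : ι) (d : ι → ℤ) : ι → ℤ := d + Pi.single i (X.weight i d)

lemma weight_add_single (i : ι) (d : ι → ℤ) (n : ℤ) :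
    X.weight i (d + Pi.single i n) = X.weight i d - 2 * n := by
  simp only [weight, Pi.add_apply, mul_add, Finset.sum_add_distrib]
  have : ∑ j, A i j * (Pi.single i n : ι → ℤ) j = 2 * n := by
    rw [Finset.sum_eq_single i]
    · rw [Pi.single_eq_same, X.diag]
    · intro j _ hj
      rw [Pi.single_eq_of_ne hj, mul_zero]
    · simp
  rw [this]
  ring

lemma weight_refl (i : ι) (d : ι → ℤ) : X.weight i (X.refl i d) = -X.weight i d := by
  rw [refl, weight_add_single]
  ring

/-- The lift of the simple reflection to `V`. -/
def w (i : ι) : Module.End ℚ V :=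
  expEnd (X.ρ (lieE A i)) * expEnd (-X.ρ (lieF A i)) * expEnd (X.ρ (lieE A i))

/-- The inverse of `X.w i`. -/
def wInv (i : ι) : Module.End ℚ V :=
  expEnd (-X.ρ (lieE A i)) * expEnd (X.ρ (lieF A i)) * expEnd (-X.ρ (lieE A i))

lemma w_mul_wInv (i : ι) : X.w i * X.wInv i = 1 := by
  have h1 := expEnd_mul_neg (X.integrable_e i).locNil
  have h2 := expEnd_neg_mul (X.integrable_f i).locNil
  calc X.w i * X.wInv i = expEnd (X.ρ (lieE A i)) * (expEnd (-X.ρ (lieF A i)) *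
        (expEnd (X.ρ (lieE A i)) * expEnd (-X.ρ (lieE A i))) * expEnd (X.ρ (lieF A i))) *
          expEnd (-X.ρ (lieE A i)) := by rw [w, wInv]; noncomm_ring
    _ = 1 := by rw [h1, mul_one, h2, mul_one, h1]

lemma wInv_mul_w (i : ι) : X.wInv i * X.w i = 1 := by
  have h1 := expEnd_neg_mul (X.integrable_e i).locNil
  have h2 := expEnd_mul_neg (X.integrable_f i).locNil
  calc X.wInv i * X.w i = expEnd (-X.ρ (lieE A i)) * (expEnd (X.ρ (lieF A i)) *
        (expEnd (-X.ρ (lieE A i)) * expEnd (X.ρ (lieE A i))) * expEnd (-X.ρ (lieF A i))) *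
          expEnd (X.ρ (lieE A i)) := by rw [w, wInv]; noncomm_ring
    _ = 1 := by rw [h1, mul_one, h2, mul_one, h1]

lemma stab_w (i : ι) : Stab X.L (X.w i) :=
  ((X.integrable_e i).stab_expEnd.mul (X.integrable_f i).neg.stab_expEnd).mul
    (X.integrable_e i).stab_expEnd

lemma stab_wInv (i : ι) : Stab X.L (X.wInv i) :=
  ((X.integrable_e i).neg.stab_expEnd.mul (X.integrable_f i).stab_expEnd).mul
    (X.integrable_e i).neg.stab_expEnd

/-- The lift of the simple reflection to the Lie algebra acts on operators as conjugation by
`X.w i`. -/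
lemma map_reflLie (i : ι) (y : LieAlg A) :
    X.ρ (reflLie A i y) = X.w i * X.ρ y * X.wInv i := by
  have hE := fun y => map_expAd X.ρ (y := y) (X.integrable_e i).locNil
    (ad_lieE_nilpotent X.diag i y)
  have hF : ∀ y, X.ρ (expAd A (-lieF A i) y) =
      expEnd (-X.ρ (lieF A i)) * X.ρ y * expEnd (X.ρ (lieF A i)) := fun y => by
    have h1 : ∃ n : ℕ, (LieAlgebra.ad ℚ (LieAlg A) (-lieF A i) ^ n) y = 0 := by
      obtain ⟨n, hn⟩ := ad_lieF_nilpotent X.diag i y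
      refine ⟨n, ?_⟩
      rw [map_neg, neg_pow, Module.End.mul_apply, hn, map_zero]
    have h2 := map_expAd X.ρ (x := -lieF A i) (y := y)
      (by rw [map_neg]; exact (X.integrable_f i).locNil.neg) h1
    rwa [map_neg, neg_neg] at h2
  rw [reflLie, hE, hF, hE, w, wInv]
  noncomm_ring

lemma integrable_of_isRealRootVec {v : ι → ℤ} {z : LieAlg A} (hz : IsRealRootVec A v z) :
    Integrable X.L (X.ρ z) := by
  induction hz with
  | simple i => exact X.integrable_e i
  | neg v x _ ih =>
    rw [map_neg]
    exact ih.neg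
  | refl i v x _ ih =>
    rw [map_reflLie]
    exact ih.conj (X.wInv_mul_w i) (X.w_mul_wInv i) (X.stab_w i) (X.stab_wInv i)

/-! ### Simple reflections of the multidegrees -/

lemma commute_w {i : ι} {D : Module.End ℚ V} (hE : Commute D (X.ρ (lieE A i)))
    (hF : Commute D (X.ρ (lieF A i))) : Commute D (X.w i) :=
  ((Commute.expEnd_right (X.integrable_e i).locNil hE).mul_right
    (Commute.expEnd_right (X.integrable_f i).locNil.neg hF.neg_right)).mul_right
    (Commute.expEnd_right (X.integrable_e i).locNil hE)

lemma lieH_mul_w (i : ι) : X.ρ (lieH A i) * X.w i = -(X.w i * X.ρ (lieH A i)) := by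
  have h := X.map_reflLie i (lieH A i)
  rw [reflLie_lieH X.diag, map_neg] at h
  calc X.ρ (lieH A i) * X.w i = -(-X.ρ (lieH A i) * X.w i) := by noncomm_ring
    _ = -(X.w i * X.ρ (lieH A i) * (X.wInv i * X.w i)) := by rw [h]; noncomm_ring
    _ = _ := by rw [X.wInv_mul_w, mul_one]

lemma deg_mul_w (i : ι) : X.deg i * X.w i = X.w i * (X.deg i + X.ρ (lieH A i)) := by
  have hlie : ∀ x y, X.ρ x * X.ρ y = X.ρ y * X.ρ x + X.ρ ⁅x, y⁆ := fun x y => by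
    rw [LieHom.map_lie, LieRing.of_associative_ring_bracket]
    abel
  -- twice the degree plus the coroot is central in the copy of `𝔤𝔩₂`
  have hc : Commute ((2 : ℚ) • X.deg i + X.ρ (lieH A i)) (X.w i) := by
    refine X.commute_w ?_ ?_
    · rw [Commute, SemiconjBy, add_mul, mul_add, smul_mul_assoc, X.deg_e, if_pos rfl, hlie,
        lie_lieH_lieE, X.diag, mul_smul_comm, map_zsmul, ← Int.cast_smul_eq_zsmul ℚ]
      push_cast
      module
    · rw [Commute, SemiconjBy, add_mul, mul_add, smul_mul_assoc, X.deg_f, if_pos rfl, hlie,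
        lie_lieH_lieF, X.diag, mul_smul_comm, map_neg, map_zsmul, ← Int.cast_smul_eq_zsmul ℚ]
      push_cast
      module
  have h1 : (2 : ℚ) • (X.deg i * X.w i) = (2 : ℚ) • (X.w i * (X.deg i + X.ρ (lieH A i))) := by
    have h2 := hc.eq
    rw [add_mul, mul_add, X.lieH_mul_w, smul_mul_assoc, mul_smul_comm] at h2
    rw [← add_neg_cancel_right ((2 : ℚ) • (X.deg i * X.w i)) (-(X.w i * X.ρ (lieH A i))), h2,
      mul_add]
    module
  exact smul_right_injective _ two_ne_zero h1

lemma homog_w {i : ι} {d : ι → ℤ} {x : V} (hx : X.Homog d x) :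
    X.Homog (X.refl i d) (X.w i x) := fun j => by
  rcases eq_or_ne j i with rfl | hij
  · rw [← Module.End.mul_apply, X.deg_mul_w, Module.End.mul_apply, LinearMap.add_apply, hx,
      X.h_of_deg j d x hx, ← add_smul, map_smul, refl, Pi.add_apply, Pi.single_eq_same, weight]
    push_cast
    rfl
  · have hc : Commute (X.deg j) (X.w i) := by
      refine X.commute_w ?_ ?_
      · rw [Commute, SemiconjBy, X.deg_e, if_neg hij, sub_zero]
      · rw [Commute, SemiconjBy, X.deg_f, if_neg hij, add_zero]
    rw [← Module.End.mul_apply, hc.eq, Module.End.mul_apply, hx, map_smul, refl, Pi.add_apply,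
      Pi.single_eq_of_ne hij, add_zero]

lemma homog_divPow_e {i : ι} {d : ι → ℤ} {x : V} (hx : X.Homog d x) (n : ℕ) :
    X.Homog (d - Pi.single i (n : ℤ)) (divPow (X.ρ (lieE A i)) n x) := fun j => by
  have key : ∀ n : ℕ, X.deg j ((X.ρ (lieE A i) ^ n) x) =
      (((d - Pi.single i (n : ℤ) : ι → ℤ) j : ℤ) : ℚ) • (X.ρ (lieE A i) ^ n) x := fun n => by
    induction n with
    | zero => simpa using hx j
    | succ n ih =>
      rw [pow_succ', Module.End.mul_apply, ← Module.End.mul_apply, X.deg_e, LinearMap.sub_apply,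
        Module.End.mul_apply, ih, map_smul]
      rcases eq_or_ne j i with rfl | hij
      · simp only [if_true, Pi.sub_apply, Pi.single_eq_same]
        push_cast
        module
      · simp [if_neg hij, Pi.single_eq_of_ne hij]
  rw [divPow, LinearMap.smul_apply, map_smul, key, smul_comm]

lemma homog_divPow_f {i : ι} {d : ι → ℤ} {x : V} (hx : X.Homog d x) (n : ℕ) :
    X.Homog (d + Pi.single i (n : ℤ)) (divPow (X.ρ (lieF A i)) n x) := fun j => by
  have key : ∀ n : ℕ, X.deg j ((X.ρ (lieF A i) ^ n) x) =
      (((d + Pi.single i (n : ℤ) : ι → ℤ) j : ℤ) : ℚ) • (X.ρ (lieF A i) ^ n) x := fun n => by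
    induction n with
    | zero => simpa using hx j
    | succ n ih =>
      rw [pow_succ', Module.End.mul_apply, ← Module.End.mul_apply, X.deg_f, LinearMap.add_apply,
        Module.End.mul_apply, ih, map_smul]
      rcases eq_or_ne j i with rfl | hij
      · simp only [if_true, Pi.add_apply, Pi.single_eq_same]
        push_cast
        module
      · simp [if_neg hij, Pi.single_eq_of_ne hij]
  rw [divPow, LinearMap.smul_apply, map_smul, key, smul_comm]

/-! ### Diagonal operators and copies of `SL₂(k)` on the reduction -/

variable (k : Type*) [Field k]

/-- The module on which the Kac-Moody group acts. -/
abbrev Mod : Type _ := k ⊗[ℤ] X.L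

variable {k}

lemma hom_ext_of_homog {f g : Module.End k (X.Mod k)}
    (h : ∀ (d : ι → ℤ) (x : X.L), X.Homog d (x : V) → f (1 ⊗ₜ x) = g (1 ⊗ₜ x)) : f = g := by
  refine TensorProduct.AlgebraTensorModule.ext fun a x => ?_
  have hs : ∀ d, X.π d x ≠ 0 → d ∈ (X.latFin_π.locFin x).toFinset := fun d hd => by simpa using hd
  have hx : x = ∑ d ∈ (X.latFin_π.locFin x).toFinset,
      (⟨X.π d x, X.latFin_π.stab d x x.2⟩ : X.L) := by
    ext
    have h1 := sumEnd_apply_eq_sum X.latFin_π.locFin x _ hs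
    rw [X.sum_π] at h1
    rw [AddSubmonoidClass.coe_finsetSum]
    exact h1
  have ha : (a ⊗ₜ x : X.Mod k) = a • (1 ⊗ₜ x) := by
    rw [TensorProduct.smul_tmul', smul_eq_mul, mul_one]
  rw [ha, map_smul, map_smul, hx, TensorProduct.tmul_sum, map_sum, map_sum]
  congr 1
  exact Finset.sum_congr rfl fun d _ => h d _ fun j => X.deg_π d j x

/-- The operator on `k ⊗ L` that is multiplication by `c d` in multidegree `d`. -/
def diagOp (c : (ι → ℤ) → k) : Module.End k (X.Mod k) := red X.L k c X.π

lemma diagOp_tmul (c : (ι → ℤ) → k) {d : ι → ℤ} (x : X.L) (hx : X.Homog d (x : V)) (a : k) :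
    X.diagOp c (a ⊗ₜ x) = (c d * a) ⊗ₜ x := by
  rw [diagOp, X.latFin_π.red_tmul c a x {d} fun d' hd' => ?_, Finset.sum_singleton]
  · congr 1
    ext
    exact (X.π_of_deg d d x hx).trans (if_pos rfl)
  · by_contra h
    rw [Finset.mem_singleton] at h
    exact hd' ((X.π_of_deg d d' x hx).trans (if_neg h))

lemma diagOp_one : X.diagOp (1 : (ι → ℤ) → k) = 1 :=
  X.hom_ext_of_homog fun d x hx => by
    rw [X.diagOp_tmul _ x hx]
    simp

lemma diagOp_mul (c c' : (ι → ℤ) → k) : X.diagOp (c * c') = X.diagOp c * X.diagOp c' :=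
  X.hom_ext_of_homog fun d x hx => by
    rw [X.diagOp_tmul _ x hx, Module.End.mul_apply, X.diagOp_tmul _ x hx, X.diagOp_tmul _ x hx,
      Pi.mul_apply, mul_assoc]

lemma diagOp_mul_redExp_e (c : (ι → ℤ) → k) (i : ι) (q r : k)
    (hc : ∀ d, c (d - Pi.single i 1) = q * c d) :
    X.diagOp c * redExp X.L (X.ρ (lieE A i)) r =
      redExp X.L (X.ρ (lieE A i)) (q * r) * X.diagOp c := by
  have hc' : ∀ (n : ℕ) d, c (d - Pi.single i (n : ℤ)) = q ^ n * c d := fun n => by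
    induction n with
    | zero => simp
    | succ n ih =>
      intro d
      have h1 : d - Pi.single i ((n + 1 : ℕ) : ℤ) = d - Pi.single i (n : ℤ) - Pi.single i 1 := by
        rw [sub_sub, ← Pi.single_add]
        push_cast
        rfl
      rw [h1, hc, ih, pow_succ']
      ring
  refine X.hom_ext_of_homog fun d x hx => ?_
  have hs : ∀ n, divPow (X.ρ (lieE A i)) n x ≠ 0 →
      n ∈ ((X.integrable_e i).latFin.locFin x).toFinset := fun n hn => by simpa using hn
  rw [Module.End.mul_apply, Module.End.mul_apply, X.diagOp_tmul _ x hx, redExp, redExp,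
    (X.integrable_e i).latFin.red_tmul _ _ _ _ hs, (X.integrable_e i).latFin.red_tmul _ _ _ _ hs,
    map_sum]
  refine Finset.sum_congr rfl fun n _ => ?_
  rw [X.diagOp_tmul c _ (X.homog_divPow_e hx n), hc']
  congr 1
  ring

lemma diagOp_mul_redExp_f (c : (ι → ℤ) → k) (i : ι) (q r : k)
    (hc : ∀ d, c (d + Pi.single i 1) = q * c d) :
    X.diagOp c * redExp X.L (X.ρ (lieF A i)) r =
      redExp X.L (X.ρ (lieF A i)) (q * r) * X.diagOp c := by
  have hc' : ∀ (n : ℕ) d, c (d + Pi.single i (n : ℤ)) = q ^ n * c d := fun n => by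
    induction n with
    | zero => simp
    | succ n ih =>
      intro d
      have h1 : d + Pi.single i ((n + 1 : ℕ) : ℤ) = d + Pi.single i (n : ℤ) + Pi.single i 1 := by
        rw [add_assoc, ← Pi.single_add]
        push_cast
        rfl
      rw [h1, hc, ih, pow_succ']
      ring
  refine X.hom_ext_of_homog fun d x hx => ?_
  have hs : ∀ n, divPow (X.ρ (lieF A i)) n x ≠ 0 →
      n ∈ ((X.integrable_f i).latFin.locFin x).toFinset := fun n hn => by simpa using hn
  rw [Module.End.mul_apply, Module.End.mul_apply, X.diagOp_tmul _ x hx, redExp, redExp,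
    (X.integrable_f i).latFin.red_tmul _ _ _ _ hs, (X.integrable_f i).latFin.red_tmul _ _ _ _ hs,
    map_sum]
  refine Finset.sum_congr rfl fun n _ => ?_
  rw [X.diagOp_tmul c _ (X.homog_divPow_f hx n), hc']
  congr 1
  ring

lemma redOp_w_mul_diagOp (c c' : (ι → ℤ) → k) (i : ι) (h : ∀ d, c (X.refl i d) = c' d) :
    redOp X.L k (X.w i) * X.diagOp c' = X.diagOp c * redOp X.L k (X.w i) := by
  refine X.hom_ext_of_homog fun d x hx => ?_
  rw [Module.End.mul_apply, Module.End.mul_apply, X.diagOp_tmul _ x hx, redOp_tmul (X.stab_w i),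
    redOp_tmul (X.stab_w i), X.diagOp_tmul _ _ (X.homog_w hx), h]

/-- Diagonal operators with values in `kˣ`, as invertible operators. -/
def diagUnit : ((ι → ℤ) → kˣ) →* (Module.End k (X.Mod k))ˣ where
  toFun c :=
    { val := X.diagOp fun d => c d
      inv := X.diagOp fun d => (c d)⁻¹
      val_inv := by
        rw [← diagOp_mul, ← diagOp_one]
        congr 1
        ext d
        simp
      inv_val := by
        rw [← diagOp_mul, ← diagOp_one]
        congr 1
        ext d
        simp }
  map_one' := by
    ext1
    exact X.diagOp_one
  map_mul' c c' := by
    ext1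
    exact X.diagOp_mul _ _

lemma coe_diagUnit (c : (ι → ℤ) → kˣ) :
    (X.diagUnit c : Module.End k (X.Mod k)) = X.diagOp fun d => (c d : k) := rfl

variable (k) in
/-- The operator on `k ⊗ L` induced by `X.w i`, as an invertible operator. -/
def wUnit (i : ι) : (Module.End k (X.Mod k))ˣ where
  val := redOp X.L k (X.w i)
  inv := redOp X.L k (X.wInv i)
  val_inv := by rw [← redOp_mul (X.stab_w i) (X.stab_wInv i), X.w_mul_wInv, redOp_one]
  inv_val := by rw [← redOp_mul (X.stab_wInv i) (X.stab_w i), X.wInv_mul_w, redOp_one]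

/-- The operator `exp (r z)` for a real root vector `z`. -/
def rootUnit (z : LieAlg A) (hz : ∃ v, IsRealRootVec A v z) (r : k) :
    (Module.End k (X.Mod k))ˣ :=
  redExpUnit (X.integrable_of_isRealRootVec hz.choose_spec) r

lemma coe_rootUnit (z : LieAlg A) (hz : ∃ v, IsRealRootVec A v z) (r : k) :
    (X.rootUnit z hz r : Module.End k (X.Mod k)) = redExp X.L (X.ρ z) r := rfl

lemma coe_inv_rootUnit (z : LieAlg A) (hz : ∃ v, IsRealRootVec A v z) (r : k) :
    (((X.rootUnit z hz r)⁻¹ : (Module.End k (X.Mod k))ˣ) : Module.End k (X.Mod k)) =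
      redExp X.L (X.ρ z) (-r) := rfl

lemma wUnit_conj_diagUnit (c c' : (ι → ℤ) → kˣ) (i : ι) (h : ∀ d, c (X.refl i d) = c' d) :
    X.wUnit k i * X.diagUnit c' * (X.wUnit k i)⁻¹ = X.diagUnit c := by
  rw [mul_inv_eq_iff_eq_mul]
  ext1
  exact X.redOp_w_mul_diagOp _ _ i fun d => by rw [h]

lemma wUnit_conj_redExpUnit (i : ι) {z : LieAlg A} (hz : Integrable X.L (X.ρ z))
    (hz' : Integrable X.L (X.ρ (reflLie A i z))) (r : k) :
    X.wUnit k i * redExpUnit hz r * (X.wUnit k i)⁻¹ = redExpUnit hz' r := by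
  ext1
  have := redExp_conj hz (X.wInv_mul_w i) (X.w_mul_wInv i) (X.stab_w i) (X.stab_wInv i) r
  rw [← X.map_reflLie] at this
  exact this.symm

lemma diagUnit_conj_e (c : (ι → ℤ) → kˣ) (i : ι) (q : kˣ) (r : k)
    (hc : ∀ d, c (d - Pi.single i 1) = q * c d) :
    X.diagUnit c * redExpUnit (X.integrable_e i) r * (X.diagUnit c)⁻¹ =
      redExpUnit (X.integrable_e i) (q * r) := by
  rw [mul_inv_eq_iff_eq_mul]
  ext1
  exact X.diagOp_mul_redExp_e (fun d => (c d : k)) i (q : k) r fun d => by rw [hc, Units.val_mul]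

lemma diagUnit_conj_f (c : (ι → ℤ) → kˣ) (i : ι) (q : kˣ) (r : k)
    (hc : ∀ d, c (d + Pi.single i 1) = q * c d) :
    X.diagUnit c * redExpUnit (X.integrable_f i) r * (X.diagUnit c)⁻¹ =
      redExpUnit (X.integrable_f i) (q * r) := by
  rw [mul_inv_eq_iff_eq_mul]
  ext1
  exact X.diagOp_mul_redExp_f (fun d => (c d : k)) i (q : k) r fun d => by rw [hc, Units.val_mul]

/-- The multiplicative weight for the coroot `h i`. -/
def corootChar (i : ι) : kˣ →* ((ι → ℤ) → kˣ) where
  toFun r d := r ^ X.weight i d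
  map_one' := by
    ext1 d
    exact one_zpow _
  map_mul' r r' := by
    ext1 d
    exact mul_zpow _ _ _

/-- The operators that make `SL₂(k)` act on `k ⊗ L` through the simple root `i`. -/
def sl2Relations (i : ι) : SL2Relations k (Module.End k (X.Mod k))ˣ where
  u := redExpUnit (X.integrable_e i)
  l := redExpUnit (X.integrable_f i)
  h := X.diagUnit.comp (X.corootChar i)
  w := X.wUnit k i
  u_add x y := by
    ext1
    exact redExp_add (X.integrable_e i) x y
  h_conj_u r x := by
    rw [MonoidHom.comp_apply, ← Units.val_pow_eq_pow_val]
    refine X.diagUnit_conj_e _ i _ x fun d => ?_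
    have : X.weight i (d - Pi.single i 1) = 2 + X.weight i d := by
      rw [sub_eq_add_neg, ← Pi.single_neg, weight_add_single]
      ring
    simp only [corootChar, MonoidHom.coe_mk, OneHom.coe_mk, this]
    rw [zpow_add, zpow_ofNat]
  w_conj_u x := by
    have hz' : Integrable X.L (X.ρ (reflLie A i (lieE A i))) := by
      rw [reflLie_lieE X.diag, map_neg]
      exact (X.integrable_f i).neg
    rw [X.wUnit_conj_redExpUnit i (X.integrable_e i) hz']
    ext1
    change redExp X.L (X.ρ (reflLie A i (lieE A i))) x = redExp X.L (X.ρ (lieF A i)) (-x)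
    rw [reflLie_lieE X.diag, map_neg, redExp_neg (X.integrable_f i)]
  w_conj_h r := by
    rw [← map_inv]
    refine X.wUnit_conj_diagUnit _ _ i fun d => ?_
    simp [corootChar, X.weight_refl]
  ulu r := by
    -- conjugate the case `r = 1` by a diagonal operator that scales `e i` by `r`
    set c : (ι → ℤ) → kˣ := fun d => r ^ (-d i) with hc
    have hu : X.diagUnit c * redExpUnit (X.integrable_e i) 1 * (X.diagUnit c)⁻¹ =
        redExpUnit (X.integrable_e i) (r : k) := by
      rw [X.diagUnit_conj_e c i r 1, mul_one]
      intro d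
      simp only [hc, Pi.sub_apply, Pi.single_eq_same]
      rw [neg_sub, sub_eq_add_neg, zpow_add, zpow_one]
    have hl : X.diagUnit c * redExpUnit (X.integrable_f i) (-1) * (X.diagUnit c)⁻¹ =
        redExpUnit (X.integrable_f i) (-((r⁻¹ : kˣ) : k)) := by
      rw [X.diagUnit_conj_f c i r⁻¹ (-1), mul_neg_one]
      intro d
      simp only [hc, Pi.add_apply, Pi.single_eq_same]
      rw [neg_add_rev, zpow_add, zpow_neg_one]
    have hw : X.wUnit k i = redExpUnit (X.integrable_e i) 1 *
        redExpUnit (X.integrable_f i) (-1) * redExpUnit (X.integrable_e i) 1 := by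
      ext1
      change redOp X.L k (X.w i) = redExp X.L (X.ρ (lieE A i)) 1 *
        redExp X.L (X.ρ (lieF A i)) (-1) * redExp X.L (X.ρ (lieE A i)) 1
      rw [← redExp_neg (X.integrable_f i), redExp_one (X.integrable_e i),
        redExp_one (X.integrable_f i).neg, w, redOp_mul
          ((X.integrable_e i).stab_expEnd.mul (X.integrable_f i).neg.stab_expEnd)
          (X.integrable_e i).stab_expEnd, redOp_mul (X.integrable_e i).stab_expEnd
          (X.integrable_f i).neg.stab_expEnd]
    have hcw : X.wUnit k i * X.diagUnit c * (X.wUnit k i)⁻¹ =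
        X.diagUnit ((X.corootChar i r)⁻¹ * c) := by
      refine X.wUnit_conj_diagUnit _ _ i fun d => ?_
      simp only [corootChar, hc, MonoidHom.coe_mk, OneHom.coe_mk, Pi.mul_apply, Pi.inv_apply,
        X.weight_refl]
      simp only [refl, Pi.add_apply, Pi.single_eq_same]
      rw [← zpow_neg, ← zpow_add]
      congr 1
      ring
    rw [map_mul, map_inv, mul_inv_eq_iff_eq_mul] at hcw
    rw [← hu, ← hl, MonoidHom.comp_apply]
    calc _ = X.diagUnit c * (redExpUnit (X.integrable_e i) 1 *
          redExpUnit (X.integrable_f i) (-1) * redExpUnit (X.integrable_e i) 1) *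
          (X.diagUnit c)⁻¹ := by group
      _ = X.diagUnit (X.corootChar i r) * ((X.diagUnit (X.corootChar i r))⁻¹ * X.diagUnit c *
          X.wUnit k i) * (X.diagUnit c)⁻¹ := by rw [← hw]; group
      _ = _ := by rw [← hcw]; group

end IntegrableLattice

end IntegrableLattice

/-! ### The representation of the Kac-Moody group -/

section Torus

variable {ι Λ : Type} [AddCommGroup Λ] {D : Datum ι Λ} {k : Type*} [Field k]

lemma Torus.ext_val {t t' : Torus Λ k} (h : ∀ v, t.val v = t'.val v) : t = t' :=
  MonoidHom.ext fun v => h v.toAdd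

lemma Torus.val_add (t : Torus Λ k) (v w : Λ) : t.val (v + w) = t.val v * t.val w :=
  map_mul t (Multiplicative.ofAdd v) (Multiplicative.ofAdd w)

lemma Torus.val_zsmul (t : Torus Λ k) (n : ℤ) (v : Λ) : t.val (n • v) = t.val v ^ n :=
  map_zpow t (Multiplicative.ofAdd v) n

lemma Torus.val_sub (t : Torus Λ k) (v w : Λ) : t.val (v - w) = t.val v / t.val w :=
  map_div t (Multiplicative.ofAdd v) (Multiplicative.ofAdd w)

lemma coweightPow_val (h : Λ →+ ℤ) (r : kˣ) (v : Λ) : (coweightPow h r).val v = r ^ h v := rfl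

lemma omega_apply (i : ι) (v : Λ) : D.omega i v = v - D.h i v • D.α i := rfl

lemma omegaTorus_val (i : ι) (t : Torus Λ k) (v : Λ) :
    (D.omegaTorus i t).val v = t.val (D.omega i v) := rfl

end Torus

section Representation

namespace IntegrableLattice

variable {ι Λ : Type} [Fintype ι] [DecidableEq ι] [AddCommGroup Λ] {D : Datum ι Λ}
variable {V : Type*} [AddCommGroup V] [Module ℚ V] (X : IntegrableLattice D.A V) {k : Type*}
  [Field k] (lam : Λ)

/-- The weight in `Λ` of the vectors of multidegree `d`. -/
def latWeight (D : Datum ι Λ) (lam : Λ) (d : ι → ℤ) : Λ := lam - ∑ j, d j • D.α j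

lemma latWeight_add_single (d : ι → ℤ) (i : ι) (n : ℤ) :
    latWeight D lam (d + Pi.single i n) = latWeight D lam d - n • D.α i := by
  simp only [latWeight, Pi.add_apply, add_smul, Finset.sum_add_distrib]
  have : ∑ j, (Pi.single i n : ι → ℤ) j • D.α j = n • D.α i := by
    rw [Finset.sum_eq_single i]
    · rw [Pi.single_eq_same]
    · intro j _ hj
      rw [Pi.single_eq_of_ne hj, zero_smul]
    · simp
  rw [this]
  abel

/-- The character through which the torus acts on `k ⊗ L`. -/
def torusChar (D : Datum ι Λ) (lam : Λ) : Torus Λ k →* ((ι → ℤ) → kˣ) where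
  toFun t d := t.val (latWeight D lam d)
  map_one' := rfl
  map_mul' _ _ := rfl

variable (hlam : ∀ i, X.wt i = D.h i lam)
include hlam

lemma h_latWeight (i : ι) (d : ι → ℤ) : D.h i (latWeight D lam d) = X.weight i d := by
  rw [latWeight, map_sub, map_sum, weight, hlam]
  congr 1
  refine Finset.sum_congr rfl fun j _ => ?_
  rw [map_zsmul, D.pairing, smul_eq_mul, mul_comm]

omit hlam in
variable (k) in
/-- The images of the generators of the Kac-Moody group in the operators on `k ⊗ L`. -/
def genMap : Gen D k → (Module.End k (X.Mod k))ˣ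
  | .torus t => X.diagUnit (torusChar D lam t)
  | .sl i g => (X.sl2Relations i).hom g
  | .root z hz r => X.rootUnit z hz r

omit hlam in
lemma lift_wordT (t : Torus Λ k) :
    FreeGroup.lift (X.genMap k lam) (wordT D t) = X.diagUnit (torusChar D lam t) :=
  FreeGroup.lift_apply_of

omit hlam in
lemma lift_wordS (i : ι) (g : SL(2, k)) :
    FreeGroup.lift (X.genMap k lam) (wordS D i g) = (X.sl2Relations i).hom g :=
  FreeGroup.lift_apply_of

omit hlam in
lemma lift_wordX (z : LieAlg D.A) (hz) (r : k) :
    FreeGroup.lift (X.genMap k lam) (wordX D z hz r) = X.rootUnit z hz r :=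
  FreeGroup.lift_apply_of

/-- The operators on `k ⊗ L` satisfy the defining relations of the Kac-Moody group. -/
lemma lift_eq_of_rel {u u' : FreeGroup (Gen D k)} (h : Rel D u u') :
    FreeGroup.lift (X.genMap k lam) u = FreeGroup.lift (X.genMap k lam) u' := by
  induction h with
  | torus_mul t t' => simp only [map_mul, lift_wordT]
  | sl_mul i g g' => simp only [map_mul, lift_wordS]
  | root_add z hz r r' =>
    simp only [map_mul, lift_wordX]
    ext1
    exact (redExp_add (X.integrable_of_isRealRootVec hz.choose_spec) r r').symm
  | root_neg z hz hz' r =>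
    simp only [lift_wordX]
    ext1
    rw [coe_rootUnit, coe_rootUnit, map_neg,
      redExp_neg (X.integrable_of_isRealRootVec hz.choose_spec)]
  | comm v w x y hx hy _ l hl r s =>
    simp only [map_mul, map_inv, lift_wordX, map_list_prod, List.map_map]
    ext1
    have := hl.redExp_eq (k := k) (X.integrable_of_isRealRootVec hx)
      (X.integrable_of_isRealRootVec hy)
      (fun g hg => X.integrable_of_isRealRootVec (hl.1 g hg).2.2) r s
    rw [Units.val_mul, Units.val_mul, Units.val_mul, coe_inv_rootUnit, coe_inv_rootUnit,
      coe_rootUnit, coe_rootUnit, this, ← Units.coeHom_apply, map_list_prod, List.map_map]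
    have hattach : ∀ g : Factor D.A → Module.End k (X.Mod k),
        l.map g = l.attach.map fun f => g f.1 := fun g => by simp
    rw [hattach]
    rfl
  | sl_upper i hz r =>
    rw [lift_wordS, lift_wordX, SL2Relations.hom_slUpper]
    rfl
  | sl_lower i hz r =>
    rw [lift_wordS, lift_wordX, SL2Relations.hom_slLower]
    rfl
  | sl_diag i r =>
    rw [lift_wordS, lift_wordT, SL2Relations.hom_slDiag]
    change X.diagUnit (X.corootChar i r) = _
    congr 1
    ext1 d
    change r ^ X.weight i d = (coweightPow (D.h i) r).val (latWeight D lam d)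
    rw [coweightPow_val, X.h_latWeight lam hlam]
  | torus_upper t i hz r =>
    simp only [map_mul, map_inv, lift_wordT, lift_wordX]
    refine X.diagUnit_conj_e _ i _ r fun d => ?_
    change t.val (latWeight D lam _) = t.val (D.α i) * t.val (latWeight D lam d)
    rw [sub_eq_add_neg, ← Pi.single_neg, latWeight_add_single, neg_smul, one_smul, sub_neg_eq_add,
      Torus.val_add, mul_comm]
  | torus_lower t i hz r =>
    simp only [map_mul, map_inv, lift_wordT, lift_wordX]
    refine X.diagUnit_conj_f _ i _ r fun d => ?_
    change t.val (latWeight D lam _) = (t.val (D.α i))⁻¹ * t.val (latWeight D lam d)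
    rw [latWeight_add_single, one_smul, Torus.val_sub, div_eq_mul_inv, mul_comm]
  | weyl_torus i t =>
    simp only [map_mul, map_inv, lift_wordS, lift_wordT, SL2Relations.hom_slWeyl]
    refine X.wUnit_conj_diagUnit _ _ i fun d => ?_
    change (D.omegaTorus i t).val (latWeight D lam _) = t.val (latWeight D lam d)
    rw [omegaTorus_val, omega_apply, X.h_latWeight lam hlam, X.weight_refl, refl,
      latWeight_add_single, neg_smul]
    congr 1
    abel
  | weyl_root i z hz hz' r =>
    simp only [map_mul, map_inv, lift_wordS, lift_wordX, SL2Relations.hom_slWeyl]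
    exact X.wUnit_conj_redExpUnit i _ _ r

/-- The action of the Kac-Moody group on `k ⊗ L`. -/
def rep : Grp D k →* (Module.End k (X.Mod k))ˣ :=
  PresentedGroup.toGroup (f := X.genMap k lam) fun r hr => by
    obtain ⟨u, u', h, rfl⟩ := hr
    rw [map_mul, map_inv, X.lift_eq_of_rel lam hlam h, mul_inv_cancel]

lemma rep_eta (t : Torus Λ k) :
    X.rep lam hlam (eta D k t) = X.diagUnit (torusChar D lam t) :=
  X.lift_wordT lam t

/-- A primitive vector of multidegree zero detects the value of a torus element at the weight
`lam`. -/
lemma val_eq_one_of_eta_eq_one (x : X.L) (hx : X.Homog 0 (x : V)) (ε : X.L →ₗ[ℤ] ℤ)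
    (hε : ε x = 1) {t : Torus Λ k} (ht : eta D k t = 1) : t.val lam = 1 := by
  have h1 := X.rep_eta lam hlam t
  rw [ht, map_one] at h1
  have h2 := congrArg (fun u : (Module.End k (X.Mod k))ˣ => (u : Module.End k (X.Mod k))
    (1 ⊗ₜ x)) h1
  simp only [Units.val_one, coe_diagUnit, Module.End.one_apply] at h2
  rw [X.diagOp_tmul _ x hx] at h2
  have h3 := congrArg (fun y => TensorProduct.rid ℤ k (LinearMap.lTensor k ε y)) h2
  simp only [LinearMap.lTensor_tmul, hε, TensorProduct.rid_tmul, one_smul, mul_one] at h3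
  ext
  rw [Units.val_one, h3]
  change _ = (t.val (latWeight D lam 0) : k)
  simp [latWeight]

end IntegrableLattice

end Representation

/-! ### Identities in Lie algebras and in representations of `𝔰𝔩₂` -/

section LieIdentities

variable {𝔤 : Type*} [LieRing 𝔤] [LieAlgebra ℚ 𝔤]

/-- For an `𝔰𝔩₂`-triple `e, f, h` and a vector `y` of weight `c` killed by `ad e`, the usual formula
for `e` on the `f`-string through `y`. -/
lemma lie_ad_pow_succ {e f h y : 𝔤} {c : ℚ} (hef : ⁅e, f⁆ = h) (hhf : ⁅h, f⁆ = (-2 : ℚ) • f)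
    (hhy : ⁅h, y⁆ = c • y) (hey : ⁅e, y⁆ = 0) (n : ℕ) :
    ⁅e, (LieAlgebra.ad ℚ 𝔤 f ^ (n + 1)) y⁆ =
      (((n : ℚ) + 1) * (c - n)) • (LieAlgebra.ad ℚ 𝔤 f ^ n) y := by
  have hw : ∀ n : ℕ, ⁅h, (LieAlgebra.ad ℚ 𝔤 f ^ n) y⁆ =
      (c - 2 * n) • (LieAlgebra.ad ℚ 𝔤 f ^ n) y := fun n => by
    induction n with
    | zero => simpa using hhy
    | succ n ih =>
      rw [pow_succ', Module.End.mul_apply, LieAlgebra.ad_apply, leibniz_lie, hhf, ih, smul_lie,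
        lie_smul, ← add_smul]
      congr 1
      push_cast
      ring
  induction n with
  | zero =>
    rw [zero_add, pow_one, LieAlgebra.ad_apply, leibniz_lie, hef, hey, lie_zero, hhy]
    simp
  | succ n ih =>
    rw [pow_succ', Module.End.mul_apply, LieAlgebra.ad_apply, leibniz_lie, hef, hw, ih, lie_smul,
      ← LieAlgebra.ad_apply ℚ, ← Module.End.mul_apply, ← pow_succ', ← add_smul]
    congr 1
    push_cast
    ring

lemma lie_ad_pow_of_lie_eq_zero {e f : 𝔤} (hef : ⁅e, f⁆ = 0) (y : 𝔤) (n : ℕ) :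
    ⁅e, (LieAlgebra.ad ℚ 𝔤 f ^ n) y⁆ = (LieAlgebra.ad ℚ 𝔤 f ^ n) ⁅e, y⁆ := by
  induction n with
  | zero => simp
  | succ n ih =>
    rw [pow_succ', Module.End.mul_apply, LieAlgebra.ad_apply, leibniz_lie, hef, zero_lie, ih,
      zero_add, Module.End.mul_apply, LieAlgebra.ad_apply]

/-- The Serre element `ad (f i) ^ (1 - A i j) (f j)` commutes with all `e l`. -/
lemma lie_serre_eq_zero {ι : Type} [DecidableEq ι] {A : Matrix ι ι ℤ} (h2 : ∀ i, A i i = 2)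
    (hoff : ∀ i j, i ≠ j → A i j ≤ 0) (hsymm : ∀ i j, A i j = 0 → A j i = 0) {e f h : ι → 𝔤}
    (hef : ∀ i, ⁅e i, f i⁆ = h i) (hef' : ∀ i j, i ≠ j → ⁅e i, f j⁆ = 0)
    (hhf : ∀ i j, ⁅h i, f j⁆ = (-A i j : ℚ) • f j) {i j : ι} (hij : i ≠ j) (l : ι) :
    ⁅e l, (LieAlgebra.ad ℚ 𝔤 (f i) ^ ((-A i j).toNat + 1)) (f j)⁆ = 0 := by
  have hA : ((-A i j).toNat : ℤ) = -A i j := Int.toNat_of_nonneg (by linarith [hoff i j hij])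
  rcases eq_or_ne l i with rfl | hli
  · rw [lie_ad_pow_succ (c := (-A l j : ℚ)) (hef l) (by rw [hhf, h2]; norm_num) (hhf l j)
      (hef' l j hij)]
    have : ((-A l j).toNat : ℚ) = -A l j := by exact_mod_cast hA
    rw [this, sub_self, mul_zero, zero_smul]
  · rw [lie_ad_pow_of_lie_eq_zero (hef' l i hli)]
    rcases eq_or_ne l j with rfl | hlj
    · rw [hef, pow_succ, Module.End.mul_apply, LieAlgebra.ad_apply, ← lie_skew, hhf, map_neg,
        map_smul]
      rcases hm : (-A i l).toNat with _ | m
      · have h0 : A i l = 0 := by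
          rw [hm] at hA
          simpa using hA
        rw [hsymm i l h0]
        simp
      · rw [pow_succ, Module.End.mul_apply, LieAlgebra.ad_apply, lie_self, map_zero]
        simp
    · rw [hef' l j hlj, map_zero]

end LieIdentities

section SL2Module

variable {W : Type*} [AddCommGroup W] [Module ℚ W] {E F H : Module.End ℚ W}

lemma e_mul_f_pow (hEF : E * F = F * E + H) (hHF : H * F = F * H - (2 : ℚ) • F) (n : ℕ) :
    E * F ^ (n + 1) = F ^ (n + 1) * E + ((n : ℚ) + 1) • (F ^ n * (H - (n : ℚ) • 1)) := by
  induction n with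
  | zero => simpa using hEF
  | succ n ih =>
    have h1 : F ^ n * (H - (n : ℚ) • 1) * F = F ^ (n + 1) * (H - ((n : ℚ) + 2) • 1) := by
      rw [mul_assoc, sub_mul, hHF, pow_succ F n, mul_assoc, mul_sub F, smul_mul_assoc, one_mul,
        mul_smul_comm, mul_one]
      congr 1
      module
    rw [pow_succ F (n + 1), ← mul_assoc, ih, add_mul, smul_mul_assoc, h1, mul_assoc, hEF, mul_add,
      ← mul_assoc, ← pow_succ, mul_sub, mul_sub, mul_smul_comm, mul_smul_comm]
    push_cast
    module

/-- The divided power `F ^ (n - j) / (n - j)!`, or zero if `n < j`. -/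
def divPowSub (F : Module.End ℚ W) (n j : ℕ) : Module.End ℚ W :=
  if j ≤ n then divPow F (n - j) else 0

lemma e_mul_divPowSub (hEF : E * F = F * E + H) (hHF : H * F = F * H - (2 : ℚ) • F) (n j : ℕ) :
    E * divPowSub F n j =
      divPowSub F n j * E + divPowSub F n (j + 1) * (H - ((n : ℚ) - j - 1) • 1) := by
  rcases lt_trichotomy j n with h | rfl | h
  · obtain ⟨m, rfl⟩ := Nat.exists_eq_add_of_lt h
    rw [divPowSub, if_pos h.le, divPowSub, if_pos (by omega : j + 1 ≤ j + m + 1),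
      show j + m + 1 - j = m + 1 by omega, show j + m + 1 - (j + 1) = m by omega, divPow, divPow,
      mul_smul_comm, e_mul_f_pow hEF hHF, smul_add, smul_mul_assoc, smul_mul_assoc, smul_smul,
      Nat.factorial_succ]
    congr 2
    · have : (m.factorial : ℚ) ≠ 0 := by positivity
      push_cast
      field_simp
    · congr 3
      push_cast
      ring
  · rw [divPowSub, if_pos le_rfl, divPowSub, if_neg (by omega), Nat.sub_self]
    simp
  · rw [divPowSub, if_neg (by omega), divPowSub, if_neg (by omega)]
    simp

/-- The commutation of divided powers of `E` and `F` on a vector of integral weight. -/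
lemma divPow_e_divPow_f (hEF : E * F = F * E + H) (hHF : H * F = F * H - (2 : ℚ) • F)
    (hHE : H * E = E * H + (2 : ℚ) • E) {x : W} {μ : ℤ} (hx : H x = (μ : ℚ) • x) (m n : ℕ) :
    divPow E m (divPow F n x) = ∑ j ∈ Finset.range (m + 1),
      Ring.choose (μ - n + m) j • divPowSub F n j (divPow E (m - j) x) := by
  have hw : ∀ p : ℕ, H (divPow E p x) = ((μ : ℚ) + 2 * p) • divPow E p x := fun p => by
    have : H ((E ^ p) x) = ((μ : ℚ) + 2 * p) • (E ^ p) x := by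
      induction p with
      | zero => simpa using hx
      | succ p ih =>
        rw [pow_succ', Module.End.mul_apply, ← Module.End.mul_apply, hHE, LinearMap.add_apply,
          Module.End.mul_apply, ih, map_smul, LinearMap.smul_apply]
        push_cast
        module
    rw [divPow, LinearMap.smul_apply, map_smul, this, smul_comm]
  induction m with
  | zero => simp [divPowSub]
  | succ m ih =>
    set c : ℤ := μ - n + m with hc
    have hc' : μ - n + ((m + 1 : ℕ) : ℤ) = c + 1 := by
      rw [hc]
      push_cast
      ring
    have hsucc : ∀ (p : ℕ) (y : W), E (divPow E p y) = ((p : ℚ) + 1) • divPow E (p + 1) y :=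
      fun p y => by rw [← Module.End.mul_apply, ← succ_smul_divPow, LinearMap.smul_apply]
    have hm0 : (m : ℚ) + 1 ≠ 0 := by positivity
    apply smul_right_injective W hm0
    change ((m : ℚ) + 1) • divPow E (m + 1) (divPow F n x) = ((m : ℚ) + 1) • _
    -- the two halves of `E` applied to the formula for `m`
    have hstep : ∀ j ∈ Finset.range (m + 1),
        E (Ring.choose c j • divPowSub F n j (divPow E (m - j) x)) =
        (((Ring.choose c j : ℤ) : ℚ) * (m + 1 - j)) • divPowSub F n j (divPow E (m + 1 - j) x) +
        (((Ring.choose c j : ℤ) : ℚ) * (c + m - j + 1)) •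
          divPowSub F n (j + 1) (divPow E (m - j) x) := fun j hj => by
      have hjm : j ≤ m := by
        have := Finset.mem_range.1 hj
        omega
      rw [← Int.cast_smul_eq_zsmul ℚ, map_smul, ← Module.End.mul_apply, e_mul_divPowSub hEF hHF,
        LinearMap.add_apply, Module.End.mul_apply, Module.End.mul_apply, LinearMap.sub_apply, hw,
        hsucc, LinearMap.smul_apply, Module.End.one_apply, ← sub_smul, map_smul, map_smul,
        show m - j + 1 = m + 1 - j by omega, smul_add, smul_smul, smul_smul, Nat.cast_sub hjm]
      congr 2
      · ring
      · rw [hc]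
        push_cast
        ring
    have hA : ∑ j ∈ Finset.range (m + 1),
        (((Ring.choose c j : ℤ) : ℚ) * (m + 1 - j)) • divPowSub F n j (divPow E (m + 1 - j) x) =
        ∑ j ∈ Finset.range (m + 1 + 1),
        (((Ring.choose c j : ℤ) : ℚ) * (m + 1 - j)) • divPowSub F n j (divPow E (m + 1 - j) x) := by
      rw [Finset.sum_range_succ _ (m + 1)]
      push_cast
      simp
    rw [← hsucc, ih, map_sum, Finset.sum_congr rfl hstep, Finset.sum_add_distrib, hA, hc',
      Finset.sum_range_succ', Finset.sum_range_succ' _ (m + 1), add_right_comm,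
      ← Finset.sum_add_distrib, smul_add, Finset.smul_sum]
    congr 1
    · refine Finset.sum_congr rfl fun j _ => ?_
      rw [show m + 1 - (j + 1) = m - j by omega, ← add_smul, ← Int.cast_smul_eq_zsmul ℚ, smul_smul]
      congr 1
      have h1 := Ring.choose_succ_succ c j
      have h3 : ((j : ℚ) + 1) * (Ring.choose c (j + 1) : ℤ) =
          (Ring.choose c j : ℤ) * (c - j) := by
        have h2 := Ring.choose_smul_choose c (Nat.le_succ j)
        rw [Nat.choose_succ_self_right, show j.succ - j = 1 by omega, Ring.choose_one_right,
          nsmul_eq_mul] at h2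
        exact_mod_cast h2
      rw [h1]
      push_cast
      linear_combination -h3
    · simp

end SL2Module

/-! ### The highest weight module as a space of functions on words -/

section WordModule

variable {ι : Type} [Fintype ι] [DecidableEq ι]

/-- Functions on words in the index set. The value of a vector at a word `i₁ i₂ ⋯ iₙ` is thought of
as the coefficient of `⋯ e i₂ e i₁` applied to the vector on the highest weight vector. -/
abbrev WordFun (ι : Type) : Type := List ι → ℚ

/-- The operator `e i`: prepend `i` to the argument. -/
def wordE (i : ι) : Module.End ℚ (WordFun ι) where
  toFun f u := f (i :: u)
  map_add' _ _ := rfl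
  map_smul' _ _ := rfl

/-- The operator of multiplication by the number of occurrences of `j` in the argument. -/
def wordDeg (j : ι) : Module.End ℚ (WordFun ι) where
  toFun f u := (u.count j : ℚ) * f u
  map_add' f g := by
    ext u
    exact mul_add _ _ _
  map_smul' c f := by
    ext u
    exact mul_left_comm _ _ _

variable (A : Matrix ι ι ℤ) (wt : ι → ℤ)

/-- The operator `h i` on functions on words, for the highest weight `wt`. -/
def wordH (i : ι) : Module.End ℚ (WordFun ι) :=
  (wt i : ℚ) • 1 - ∑ j, (A i j : ℚ) • wordDeg j

/-- The value of `f i` applied to a function at a word; it is determined by the commutators of `f i`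
with the operators `e j`. -/
def wordFVal (i : ι) : List ι → WordFun ι →ₗ[ℚ] ℚ
  | [] => 0
  | j :: u => wordFVal i u ∘ₗ wordE j +
      if j = i then LinearMap.proj u ∘ₗ wordH A wt i else 0

/-- The operator `f i` on functions on words. -/
def wordF (i : ι) : Module.End ℚ (WordFun ι) := LinearMap.pi (wordFVal A wt i)

variable {A wt}

@[simp] lemma wordE_apply (i : ι) (f : WordFun ι) (u : List ι) : wordE i f u = f (i :: u) := rfl

@[simp] lemma wordDeg_apply (j : ι) (f : WordFun ι) (u : List ι) :
    wordDeg j f u = u.count j * f u := rfl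

@[simp] lemma wordF_nil (i : ι) (f : WordFun ι) : wordF A wt i f [] = 0 := rfl

lemma wordF_cons (i j : ι) (f : WordFun ι) (u : List ι) :
    wordF A wt i f (j :: u) = wordF A wt i (wordE j f) u +
      if j = i then wordH A wt i f u else 0 := by
  change wordFVal A wt i (j :: u) f = _
  rw [wordFVal, LinearMap.add_apply]
  split_ifs <;> rfl

lemma lie_wordE_wordF (i j : ι) :
    ⁅wordE j, wordF A wt i⁆ = if j = i then wordH A wt i else 0 := by
  ext f u
  rw [LieRing.of_associative_ring_bracket, LinearMap.sub_apply, Module.End.mul_apply,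
    Module.End.mul_apply, Pi.sub_apply, wordE_apply, wordF_cons, add_sub_cancel_left]
  split_ifs <;> rfl

lemma lie_wordDeg_wordE (i j : ι) :
    ⁅wordDeg j, wordE i⁆ = if j = i then -wordE i else 0 := by
  ext f u
  rw [LieRing.of_associative_ring_bracket, LinearMap.sub_apply, Module.End.mul_apply,
    Module.End.mul_apply, Pi.sub_apply, wordE_apply, wordDeg_apply, wordDeg_apply, wordE_apply]
  rcases eq_or_ne j i with rfl | h
  · rw [if_pos rfl, List.count_cons_self, LinearMap.neg_apply, Pi.neg_apply, wordE_apply]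
    push_cast
    ring
  · rw [if_neg h, List.count_cons_of_ne h.symm, sub_self]
    rfl

lemma wordH_apply (i : ι) (f : WordFun ι) (u : List ι) :
    wordH A wt i f u = ((wt i : ℚ) - ∑ j, (A i j : ℚ) * u.count j) * f u := by
  rw [wordH, LinearMap.sub_apply, LinearMap.sum_apply, Pi.sub_apply, Finset.sum_apply, sub_mul,
    Finset.sum_mul]
  congr 1
  exact Finset.sum_congr rfl fun j _ => by
    rw [LinearMap.smul_apply, Pi.smul_apply, wordDeg_apply, smul_eq_mul, mul_assoc]

lemma lie_wordDeg_wordF (i j : ι) :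
    ⁅wordDeg j, wordF A wt i⁆ = if j = i then wordF A wt i else 0 := by
  have key : ∀ (u : List ι) (f : WordFun ι), wordF A wt i (wordDeg j f) u =
      (u.count j : ℚ) * wordF A wt i f u - if j = i then wordF A wt i f u else 0 := by
    intro u
    induction u with
    | nil => simp
    | cons l u ih =>
      intro f
      have h1 : wordE l (wordDeg j f) =
          wordDeg j (wordE l f) + if j = l then wordE l f else 0 := by
        have := congrArg (fun D : Module.End ℚ (WordFun ι) => D f) (lie_wordDeg_wordE l j)
        simp only [LieRing.of_associative_ring_bracket, LinearMap.sub_apply,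
          Module.End.mul_apply] at this
        rw [← sub_eq_iff_eq_add', ← neg_sub, this]
        split_ifs <;> simp
      have h2 : wordH A wt i (wordDeg j f) u = u.count j * wordH A wt i f u := by
        rw [wordH_apply, wordH_apply, wordDeg_apply]
        ring
      rw [wordF_cons, wordF_cons, h1, map_add, Pi.add_apply, ih, h2]
      rcases eq_or_ne j l with rfl | hjl
      · rw [if_pos rfl, List.count_cons_self]
        split_ifs <;> push_cast <;> ring
      · rw [if_neg hjl, List.count_cons_of_ne hjl.symm, map_zero, Pi.zero_apply]
        rcases eq_or_ne l i with rfl | hli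
        · rw [if_pos rfl, if_pos rfl, if_neg hjl, if_neg hjl]
          ring
        · rw [if_neg hli, if_neg hli]
          split_ifs <;> ring
  ext f u
  rw [LieRing.of_associative_ring_bracket, LinearMap.sub_apply, Module.End.mul_apply,
    Module.End.mul_apply, Pi.sub_apply, wordDeg_apply, key]
  split_ifs <;> simp

lemma lie_wordH (i : ι) (D : Module.End ℚ (WordFun ι)) :
    ⁅wordH A wt i, D⁆ = -∑ j, (A i j : ℚ) • ⁅wordDeg j, D⁆ := by
  simp only [LieRing.of_associative_ring_bracket, wordH, sub_mul, mul_sub, Finset.sum_mul,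
    Finset.mul_sum, smul_mul_assoc, mul_smul_comm, one_mul, mul_one, smul_sub,
    Finset.sum_sub_distrib]
  abel

lemma lie_wordH_wordE (i j : ι) : ⁅wordH A wt i, wordE j⁆ = (A i j : ℚ) • wordE j := by
  rw [lie_wordH]
  simp only [lie_wordDeg_wordE, smul_ite, smul_zero]
  rw [Finset.sum_ite_eq' Finset.univ j, if_pos (Finset.mem_univ _), smul_neg, neg_neg]

lemma lie_wordH_wordF (i j : ι) :
    ⁅wordH A wt i, wordF A wt j⁆ = (-A i j : ℚ) • wordF A wt j := by
  rw [lie_wordH]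
  simp only [lie_wordDeg_wordF, smul_ite, smul_zero]
  rw [Finset.sum_ite_eq' Finset.univ j, if_pos (Finset.mem_univ _)]
  exact (neg_smul _ _).symm

lemma lie_wordH_wordH (i j : ι) : ⁅wordH A wt i, wordH A wt j⁆ = 0 := by
  ext f u
  rw [LieRing.of_associative_ring_bracket, LinearMap.sub_apply, Module.End.mul_apply,
    Module.End.mul_apply, Pi.sub_apply, wordH_apply, wordH_apply,
    wordH_apply, wordH_apply, LinearMap.zero_apply, Pi.zero_apply]
  ring

/-! ### The Serre relations on functions on words -/

lemma eq_zero_of_wordE {g : WordFun ι} (h : ∀ j, wordE j g = 0) (h0 : g [] = 0) : g = 0 := by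
  ext u
  cases u with
  | nil => exact h0
  | cons j u => exact congrFun (h j) u

/-- The Serre relation for the `f i` holds for all functions on words: the Serre element commutes
with the `e l`, and its values vanish at the empty word, so they vanish at all words. -/
lemma wordF_serre (h2 : ∀ i, A i i = 2) (hoff : ∀ i j, i ≠ j → A i j ≤ 0)
    (hsymm : ∀ i j, A i j = 0 → A j i = 0) {i j : ι} (hij : i ≠ j) :
    (LieAlgebra.ad ℚ (Module.End ℚ (WordFun ι)) (wordF A wt i) ^ ((-A i j).toNat + 1))
      (wordF A wt j) = 0 := by
  set θ := (LieAlgebra.ad ℚ (Module.End ℚ (WordFun ι)) (wordF A wt i) ^ ((-A i j).toNat + 1))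
      (wordF A wt j) with hθ
  have hcomm : ∀ l, ⁅wordE l, θ⁆ = 0 := fun l =>
    lie_serre_eq_zero h2 hoff hsymm (h := wordH A wt)
      (fun i => by rw [lie_wordE_wordF, if_pos rfl])
      (fun i j hij => by rw [lie_wordE_wordF, if_neg hij]) lie_wordH_wordF hij l
  have hnil : ∀ n f, ((LieAlgebra.ad ℚ (Module.End ℚ (WordFun ι)) (wordF A wt i) ^ n)
      (wordF A wt j)) f [] = 0 := fun n => by
    induction n with
    | zero => exact fun f => rfl
    | succ n ih =>
      intro f
      rw [pow_succ', Module.End.mul_apply, LieAlgebra.ad_apply,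
        LieRing.of_associative_ring_bracket, LinearMap.sub_apply, Module.End.mul_apply,
        Module.End.mul_apply, Pi.sub_apply, ih, wordF_nil, sub_zero]
  have key : ∀ (u : List ι) f, θ f u = 0 := fun u => by
    induction u with
    | nil => exact hnil _
    | cons l u ih =>
      intro f
      have := congrArg (fun D : Module.End ℚ (WordFun ι) => D f u) (hcomm l)
      simp only [LieRing.of_associative_ring_bracket, LinearMap.sub_apply,
        Module.End.mul_apply, Pi.sub_apply, wordE_apply, ih, sub_zero] at this
      exact this
  ext f u
  exact key u f

/-- The highest weight vector. -/
def wordOne : WordFun ι := fun u => if u = [] then 1 else 0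

lemma wordE_wordOne (i : ι) : wordE i (wordOne : WordFun ι) = 0 := by
  ext u
  simp [wordOne]

lemma wordDeg_wordOne (i : ι) : wordDeg i (wordOne : WordFun ι) = 0 := by
  ext u
  cases u <;> simp [wordOne]

lemma wordH_wordOne (i : ι) : wordH A wt i (wordOne : WordFun ι) = (wt i : ℚ) • wordOne := by
  rw [wordH, LinearMap.sub_apply, LinearMap.sum_apply]
  simp [wordDeg_wordOne]

lemma wordE_mul_wordF (i : ι) :
    wordE i * wordF A wt i = wordF A wt i * wordE i + wordH A wt i := by
  have := lie_wordE_wordF (A := A) (wt := wt) i i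
  rw [if_pos rfl, LieRing.of_associative_ring_bracket] at this
  rw [← this]
  abel

lemma commute_wordE_wordF {i j : ι} (hij : i ≠ j) : Commute (wordE i) (wordF A wt j) := by
  have := lie_wordE_wordF (A := A) (wt := wt) j i
  rw [if_neg hij, LieRing.of_associative_ring_bracket] at this
  exact sub_eq_zero.1 this

lemma wordH_mul_wordF (h2 : ∀ i, A i i = 2) (i : ι) :
    wordH A wt i * wordF A wt i = wordF A wt i * wordH A wt i - (2 : ℚ) • wordF A wt i := by
  have := lie_wordH_wordF (A := A) (wt := wt) i i
  rw [LieRing.of_associative_ring_bracket, sub_eq_iff_eq_add, h2] at this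
  rw [this]
  push_cast
  module

lemma wordH_mul_wordE (h2 : ∀ i, A i i = 2) (i : ι) :
    wordH A wt i * wordE i = wordE i * wordH A wt i + (2 : ℚ) • wordE i := by
  have := lie_wordH_wordE (A := A) (wt := wt) i i
  rw [LieRing.of_associative_ring_bracket, sub_eq_iff_eq_add, h2] at this
  rw [this]
  push_cast
  module

/-- For a dominant weight a power of `f i` kills the highest weight vector. -/
lemma wordF_pow_wordOne (h2 : ∀ i, A i i = 2) {i : ι} (hi : 0 ≤ wt i) :
    (wordF A wt i ^ ((wt i).toNat + 1)) (wordOne : WordFun ι) = 0 := by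
  refine eq_zero_of_wordE (fun j => ?_) ?_
  · rcases eq_or_ne j i with rfl | hij
    · rw [← Module.End.mul_apply, e_mul_f_pow (wordE_mul_wordF j) (wordH_mul_wordF h2 j),
        LinearMap.add_apply, Module.End.mul_apply, wordE_wordOne, map_zero, LinearMap.smul_apply,
        Module.End.mul_apply, LinearMap.sub_apply, wordH_wordOne, LinearMap.smul_apply,
        Module.End.one_apply, ← sub_smul]
      have : ((wt j).toNat : ℚ) = wt j := by exact_mod_cast Int.toNat_of_nonneg hi
      rw [this, sub_self, zero_smul, map_zero, smul_zero, zero_add]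
    · rw [← Module.End.mul_apply, ((commute_wordE_wordF hij).pow_right _).eq,
        Module.End.mul_apply, wordE_wordOne, map_zero]
  · rw [pow_succ', Module.End.mul_apply, wordF_nil]

/-! ### The lattice generated by the highest weight vector -/

variable (A wt) in
/-- The vectors obtained from the highest weight vector by divided powers of the `f i`, with their
multidegrees. -/
inductive IsMonomial : (ι → ℤ) → WordFun ι → Prop
  | one : IsMonomial 0 wordOne
  | step (i : ι) (n : ℕ) (d : ι → ℤ) (x : WordFun ι) : IsMonomial d x →
      IsMonomial (d + Pi.single i (n : ℤ)) (divPow (wordF A wt i) n x)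

variable (A wt) in
/-- The lattice in the highest weight module. -/
def wordLat : Submodule ℤ (WordFun ι) := Submodule.span ℤ {x | ∃ d, IsMonomial A wt d x}

lemma IsMonomial.deg {d : ι → ℤ} {x : WordFun ι} (hx : IsMonomial A wt d x) (j : ι) :
    wordDeg j x = (d j : ℚ) • x := by
  induction hx with
  | one => simp [wordDeg_wordOne]
  | step i n d x _ ih =>
    have hcomm : wordDeg j * wordF A wt i =
        wordF A wt i * wordDeg j + if j = i then wordF A wt i else 0 := by
      have := lie_wordDeg_wordF (A := A) (wt := wt) i j
      rw [LieRing.of_associative_ring_bracket] at this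
      rw [← this]
      abel
    have key : ∀ n : ℕ, wordDeg j ((wordF A wt i ^ n) x) =
        (((d + Pi.single i (n : ℤ) : ι → ℤ) j : ℤ) : ℚ) • (wordF A wt i ^ n) x := fun n => by
      induction n with
      | zero => simpa using ih
      | succ n ih =>
        rw [pow_succ', Module.End.mul_apply, ← Module.End.mul_apply, hcomm, LinearMap.add_apply,
          Module.End.mul_apply, ih, map_smul]
        rcases eq_or_ne j i with rfl | hij
        · simp only [if_true, Pi.add_apply, Pi.single_eq_same]
          push_cast
          module
        · simp [if_neg hij, Pi.single_eq_of_ne hij]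
    rw [divPow, LinearMap.smul_apply, map_smul, key, smul_comm]

lemma wordH_of_deg {d : ι → ℤ} {x : WordFun ι} (hx : ∀ j, wordDeg j x = (d j : ℚ) • x) (i : ι) :
    wordH A wt i x = ((wt i - ∑ j, A i j * d j : ℤ) : ℚ) • x := by
  rw [wordH, LinearMap.sub_apply, LinearMap.sum_apply]
  simp only [LinearMap.smul_apply, hx, smul_smul, Module.End.one_apply]
  rw [← Finset.sum_smul, ← sub_smul]
  push_cast
  rfl

lemma IsMonomial.divPow_wordF_mem {d : ι → ℤ} {x : WordFun ι} (hx : IsMonomial A wt d x) (i : ι)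
    (n : ℕ) : divPow (wordF A wt i) n x ∈ wordLat A wt :=
  Submodule.subset_span ⟨_, hx.step i n⟩

lemma stab_divPow_wordF (i : ι) (n : ℕ) : Stab (wordLat A wt) (divPow (wordF A wt i) n) :=
  fun x hx => by
  induction hx using Submodule.span_induction with
  | mem x hx =>
    obtain ⟨d, hx⟩ := hx
    exact hx.divPow_wordF_mem i n
  | zero => rw [map_zero]; exact Submodule.zero_mem _
  | add x y _ _ hx hy => rw [map_add]; exact Submodule.add_mem _ hx hy
  | smul c x _ hx => rw [map_zsmul]; exact Submodule.smul_mem _ c hx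

/-- Moving a divided power of `e i` to the right past the divided powers of the `f j` produces only
integral coefficients, and the highest weight vector is killed by `e i`. -/
lemma stab_divPow_wordE (h2 : ∀ i, A i i = 2) (i : ι) (m : ℕ) :
    Stab (wordLat A wt) (divPow (wordE i) m) := fun x hx => by
  induction hx using Submodule.span_induction with
  | mem x hx =>
    obtain ⟨d, hx⟩ := hx
    induction hx generalizing m with
    | one =>
      rcases m with _ | m
      · rw [divPow_zero]
        exact Submodule.subset_span ⟨0, .one⟩
      · rw [divPow, pow_succ, LinearMap.smul_apply, Module.End.mul_apply, wordE_wordOne, map_zero,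
          smul_zero]
        exact Submodule.zero_mem _
    | step j n d x hx ih =>
      rcases eq_or_ne i j with rfl | hij
      · rw [divPow_e_divPow_f (wordE_mul_wordF i) (wordH_mul_wordF h2 i) (wordH_mul_wordE h2 i)
          (wordH_of_deg hx.deg i)]
        refine Submodule.sum_mem _ fun l _ => Submodule.smul_mem _ _ ?_
        rw [divPowSub]
        split_ifs
        · exact stab_divPow_wordF i _ _ (ih _)
        · exact Submodule.zero_mem _
      · have hc : Commute (divPow (wordE i) m) (divPow (wordF A wt j) n) := by
          rw [divPow, divPow]
          exact ((((commute_wordE_wordF hij).pow_left m).pow_right n).smul_left _).smul_right _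
        rw [← Module.End.mul_apply, hc.eq, Module.End.mul_apply]
        exact stab_divPow_wordF j n _ (ih m)
  | zero => rw [map_zero]; exact Submodule.zero_mem _
  | add x y _ _ hx hy => rw [map_add]; exact Submodule.add_mem _ hx hy
  | smul c x _ hx => rw [map_zsmul]; exact Submodule.smul_mem _ c hx

/-- The elements of the lattice have integral values at the empty word. -/
lemma exists_int_of_mem_wordLat {x : WordFun ι} (hx : x ∈ wordLat A wt) : ∃ n : ℤ, x [] = n := by
  induction hx using Submodule.span_induction with
  | mem x hx =>
    obtain ⟨d, hx⟩ := hx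
    induction hx with
    | one => exact ⟨1, by simp [wordOne]⟩
    | step i n d x _ ih =>
      rcases n with _ | n
      · simpa using ih
      · refine ⟨0, ?_⟩
        rw [divPow, LinearMap.smul_apply, Pi.smul_apply, pow_succ', Module.End.mul_apply,
          wordF_nil, smul_zero, Int.cast_zero]
  | zero => exact ⟨0, by simp⟩
  | add x y _ _ hx hy =>
    obtain ⟨m, hm⟩ := hx
    obtain ⟨n, hn⟩ := hy
    exact ⟨m + n, by rw [Pi.add_apply, hm, hn]; push_cast; rfl⟩
  | smul c x _ hx =>
    obtain ⟨m, hm⟩ := hx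
    exact ⟨c * m, by rw [Pi.smul_apply, hm, zsmul_eq_mul]; push_cast; rfl⟩

/-- The Serre element of the `e i` kills the highest weight vector and commutes with the `f i`. -/
lemma IsMonomial.wordE_serre (h2 : ∀ i, A i i = 2) (hoff : ∀ i j, i ≠ j → A i j ≤ 0)
    (hsymm : ∀ i j, A i j = 0 → A j i = 0) {i j : ι} (hij : i ≠ j) {d : ι → ℤ} {x : WordFun ι}
    (hx : IsMonomial A wt d x) :
    (LieAlgebra.ad ℚ (Module.End ℚ (WordFun ι)) (wordE i) ^ ((-A i j).toNat + 1))
      (wordE j) x = 0 := by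
  set θ := (LieAlgebra.ad ℚ (Module.End ℚ (WordFun ι)) (wordE i) ^ ((-A i j).toNat + 1))
      (wordE j) with hθ
  have hfe : ∀ i j, ⁅wordF A wt i, wordE j⁆ = if j = i then -wordH A wt i else 0 := fun i j => by
    rw [← lie_skew, lie_wordE_wordF]
    split_ifs <;> simp
  have hcomm : ∀ l, Commute (wordF A wt l) θ := fun l => by
    have : ⁅wordF A wt l, θ⁆ = 0 :=
      lie_serre_eq_zero h2 hoff hsymm (h := fun i => -wordH A wt i)
        (fun i => by rw [hfe, if_pos rfl])
        (fun i j hij => by rw [hfe, if_neg hij.symm])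
        (fun i j => by rw [neg_lie, lie_wordH_wordE, neg_smul]) hij l
    rw [LieRing.of_associative_ring_bracket] at this
    exact sub_eq_zero.1 this
  induction hx with
  | one =>
    have : ∀ n : ℕ, ((LieAlgebra.ad ℚ (Module.End ℚ (WordFun ι)) (wordE i) ^ n)
        (wordE j)) wordOne = 0 := fun n => by
      induction n with
      | zero => exact wordE_wordOne j
      | succ n ih =>
        rw [pow_succ', Module.End.mul_apply, LieAlgebra.ad_apply,
          LieRing.of_associative_ring_bracket, LinearMap.sub_apply, Module.End.mul_apply,
          Module.End.mul_apply, ih, wordE_wordOne, map_zero, map_zero, sub_zero]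
    exact this _
  | step l n d x _ ih =>
    have hc : Commute θ (divPow (wordF A wt l) n) := ((hcomm l).symm.pow_right n).smul_right _
    rw [← Module.End.mul_apply, hc.eq, Module.End.mul_apply, ih, map_zero]

end WordModule

/-! ### The integrable highest weight module and its lattice -/

section LieLift

open CartanMatrix

variable {ι : Type} [DecidableEq ι] {A : Matrix ι ι ℤ} {𝔤 : Type*} [LieRing 𝔤] [LieAlgebra ℚ 𝔤]

/-- Elements of a Lie algebra that satisfy the Chevalley-Serre relations of a generalized Cartan
matrix. -/
structure ChevalleySerre (A : Matrix ι ι ℤ) (e f h : ι → 𝔤) : Prop where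
  hh : ∀ i j, ⁅h i, h j⁆ = 0
  ef : ∀ i j, ⁅e i, f j⁆ = if i = j then h i else 0
  he : ∀ i j, ⁅h i, e j⁆ = (A i j : ℚ) • e j
  hf : ∀ i j, ⁅h i, f j⁆ = (-A i j : ℚ) • f j
  serre_e : ∀ i j, i ≠ j → (LieAlgebra.ad ℚ 𝔤 (e i) ^ ((-A i j).toNat + 1)) (e j) = 0
  serre_f : ∀ i j, i ≠ j → (LieAlgebra.ad ℚ 𝔤 (f i) ^ ((-A i j).toNat + 1)) (f j) = 0

variable {e f h : ι → 𝔤}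

/-- The homomorphism from the free Lie algebra with given values on the generators. -/
def freeLieLift (e f h : ι → 𝔤) : FreeLieAlgebra ℚ (Generators ι) →ₗ⁅ℚ⁆ 𝔤 :=
  FreeLieAlgebra.lift ℚ fun g => match g with
    | .H i => h i
    | .E i => e i
    | .F i => f i

lemma freeLieLift_H (i : ι) : freeLieLift e f h (FreeLieAlgebra.of ℚ (Generators.H i)) = h i :=
  FreeLieAlgebra.lift_of_apply _ _

lemma freeLieLift_E (i : ι) : freeLieLift e f h (FreeLieAlgebra.of ℚ (Generators.E i)) = e i :=
  FreeLieAlgebra.lift_of_apply _ _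

lemma freeLieLift_F (i : ι) : freeLieLift e f h (FreeLieAlgebra.of ℚ (Generators.F i)) = f i :=
  FreeLieAlgebra.lift_of_apply _ _

lemma ChevalleySerre.toIdeal_le (hc : ChevalleySerre A e f h) :
    Relations.toIdeal ℚ A ≤ (freeLieLift e f h).ker := by
  refine (LieSubmodule.lieSpan_le).2 fun x hx => ?_
  change x ∈ (freeLieLift e f h).ker
  rw [LieHom.mem_ker]
  rcases hx with ((((⟨⟨i, j⟩, rfl⟩ | ⟨⟨i, j⟩, rfl⟩) | ⟨⟨i, j⟩, rfl⟩) | ⟨⟨i, j⟩, rfl⟩) |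
    ⟨⟨i, j⟩, rfl⟩) | ⟨⟨i, j⟩, rfl⟩
  · simp only [Relations.HH, Function.uncurry_apply_pair, LieHom.map_lie, Function.comp_apply,
      freeLieLift_H, hc.hh]
  · rcases eq_or_ne i j with rfl | hij
    · simp only [Relations.EF, Function.uncurry_apply_pair, if_true, map_sub, LieHom.map_lie,
        Function.comp_apply, freeLieLift_H, freeLieLift_E, freeLieLift_F, hc.ef, sub_self]
    · simp only [Relations.EF, Function.uncurry_apply_pair, if_neg hij, LieHom.map_lie,
        Function.comp_apply, freeLieLift_E, freeLieLift_F, hc.ef]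
  · simp only [Relations.HE, Function.uncurry_apply_pair, map_sub, LieHom.map_lie, map_zsmul,
      Function.comp_apply, freeLieLift_H, freeLieLift_E, hc.he, Int.cast_smul_eq_zsmul, sub_self]
  · simp only [Relations.HF, Function.uncurry_apply_pair, map_add, LieHom.map_lie, map_zsmul,
      Function.comp_apply, freeLieLift_H, freeLieLift_F, hc.hf, neg_smul, Int.cast_smul_eq_zsmul,
      neg_add_cancel]
  · simp only [Relations.adE, Function.uncurry_apply_pair, map_ad_pow, LieHom.map_lie,
      Function.comp_apply, freeLieLift_E]
    rcases eq_or_ne i j with rfl | hij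
    · rw [lie_self, map_zero]
    · rw [← hc.serre_e i j hij, pow_succ, Module.End.mul_apply, LieAlgebra.ad_apply]
  · simp only [Relations.adF, Function.uncurry_apply_pair, map_ad_pow, LieHom.map_lie,
      Function.comp_apply, freeLieLift_F]
    rcases eq_or_ne i j with rfl | hij
    · rw [lie_self, map_zero]
    · rw [← hc.serre_f i j hij, pow_succ, Module.End.mul_apply, LieAlgebra.ad_apply]

/-- The homomorphism from the Kac-Moody Lie algebra given by elements that satisfy the
Chevalley-Serre relations. -/
def lieLift (hc : ChevalleySerre A e f h) : LieAlg A →ₗ⁅ℚ⁆ 𝔤 where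
  toLinearMap := (Relations.toIdeal ℚ A).toSubmodule.liftQ
    (freeLieLift e f h : FreeLieAlgebra ℚ (Generators ι) →ₗ[ℚ] 𝔤) fun _ hx => hc.toIdeal_le hx
  map_lie' {x y} := by
    obtain ⟨x, rfl⟩ := lieMk_surjective A x
    obtain ⟨y, rfl⟩ := lieMk_surjective A y
    rw [← LieHom.map_lie]
    exact LieHom.map_lie (freeLieLift e f h) x y

lemma lieLift_lieE (hc : ChevalleySerre A e f h) (i : ι) : lieLift hc (lieE A i) = e i :=
  freeLieLift_E i

lemma lieLift_lieF (hc : ChevalleySerre A e f h) (i : ι) : lieLift hc (lieF A i) = f i :=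
  freeLieLift_F i

lemma lieLift_lieH (hc : ChevalleySerre A e f h) (i : ι) : lieLift hc (lieH A i) = h i :=
  freeLieLift_H i

end LieLift

section RestrictMod

variable {W : Type*} [AddCommGroup W] [Module ℚ W] {V : Submodule ℚ W}

/-- The operator `D` on the subspace `V` is the restriction of `D'`. -/
def IsRestr (D : Module.End ℚ V) (D' : Module.End ℚ W) : Prop := ∀ x : V, (D x : W) = D' x

namespace IsRestr

variable {D B : Module.End ℚ V} {D' B' : Module.End ℚ W}

lemma mul (h : IsRestr D D') (h' : IsRestr B B') : IsRestr (D * B) (D' * B') := fun x => by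
  rw [Module.End.mul_apply, Module.End.mul_apply, h, h']

lemma sub (h : IsRestr D D') (h' : IsRestr B B') : IsRestr (D - B) (D' - B') := fun x => by
  rw [LinearMap.sub_apply, LinearMap.sub_apply, Submodule.coe_sub, h, h']

lemma smul (h : IsRestr D D') (c : ℚ) : IsRestr (c • D) (c • D') := fun x => by
  rw [LinearMap.smul_apply, LinearMap.smul_apply, Submodule.coe_smul, h]

lemma zero : IsRestr (0 : Module.End ℚ V) 0 := fun _ => rfl

lemma pow (h : IsRestr D D') (n : ℕ) : IsRestr (D ^ n) (D' ^ n) := by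
  induction n with
  | zero => exact fun x => rfl
  | succ n ih =>
    rw [pow_succ, pow_succ]
    exact ih.mul h

lemma divPow (h : IsRestr D D') (n : ℕ) : IsRestr (divPow D n) (divPow D' n) := (h.pow n).smul _

lemma lie (h : IsRestr D D') (h' : IsRestr B B') : IsRestr ⁅D, B⁆ ⁅D', B'⁆ := by
  rw [LieRing.of_associative_ring_bracket, LieRing.of_associative_ring_bracket]
  exact (h.mul h').sub (h'.mul h)

lemma ad_pow (h : IsRestr D D') (h' : IsRestr B B') (n : ℕ) :
    IsRestr ((LieAlgebra.ad ℚ (Module.End ℚ V) D ^ n) B)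
      ((LieAlgebra.ad ℚ (Module.End ℚ W) D' ^ n) B') := by
  induction n with
  | zero => exact h'
  | succ n ih =>
    rw [pow_succ', pow_succ']
    exact h.lie ih

lemma ext (h : IsRestr D D') (h' : IsRestr B D') : D = B :=
  LinearMap.ext fun x => Subtype.ext ((h x).trans (h' x).symm)

end IsRestr

end RestrictMod

section WordModule

variable {ι : Type} [Fintype ι] [DecidableEq ι] (A : Matrix ι ι ℤ) (wt : ι → ℤ)

/-- The highest weight module, generated by the highest weight vector in the space of functions on
words. -/
def wordMod : Submodule ℚ (WordFun ι) := Submodule.span ℚ {x | ∃ d, IsMonomial A wt d x}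

/-- The projection to the functions supported on words with `d j` occurrences of `j`. -/
def wordProj (d : ι → ℤ) : Module.End ℚ (WordFun ι) where
  toFun f u := if ∀ j, (u.count j : ℤ) = d j then f u else 0
  map_add' f g := by
    ext u
    simp only [Pi.add_apply]
    split_ifs <;> simp
  map_smul' c f := by
    ext u
    simp

variable {A wt}

lemma wordProj_of_deg {d d' : ι → ℤ} {x : WordFun ι} (hx : ∀ j, wordDeg j x = (d j : ℚ) • x) :
    wordProj d' x = if d' = d then x else 0 := by
  have h0 : ∀ u, x u ≠ 0 → ∀ j, (u.count j : ℤ) = d j := fun u hu j => by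
    have := congrFun (hx j) u
    rw [wordDeg_apply, Pi.smul_apply, smul_eq_mul] at this
    exact_mod_cast mul_right_cancel₀ hu this
  ext u
  change (if ∀ j, (u.count j : ℤ) = d' j then x u else 0) = _
  by_cases hu : x u = 0
  · rw [hu, ite_self]
    split_ifs <;> simp [hu]
  · rcases eq_or_ne d' d with rfl | hd
    · rw [if_pos (h0 u hu), if_pos rfl]
    · rw [if_neg hd, if_neg]
      · rfl
      · exact fun h => hd (funext fun j => by rw [← h j, h0 u hu j])

lemma wordDeg_wordProj (d : ι → ℤ) (j : ι) (x : WordFun ι) :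
    wordDeg j (wordProj d x) = (d j : ℚ) • wordProj d x := by
  ext u
  change (u.count j : ℚ) * (if ∀ j, (u.count j : ℤ) = d j then x u else 0) =
    (d j : ℚ) • (if ∀ j, (u.count j : ℤ) = d j then x u else 0)
  split_ifs with h
  · rw [← h j, smul_eq_mul, Int.cast_natCast]
  · simp

lemma wordE_pow_apply (i : ι) (n : ℕ) (f : WordFun ι) (u : List ι) :
    (wordE i ^ n) f u = f (List.replicate n i ++ u) := by
  induction n generalizing f with
  | zero => rfl
  | succ n ih =>
    rw [pow_succ, Module.End.mul_apply, ih, wordE_apply, List.replicate_succ, List.cons_append]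

lemma IsMonomial.wordE_pow {d : ι → ℤ} {x : WordFun ι} (hx : IsMonomial A wt d x) (i : ι) :
    (wordE i ^ ((d i).toNat + 1)) x = 0 := by
  ext u
  rw [wordE_pow_apply]
  by_contra h
  have := congrFun (hx.deg i) (List.replicate ((d i).toNat + 1) i ++ u)
  rw [wordDeg_apply, Pi.smul_apply, smul_eq_mul] at this
  have h1 := mul_right_cancel₀ h this
  rw [List.count_append, List.count_replicate_self] at h1
  have h2 : (((d i).toNat + 1 + u.count i : ℕ) : ℤ) = d i := by exact_mod_cast h1
  have := Int.self_le_toNat (d i)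
  push_cast at h2
  omega

/-- For a dominant weight the `f i` are locally nilpotent on the highest weight module. -/
lemma IsMonomial.wordF_locNil (h2 : ∀ i, A i i = 2) (hoff : ∀ i j, i ≠ j → A i j ≤ 0)
    (hsymm : ∀ i j, A i j = 0 → A j i = 0) (hwt : ∀ i, 0 ≤ wt i) {d : ι → ℤ} {x : WordFun ι}
    (hx : IsMonomial A wt d x) (i : ι) : ∃ n : ℕ, (wordF A wt i ^ n) x = 0 := by
  suffices h : x ∈ Module.End.maxGenEigenspace (wordF A wt i) 0 by
    rw [Module.End.mem_maxGenEigenspace] at h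
    simpa using h
  -- The generalized kernel of `f i` is stable under `f j`, as `ad (f i)` is nilpotent on `f j`.
  have key : ∀ (j : ι) (y : WordFun ι), y ∈ Module.End.maxGenEigenspace (wordF A wt i) 0 →
      wordF A wt j y ∈ Module.End.maxGenEigenspace (wordF A wt i) 0 := fun j y hy => by
    have hj : wordF A wt j ∈ Module.End.maxGenEigenspace
        (LieAlgebra.ad ℚ (Module.End ℚ (WordFun ι)) (wordF A wt i)) 0 := by
      rw [Module.End.mem_maxGenEigenspace]
      rcases eq_or_ne i j with rfl | hij
      · exact ⟨1, by rw [zero_smul, sub_zero, pow_one, LieAlgebra.ad_apply, lie_self]⟩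
      · exact ⟨_, by rw [zero_smul, sub_zero]; exact wordF_serre h2 hoff hsymm hij⟩
    have := LieModule.lie_mem_maxGenEigenspace_toEnd (R := ℚ)
      (L := Module.End ℚ (WordFun ι)) (M := WordFun ι) (χ₁ := 0) (χ₂ := 0) (x := wordF A wt i)
      (y := wordF A wt j) (m := y) hj hy
    rw [add_zero] at this
    exact this
  induction hx with
  | one =>
    rw [Module.End.mem_maxGenEigenspace]
    exact ⟨_, by rw [zero_smul, sub_zero]; exact wordF_pow_wordOne h2 (hwt i)⟩
  | step j n d x _ ih =>
    rw [divPow, LinearMap.smul_apply]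
    refine Submodule.smul_mem _ _ ?_
    induction n with
    | zero => exact ih
    | succ n ihn =>
      rw [pow_succ', Module.End.mul_apply]
      exact key j _ ihn

lemma IsMonomial.mem {d : ι → ℤ} {x : WordFun ι} (hx : IsMonomial A wt d x) : x ∈ wordMod A wt :=
  Submodule.subset_span ⟨d, hx⟩

lemma wordLat_le {x : WordFun ι} (hx : x ∈ wordLat A wt) : x ∈ wordMod A wt := by
  induction hx using Submodule.span_induction with
  | mem x hx =>
    obtain ⟨d, hx⟩ := hx
    exact hx.mem
  | zero => exact Submodule.zero_mem _
  | add x y _ _ hx hy => exact Submodule.add_mem _ hx hy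
  | smul c x _ hx =>
    rw [← Int.cast_smul_eq_zsmul ℚ]
    exact Submodule.smul_mem _ _ hx

/-- An operator that maps the monomials into the highest weight module can be restricted to it. -/
def restrMod (D : Module.End ℚ (WordFun ι))
    (h : ∀ d x, IsMonomial A wt d x → D x ∈ wordMod A wt) : Module.End ℚ (wordMod A wt) :=
  D.restrict (p := wordMod A wt) (q := wordMod A wt) fun x hx => by
    have : wordMod A wt ≤ (wordMod A wt).comap D := Submodule.span_le.2 fun x ⟨d, hx⟩ => h d x hx
    exact this hx

lemma isRestr_restrMod (D : Module.End ℚ (WordFun ι))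
    (h : ∀ d x, IsMonomial A wt d x → D x ∈ wordMod A wt) : IsRestr (restrMod D h) D :=
  fun _ => rfl

lemma eq_of_isRestr {D B : Module.End ℚ (wordMod A wt)} {D' B' : Module.End ℚ (WordFun ι)}
    (hD : IsRestr D D') (hB : IsRestr B B') (h : ∀ d x, IsMonomial A wt d x → D' x = B' x) :
    D = B := by
  have : wordMod A wt ≤ LinearMap.eqLocus D' B' := Submodule.span_le.2 fun x ⟨d, hx⟩ => h d x hx
  exact LinearMap.ext fun x => Subtype.ext (by rw [hD, hB]; exact this x.2)

variable (A wt)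

/-- The operator `e i` on the highest weight module. -/
def modE (h2 : ∀ i, A i i = 2) (i : ι) : Module.End ℚ (wordMod A wt) :=
  restrMod (wordE i) fun _ _ hx => wordLat_le (by
    simpa using stab_divPow_wordE h2 i 1 _ (Submodule.subset_span ⟨_, hx⟩))

/-- The operator `f i` on the highest weight module. -/
def modF (i : ι) : Module.End ℚ (wordMod A wt) :=
  restrMod (wordF A wt i) fun _ _ hx => wordLat_le (by simpa using hx.divPow_wordF_mem i 1)

/-- The operator `h i` on the highest weight module. -/
def modH (i : ι) : Module.End ℚ (wordMod A wt) :=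
  restrMod (wordH A wt i) fun _ _ hx => by
    rw [wordH_of_deg hx.deg]
    exact Submodule.smul_mem _ _ hx.mem

/-- The degree operators on the highest weight module. -/
def modDeg (j : ι) : Module.End ℚ (wordMod A wt) :=
  restrMod (wordDeg j) fun _ _ hx => by
    rw [hx.deg]
    exact Submodule.smul_mem _ _ hx.mem

/-- The projections of the highest weight module to its homogeneous components. -/
def modProj (d : ι → ℤ) : Module.End ℚ (wordMod A wt) :=
  restrMod (wordProj d) fun _ _ hx => by
    rw [wordProj_of_deg hx.deg]
    split_ifs
    · exact hx.mem
    · exact Submodule.zero_mem _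

variable {A wt}

lemma isRestr_modE (h2 : ∀ i, A i i = 2) (i : ι) : IsRestr (modE A wt h2 i) (wordE i) :=
  isRestr_restrMod _ _

lemma isRestr_modF (i : ι) : IsRestr (modF A wt i) (wordF A wt i) := isRestr_restrMod _ _

lemma isRestr_modH (i : ι) : IsRestr (modH A wt i) (wordH A wt i) := isRestr_restrMod _ _

lemma isRestr_modDeg (i : ι) : IsRestr (modDeg A wt i) (wordDeg i) := isRestr_restrMod _ _

lemma isRestr_modProj (d : ι → ℤ) : IsRestr (modProj A wt d) (wordProj d) := isRestr_restrMod _ _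

lemma chevalleySerre_mod (h2 : ∀ i, A i i = 2) (hoff : ∀ i j, i ≠ j → A i j ≤ 0)
    (hsymm : ∀ i j, A i j = 0 → A j i = 0) :
    ChevalleySerre A (modE A wt h2) (modF A wt) (modH A wt) where
  hh i j := ((isRestr_modH i).lie (isRestr_modH j)).ext (by
    rw [lie_wordH_wordH]
    exact .zero)
  ef i j := ((isRestr_modE h2 i).lie (isRestr_modF j)).ext (by
    rw [lie_wordE_wordF]
    rcases eq_or_ne i j with rfl | hij
    · rw [if_pos rfl, if_pos rfl]
      exact isRestr_modH i
    · rw [if_neg hij, if_neg hij]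
      exact .zero)
  he i j := ((isRestr_modH i).lie (isRestr_modE h2 j)).ext (by
    rw [lie_wordH_wordE]
    exact (isRestr_modE h2 j).smul _)
  hf i j := ((isRestr_modH i).lie (isRestr_modF j)).ext (by
    rw [lie_wordH_wordF]
    exact (isRestr_modF j).smul _)
  serre_e i j hij := eq_of_isRestr ((isRestr_modE h2 i).ad_pow (isRestr_modE h2 j) _) .zero
    fun d x hx => hx.wordE_serre h2 hoff hsymm hij
  serre_f i j hij := eq_of_isRestr ((isRestr_modF i).ad_pow (isRestr_modF j) _) .zero
    fun d x hx => by rw [wordF_serre h2 hoff hsymm hij]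

/-- An operator on the highest weight module is locally nilpotent if it is nilpotent on every
monomial. -/
lemma locNil_of_isRestr {D : Module.End ℚ (wordMod A wt)} {D' : Module.End ℚ (WordFun ι)}
    (hD : IsRestr D D') (h : ∀ d x, IsMonomial A wt d x → ∃ n : ℕ, (D' ^ n) x = 0) : LocNil D := by
  have : wordMod A wt ≤ Module.End.maxGenEigenspace D' 0 :=
    Submodule.span_le.2 fun x ⟨d, hx⟩ => by
      change x ∈ Module.End.maxGenEigenspace D' 0
      rw [Module.End.mem_maxGenEigenspace]
      simpa using h d x hx
  intro x
  obtain ⟨n, hn⟩ := (Module.End.mem_maxGenEigenspace D' 0 _).1 (this x.2)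
  rw [zero_smul, sub_zero] at hn
  exact ⟨n, Subtype.ext (((hD.pow n) x).trans hn)⟩

variable (A wt) in
/-- The lattice in the highest weight module. -/
def modLat : Submodule ℤ (wordMod A wt) :=
  (wordLat A wt).comap ((wordMod A wt).subtype.restrictScalars ℤ)

lemma stab_of_isRestr {D : Module.End ℚ (wordMod A wt)} {D' : Module.End ℚ (WordFun ι)}
    (hD : IsRestr D D') (h : Stab (wordLat A wt) D') : Stab (modLat A wt) D := fun x hx => by
  change (D x : WordFun ι) ∈ wordLat A wt
  rw [hD]
  exact h _ hx

lemma stab_wordProj (d : ι → ℤ) : Stab (wordLat A wt) (wordProj d) := fun x hx => by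
  induction hx using Submodule.span_induction with
  | mem x hx =>
    obtain ⟨d', hx⟩ := hx
    rw [wordProj_of_deg hx.deg]
    split_ifs
    · exact Submodule.subset_span ⟨_, hx⟩
    · exact Submodule.zero_mem _
  | zero => rw [map_zero]; exact Submodule.zero_mem _
  | add x y _ _ hx hy => rw [map_add]; exact Submodule.add_mem _ hx hy
  | smul c x _ hx => rw [map_zsmul]; exact Submodule.smul_mem _ c hx

lemma locFin_wordProj {x : WordFun ι} (hx : x ∈ wordMod A wt) : {d | wordProj d x ≠ 0}.Finite := by
  induction hx using Submodule.span_induction with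
  | mem x hx =>
    obtain ⟨d', hx⟩ := hx
    refine (Set.finite_singleton d').subset fun d hd => ?_
    by_contra h
    exact hd (by rw [wordProj_of_deg hx.deg]; exact if_neg h)
  | zero => simp
  | add x y _ _ hx hy =>
    refine (hx.union hy).subset fun d hd => ?_
    by_contra h
    simp only [Set.mem_union, Set.mem_ofPred_eq, not_or, not_not] at h
    exact hd (by rw [map_add, h.1, h.2, add_zero])
  | smul c x _ hx =>
    refine hx.subset fun d hd h => hd ?_
    rw [map_smul, h, smul_zero]

lemma locFin_modProj : LocFin (modProj A wt) := fun x =>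
  (locFin_wordProj x.2).subset fun d hd h => hd (Subtype.ext ((isRestr_modProj d x).trans h))

lemma sum_modProj : sumEnd (modProj A wt) = 1 := by
  refine LinearMap.ext fun x => Subtype.ext (funext fun u => ?_)
  set s := insert (fun j => (u.count j : ℤ)) (locFin_modProj x).toFinset with hs
  rw [sumEnd_apply_eq_sum locFin_modProj x s fun d hd =>
    Finset.mem_insert_of_mem (by simpa using hd), Submodule.coe_sum, Finset.sum_apply,
    Finset.sum_eq_single (fun j => (u.count j : ℤ))]
  · rw [isRestr_modProj]
    exact if_pos fun j => rfl
  · intro d _ hd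
    rw [isRestr_modProj]
    exact if_neg fun h => hd (funext fun j => (h j).symm)
  · exact fun h => absurd (Finset.mem_insert_self _ _) h

variable (A wt) in
/-- The integrable highest weight module of a dominant weight. -/
def highestWeight (h2 : ∀ i, A i i = 2) (hoff : ∀ i j, i ≠ j → A i j ≤ 0)
    (hsymm : ∀ i j, A i j = 0 → A j i = 0) (hwt : ∀ i, 0 ≤ wt i) :
    IntegrableLattice A (wordMod A wt) where
  diag := h2
  ρ := lieLift (chevalleySerre_mod h2 hoff hsymm)
  L := modLat A wt
  wt := wt
  deg := modDeg A wt
  π := modProj A wt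
  integrable_e i := by
    rw [lieLift_lieE]
    exact ⟨locNil_of_isRestr (isRestr_modE h2 i) fun d x hx => ⟨_, hx.wordE_pow i⟩,
      fun n => stab_of_isRestr ((isRestr_modE h2 i).divPow n) (stab_divPow_wordE h2 i n)⟩
  integrable_f i := by
    rw [lieLift_lieF]
    exact ⟨locNil_of_isRestr (isRestr_modF i) fun d x hx => hx.wordF_locNil h2 hoff hsymm hwt i,
      fun n => stab_of_isRestr ((isRestr_modF i).divPow n) (stab_divPow_wordF i n)⟩
  latFin_π := ⟨fun d => stab_of_isRestr (isRestr_modProj d) (stab_wordProj d), locFin_modProj⟩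
  sum_π := sum_modProj
  deg_π d j x := Subtype.ext (wordDeg_wordProj d j x)
  π_of_deg d d' x hx := by
    have := wordProj_of_deg (d' := d') (d := d) (x := x) fun j => congrArg Subtype.val (hx j)
    refine Subtype.ext ((isRestr_modProj d' x).trans (this.trans ?_))
    split_ifs <;> rfl
  deg_e i j := by
    rw [lieLift_lieE]
    have h1 : modDeg A wt j * modE A wt h2 i - modE A wt h2 i * modDeg A wt j =
        if j = i then -modE A wt h2 i else 0 :=
      (((isRestr_modDeg j).mul (isRestr_modE h2 i)).sub
        ((isRestr_modE h2 i).mul (isRestr_modDeg j))).ext (by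
        rw [← LieRing.of_associative_ring_bracket, lie_wordDeg_wordE]
        split_ifs
        · exact fun x => rfl
        · exact .zero)
    refine (sub_eq_iff_eq_add'.1 h1).trans ?_
    split_ifs <;> abel
  deg_f i j := by
    rw [lieLift_lieF]
    have h1 : modDeg A wt j * modF A wt i - modF A wt i * modDeg A wt j =
        if j = i then modF A wt i else 0 :=
      (((isRestr_modDeg j).mul (isRestr_modF i)).sub
        ((isRestr_modF i).mul (isRestr_modDeg j))).ext (by
        rw [← LieRing.of_associative_ring_bracket, lie_wordDeg_wordF]
        split_ifs
        · exact isRestr_modF i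
        · exact .zero)
    refine (sub_eq_iff_eq_add'.1 h1).trans ?_
    rfl
  h_of_deg i d x hx := by
    rw [lieLift_lieH]
    exact Subtype.ext (wordH_of_deg (fun j => congrArg Subtype.val (hx j)) i)

/-- The value at the empty word, that is, the coefficient of the highest weight vector, as a
functional on the lattice. -/
def latCoeff : modLat A wt →ₗ[ℤ] ℤ where
  toFun x := ((x : wordMod A wt) : WordFun ι) [] |>.num
  map_add' x y := by
    obtain ⟨m, hm⟩ := exists_int_of_mem_wordLat x.2
    obtain ⟨n, hn⟩ := exists_int_of_mem_wordLat y.2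
    have hm' : ((x : wordMod A wt) : WordFun ι) [] = m := hm
    have hn' : ((y : wordMod A wt) : WordFun ι) [] = n := hn
    change (((x : wordMod A wt) : WordFun ι) [] + ((y : wordMod A wt) : WordFun ι) []).num = _
    rw [hm', hn', ← Int.cast_add, Rat.num_intCast, Rat.num_intCast, Rat.num_intCast]
  map_smul' c x := by
    obtain ⟨m, hm⟩ := exists_int_of_mem_wordLat x.2
    have hm' : ((x : wordMod A wt) : WordFun ι) [] = m := hm
    change (c • (((x : wordMod A wt) : WordFun ι) [])).num = _
    rw [hm', zsmul_eq_mul, ← Int.cast_mul, Rat.num_intCast, Rat.num_intCast]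
    rfl

end WordModule

section Dominant

variable {ι Λ : Type} [Fintype ι] [DecidableEq ι] [AddCommGroup Λ] {D : Datum ι Λ} {k : Type*}
  [Field k]

/-- Elements of the kernel of `η` take the value one at dominant weights, since `η(t)` acts on the
highest weight vector of the integrable module as the scalar `t(λ)`. -/
lemma val_eq_one_of_dominant {lam : Λ} (hlam : ∀ i, 0 ≤ D.h i lam) {t : Torus Λ k}
    (ht : eta D k t = 1) : t.val lam = 1 := by
  set wt : ι → ℤ := fun i => D.h i lam with hwt
  let X := highestWeight D.A wt D.diag D.offDiag D.zero_symm hlam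
  let v : X.L := ⟨⟨wordOne, (IsMonomial.one (A := D.A) (wt := wt)).mem⟩,
    Submodule.subset_span ⟨0, .one⟩⟩
  refine X.val_eq_one_of_eta_eq_one lam (fun i => rfl) v ?_ latCoeff ?_ ht
  · exact fun j => Subtype.ext ((IsMonomial.one (A := D.A) (wt := wt)).deg j)
  · change ((wordOne : WordFun ι) []).num = 1
    simp [wordOne]

end Dominant

/-! ### The kernel of the homomorphism from the torus -/

section Kernel

variable {ι Λ : Type} [Fintype ι] [DecidableEq ι] [AddCommGroup Λ] {D : Datum ι Λ} {k : Type*}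
  [Field k]

/-- If some weight is regular dominant, then every weight is a difference of dominant weights, and
`η` is injective. -/
lemma eta_injective_of_regular {rho : Λ} (hrho : ∀ i, 0 < D.h i rho) :
    Function.Injective (eta D k) := by
  rw [injective_iff_map_eq_one]
  refine fun t ht => Torus.ext_val fun v => ?_
  have h1 : ∀ N : ℕ, t.val ((N : ℤ) • rho) = 1 := fun N => val_eq_one_of_dominant (fun i => by
    rw [map_zsmul, smul_eq_mul]
    exact mul_nonneg (Int.natCast_nonneg _) (hrho i).le) ht
  set N : ℕ := ∑ i, (D.h i v).natAbs with hN
  have h2 : t.val (v + (N : ℤ) • rho) = 1 := val_eq_one_of_dominant (fun i => by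
    rw [map_add, map_zsmul, smul_eq_mul]
    have hle : (D.h i v).natAbs ≤ N :=
      Finset.single_le_sum (f := fun i => (D.h i v).natAbs) (fun _ _ => Nat.zero_le _)
        (Finset.mem_univ i)
    have : (N : ℤ) ≤ N * D.h i rho := le_mul_of_one_le_right (Int.natCast_nonneg _) (hrho i)
    omega) ht
  rwa [Torus.val_add, h1, mul_one] at h2

/-- The homomorphism `r ↦ r^h` to the torus. -/
def coweightHom (h : Λ →+ ℤ) : kˣ →* Torus Λ k :=
  MonoidHom.mk' (coweightPow h) fun r r' => Torus.ext_val fun v => mul_zpow r r' (h v)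

variable (D k) in
/-- The subgroup of the torus generated by all `r^h` for the simple coroots `h`. -/
def corootTorus : Subgroup (Torus Λ k) := ⨆ j, (coweightHom (D.h j)).range

instance corootTorus_normal : (corootTorus D k).Normal :=
  ⟨fun t ht t' => by
    rwa [show t' * t * t'⁻¹ = t from Torus.ext_val fun v => mul_inv_cancel_comm _ _]⟩

lemma coweightPow_mem (j : ι) (r : kˣ) : coweightPow (D.h j) r ∈ corootTorus D k :=
  le_iSup (fun j => (coweightHom (k := k) (D.h j)).range) j ⟨r, rfl⟩

variable (D k) in
/-- The map on the generators of the Kac-Moody group that is trivial except for the torus. It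
respects the relations, since a torus element and its images under simple reflections differ by
elements `r^h`. -/
def torusQuotGen : Gen D k → Torus Λ k ⧸ corootTorus D k
  | .torus t => QuotientGroup.mk t
  | .sl _ _ => 1
  | .root _ _ _ => 1

lemma torusQuot_rel {u u' : FreeGroup (Gen D k)} (h : Rel D u u') :
    FreeGroup.lift (torusQuotGen D k) u = FreeGroup.lift (torusQuotGen D k) u' := by
  have hT : ∀ t, FreeGroup.lift (torusQuotGen D k) (wordT D t) = QuotientGroup.mk t := fun t =>
    FreeGroup.lift_apply_of
  have hS : ∀ i g, FreeGroup.lift (torusQuotGen D k) (wordS D i g) = 1 := fun i g =>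
    FreeGroup.lift_apply_of
  have hX : ∀ z hz r, FreeGroup.lift (torusQuotGen D k) (wordX D z hz r) = 1 := fun z hz r =>
    FreeGroup.lift_apply_of
  cases h with
  | torus_mul t t' =>
    rw [map_mul, hT, hT, hT]
    rfl
  | comm v w x y hx hy hvw l hl r s =>
    rw [map_list_prod, List.map_map]
    simp only [map_mul, map_inv, hX, mul_one, inv_one]
    refine (List.prod_eq_one fun y hy => ?_).symm
    obtain ⟨f, -, rfl⟩ := List.mem_map.1 hy
    exact hX _ _ _
  | sl_diag i r =>
    rw [hS, hT]
    exact ((QuotientGroup.eq_one_iff _).2 (coweightPow_mem i r)).symm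
  | weyl_torus i t =>
    simp only [map_mul, map_inv, hS, hT, one_mul, inv_one, mul_one]
    refine QuotientGroup.eq.2 ?_
    have : t⁻¹ * D.omegaTorus i t = coweightPow (D.h i) (t.val (D.α i))⁻¹ :=
      Torus.ext_val fun v => by
        change (t.val v)⁻¹ * (D.omegaTorus i t).val v = _
        rw [omegaTorus_val, omega_apply,
          Torus.val_sub, Torus.val_zsmul,
          coweightPow_val, inv_zpow, div_eq_mul_inv, inv_mul_cancel_left]
    rw [this]
    exact coweightPow_mem i _
  | _ => simp only [map_mul, map_inv, hS, hX, hT, mul_one, mul_inv_cancel]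

/-- The kernel of `η` is contained in the subgroup generated by the coroots. -/
lemma mem_corootTorus_of_eta_eq_one {t : Torus Λ k} (ht : eta D k t = 1) :
    t ∈ corootTorus D k := by
  let F : Grp D k →* Torus Λ k ⧸ corootTorus D k :=
    PresentedGroup.toGroup (f := torusQuotGen D k) fun r hr => by
      obtain ⟨u, u', h, rfl⟩ := hr
      rw [map_mul, map_inv, torusQuot_rel h, mul_inv_cancel]
  have h1 : F (eta D k t) = QuotientGroup.mk t := FreeGroup.lift_apply_of
  rw [ht, map_one] at h1
  exact (QuotientGroup.eq_one_iff _).1 h1.symm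

lemma phi_slDiag (i : ι) (r : kˣ) : phi D k i (slDiag r) = eta D k (coweightPow (D.h i) r) :=
  Grp.rel D (Rel.sl_diag i r)

lemma slDiag_injective : Function.Injective (slDiag : kˣ → SL(2, k)) := fun r r' h => by
  have := congrArg (fun g : SL(2, k) => g 0 0) h
  exact Units.ext (by simpa [coe_slDiag] using this)

/-- If `h i` is divisible by two and `φ i` is injective, then the field has characteristic two. -/
lemma charP_two_of_isMonic {i : ι} (hi : IsMonic D k i) (heven : ∀ v, Even (D.h i v)) :
    CharP k 2 := by
  have h1 : coweightPow (D.h i) (-1 : kˣ) = 1 := Torus.ext_val fun v => (heven v).neg_one_zpow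
  have h2 : (slDiag (-1) : SL(2, k)) = slDiag 1 := hi (by
    rw [phi_slDiag, phi_slDiag, h1]
    congr 1
    exact Torus.ext_val fun v => (one_zpow _).symm)
  have h3 := congrArg (fun u : kˣ => (u : k)) (slDiag_injective h2)
  simp only [Units.val_neg, Units.val_one] at h3
  refine CharTwo.of_one_ne_zero_of_two_eq_zero one_ne_zero ?_
  rw [← one_add_one_eq_two]
  nth_rewrite 1 [← h3]
  exact neg_add_cancel 1

/-- The homomorphism `η` is injective if the coroots are proportional over `ℚ` to a single coroot
`h i` with `φ i` injective. -/
lemma eta_injective_of_proportional [Finite k] {i : ι} (hi : IsMonic D k i)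
    (hprop : ∀ j, ∃ c : ℤ, ∀ v, 2 * D.h j v = c * D.h i v) : Function.Injective (eta D k) := by
  have hle : corootTorus D k ≤ (coweightHom (D.h i)).range := iSup_le fun j => by
    rintro _ ⟨r, rfl⟩
    obtain ⟨c, hc⟩ := hprop j
    rcases Int.even_or_odd' c with ⟨c', rfl | hodd⟩
    · refine ⟨r ^ c', Torus.ext_val fun v => ?_⟩
      change (r ^ c') ^ D.h i v = r ^ D.h j v
      rw [← zpow_mul]
      congr 1
      linarith [hc v]
    · -- For odd `c` the coroot `h i` is even, so that all elements of `kˣ` are squares.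
      have : CharP k 2 := charP_two_of_isMonic hi fun v => by
        have h1 := hc v
        refine Int.even_iff.2 ?_
        rw [hodd] at h1
        have : D.h i v = 2 * (D.h j v - c' * D.h i v) := by linarith
        omega
      obtain ⟨q, hq⟩ := FiniteField.isSquare_of_char_two (CharP.ringChar_of_prime_eq_zero
        Nat.prime_two (CharP.cast_eq_zero k 2)) (r : k)
      have hq0 : q ≠ 0 := fun h => r.ne_zero (by rw [hq, h, mul_zero])
      have hr : r = Units.mk0 q hq0 ^ (2 : ℤ) := Units.ext (by
        rw [zpow_ofNat, sq]
        exact hq)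
      refine ⟨Units.mk0 q hq0 ^ c, Torus.ext_val fun v => ?_⟩
      change (Units.mk0 q hq0 ^ c) ^ D.h i v = r ^ D.h j v
      rw [hr, ← zpow_mul, ← zpow_mul, hc]
  rw [injective_iff_map_eq_one]
  intro t ht
  obtain ⟨r, rfl⟩ := hle (mem_corootTorus_of_eta_eq_one ht)
  have h1 : phi D k i (slDiag r) = phi D k i (slDiag 1) := by
    rw [phi_slDiag, phi_slDiag]
    refine ht.trans (Eq.symm ?_)
    rw [show coweightPow (D.h i) (1 : kˣ) = 1 from map_one (coweightHom (D.h i)), map_one]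
  rw [slDiag_injective (hi h1), map_one]

end Kernel

section RankTwoKernel

variable {a b : ℤ} {ha : 0 < a} {hb : 0 < b} {n m s t : Fin 2 → ℤ}
  {hA : !![s 0, t 0; s 1, t 1] * !![n 0, n 1; m 0, m 1] = !![2, -a; -b, 2]} {k : Type*} [Field k]

lemma rankTwo_h (i : Fin 2) (v : Lat) :
    (rankTwo a b ha hb n m s t hA).h i v = s i * v 0 + t i * v 1 := by
  simp [rankTwo]

lemma rankTwo_α (i : Fin 2) : (rankTwo a b ha hb n m s t hA).α i = ![n i, m i] := rfl

/-- The pairing of a simple coroot with its root. -/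
lemma rankTwo_pairing (i j : Fin 2) :
    s i * n j + t i * m j = (rankTwo a b ha hb n m s t hA).A i j := by
  rw [← (rankTwo a b ha hb n m s t hA).pairing, rankTwo_h, rankTwo_α]
  rfl

/-- The homomorphism `η` is injective if one of the two Lévi subgroups is monic. For linearly
independent coroots there is a regular dominant weight; otherwise the two coroots
are proportional. -/
lemma rankTwo_eta_injective [Finite k] {i : Fin 2}
    (hi : IsMonic (rankTwo a b ha hb n m s t hA) k i) :
    Function.Injective (eta (rankTwo a b ha hb n m s t hA) k) := by
  by_cases hΔ : s 0 * t 1 - s 1 * t 0 = 0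
  · refine eta_injective_of_proportional hi fun j =>
      ⟨(rankTwo a b ha hb n m s t hA).A j i, fun v => ?_⟩
    have h1 := rankTwo_pairing (ha := ha) (hb := hb) (hA := hA) i i
    rw [(rankTwo a b ha hb n m s t hA).diag] at h1
    have h2 : s i * t j = s j * t i := by
      fin_cases i <;> fin_cases j <;> simp <;> linarith
    rw [← h1, ← rankTwo_pairing, rankTwo_h, rankTwo_h]
    linear_combination (v 0 * m i - v 1 * n i) * (-h2)
  · -- Both coroots take the value `s 0 * t 1 - s 1 * t 0` at `(t 1 - t 0, s 0 - s 1)`.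
    refine eta_injective_of_regular (rho := (s 0 * t 1 - s 1 * t 0) • ![t 1 - t 0, s 0 - s 1])
      fun j => ?_
    have : (rankTwo a b ha hb n m s t hA).h j
        ((s 0 * t 1 - s 1 * t 0) • ![t 1 - t 0, s 0 - s 1]) = (s 0 * t 1 - s 1 * t 0) ^ 2 := by
      rw [map_zsmul, rankTwo_h, smul_eq_mul]
      fin_cases j <;> simp <;> ring
    rw [this]
    positivity

end RankTwoKernel

/-! ### Lévi subgroups as quotients of semidirect products -/

section Semidirect

variable {N K G G' : Type*} [Group N] [Group K] [Group G] [Group G']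

/-- Two groups generated by homomorphic images of `N` and `K` are isomorphic if `K` acts on `N` in
the same way and the same pairs of elements of `N` and `K` are identified, as both are quotients of
the semidirect product by the same kernel. -/
lemma exists_mulEquiv_of_semidirect (act : K →* MulAut N) {f : N →* G} {g : K →* G} {f' : N →* G'}
    {g' : K →* G'} (h : ∀ k x, g k * f x * (g k)⁻¹ = f (act k x))
    (h' : ∀ k x, g' k * f' x * (g' k)⁻¹ = f' (act k x)) (htop : g.range ⊔ f.range = ⊤)
    (htop' : g'.range ⊔ f'.range = ⊤) (hker : ∀ k x, g k = f x ↔ g' k = f' x) :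
    ∃ γ : G ≃* G', ∀ k, γ (g k) = g' k := by
  have hact : ∀ k, f.comp (MulEquiv.toMonoidHom (act k)) =
      (MulEquiv.toMonoidHom (MulAut.conj (g k))).comp f := fun k =>
    MonoidHom.ext fun x => (h k x).symm
  have hact' : ∀ k, f'.comp (MulEquiv.toMonoidHom (act k)) =
      (MulEquiv.toMonoidHom (MulAut.conj (g' k))).comp f' := fun k =>
    MonoidHom.ext fun x => (h' k x).symm
  let F : N ⋊[act] K →* G := SemidirectProduct.lift f g hact
  let F' : N ⋊[act] K →* G' := SemidirectProduct.lift f' g' hact'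
  have hF : Function.Surjective F := by
    rw [← MonoidHom.range_eq_top, eq_top_iff, ← htop]
    refine sup_le ?_ ?_
    · rintro _ ⟨k, rfl⟩
      exact ⟨SemidirectProduct.inr k, SemidirectProduct.lift_inr _ _ _ _⟩
    · rintro _ ⟨x, rfl⟩
      exact ⟨SemidirectProduct.inl x, SemidirectProduct.lift_inl _ _ _ _⟩
  have hF' : Function.Surjective F' := by
    rw [← MonoidHom.range_eq_top, eq_top_iff, ← htop']
    refine sup_le ?_ ?_
    · rintro _ ⟨k, rfl⟩
      exact ⟨SemidirectProduct.inr k, SemidirectProduct.lift_inr _ _ _ _⟩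
    · rintro _ ⟨x, rfl⟩
      exact ⟨SemidirectProduct.inl x, SemidirectProduct.lift_inl _ _ _ _⟩
  have hk : F.ker = F'.ker := by
    ext y
    change f y.left * g y.right = 1 ↔ f' y.left * g' y.right = 1
    rw [mul_eq_one_iff_eq_inv', mul_eq_one_iff_eq_inv', ← map_inv, ← map_inv, hker]
  refine ⟨(QuotientGroup.quotientKerEquivOfSurjective F hF).symm.trans
    ((QuotientGroup.quotientMulEquivOfEq hk).trans
      (QuotientGroup.quotientKerEquivOfSurjective F' hF')), fun k => ?_⟩
  have h1 : (QuotientGroup.quotientKerEquivOfSurjective F hF).symm (g k) =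
      QuotientGroup.mk (SemidirectProduct.inr k) := by
    rw [MulEquiv.symm_apply_eq]
    exact (SemidirectProduct.lift_inr f g hact k).symm
  rw [MulEquiv.trans_apply, h1]
  exact SemidirectProduct.lift_inr f' g' hact' k

end Semidirect

section Conj

variable {k : Type*} [Field k]

/-- Conjugation of a matrix in `SL₂` by `(u 0; 0 1)`. -/
def slConjFun (u : kˣ) (g : SL(2, k)) : SL(2, k) :=
  ⟨!![g 0 0, u * g 0 1; ((u⁻¹ : kˣ) : k) * g 1 0, g 1 1], by
    have hg := g.2
    rw [Matrix.det_fin_two] at hg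
    rw [Matrix.det_fin_two_of]
    have hu := u.mul_inv
    linear_combination hg - (g 0 1 * g 1 0) * hu⟩

lemma coe_slConjFun (u : kˣ) (g : SL(2, k)) : (slConjFun u g : Matrix (Fin 2) (Fin 2) k) =
    !![g 0 0, u * g 0 1; ((u⁻¹ : kˣ) : k) * g 1 0, g 1 1] := rfl

lemma slConjFun_one (g : SL(2, k)) : slConjFun 1 g = g := by
  ext i j
  fin_cases i <;> fin_cases j <;> simp [coe_slConjFun]

lemma slConjFun_slConjFun (u u' : kˣ) (g : SL(2, k)) :
    slConjFun u (slConjFun u' g) = slConjFun (u * u') g := by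
  ext i j
  fin_cases i <;> fin_cases j <;> simp [coe_slConjFun] <;> ring

lemma slConjFun_mul (u : kˣ) (g g' : SL(2, k)) :
    slConjFun u (g * g') = slConjFun u g * slConjFun u g' := by
  have hu := u.mul_inv
  ext i j
  fin_cases i <;> fin_cases j <;>
    simp only [coe_slConjFun, Matrix.SpecialLinearGroup.coe_mul, Matrix.mul_apply,
      Fin.sum_univ_two, Fin.zero_eta, Fin.mk_one, Matrix.of_apply, Matrix.cons_val_zero,
      Matrix.cons_val_one]
  · linear_combination (-(g 0 1 * g' 1 0)) * hu
  · ring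
  · ring
  · linear_combination (-(g 1 0 * g' 0 1)) * hu

/-- Conjugation by the matrix `(u 0; 0 1)` on `SL₂`. -/
def slConj : kˣ →* MulAut SL(2, k) where
  toFun u :=
    { toFun := slConjFun u
      invFun := slConjFun u⁻¹
      left_inv := fun g => by rw [slConjFun_slConjFun, inv_mul_cancel, slConjFun_one]
      right_inv := fun g => by rw [slConjFun_slConjFun, mul_inv_cancel, slConjFun_one]
      map_mul' := slConjFun_mul u }
  map_one' := MulEquiv.ext slConjFun_one
  map_mul' u u' := MulEquiv.ext fun g => (slConjFun_slConjFun u u' g).symm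

lemma coe_slConj (u : kˣ) (g : SL(2, k)) : (slConj u g : Matrix (Fin 2) (Fin 2) k) =
    !![g 0 0, u * g 0 1; ((u⁻¹ : kˣ) : k) * g 1 0, g 1 1] := rfl

lemma slConj_slUpper (u : kˣ) (x : k) : slConj u (slUpper x) = slUpper (u * x) := by
  ext i j
  fin_cases i <;> fin_cases j <;> simp [coe_slConj, coe_slUpper]

lemma slConj_slLower (u : kˣ) (x : k) :
    slConj u (slLower x) = slLower (((u⁻¹ : kˣ) : k) * x) := by
  ext i j
  fin_cases i <;> fin_cases j <;> simp [coe_slConj, coe_slLower]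

/-- A matrix that acts on `SL₂` as a diagonal matrix is diagonal. -/
lemma exists_slDiag_of_conj {u : kˣ} {g : SL(2, k)} (h : ∀ x, g * x * g⁻¹ = slConj u x) :
    ∃ r, g = slDiag r := by
  have h1 := h (slUpper 1)
  have h2 := h (slLower 1)
  rw [slConj_slUpper, mul_inv_eq_iff_eq_mul] at h1
  rw [slConj_slLower, mul_inv_eq_iff_eq_mul] at h2
  have hc : g 1 0 = 0 := by
    have := congrArg (fun y : SL(2, k) => y 0 0) h1
    simpa [coe_slUpper, Matrix.SpecialLinearGroup.coe_mul, Matrix.mul_apply,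
      Fin.sum_univ_two] using this
  have hb : g 0 1 = 0 := by
    have := congrArg (fun y : SL(2, k) => y 0 0) h2
    simpa [coe_slLower, Matrix.SpecialLinearGroup.coe_mul, Matrix.mul_apply,
      Fin.sum_univ_two] using this
  have hdet := g.2
  rw [Matrix.det_fin_two, hb, hc, mul_zero, sub_zero] at hdet
  refine ⟨Units.mk (g 0 0) (g 1 1) hdet (by rw [mul_comm]; exact hdet), ?_⟩
  ext i j
  fin_cases i <;> fin_cases j <;> simp [coe_slDiag, hb, hc]

end Conj

section Levi

variable {ι Λ : Type} [Fintype ι] [DecidableEq ι] [AddCommGroup Λ] {D : Datum ι Λ} {k : Type*}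
  [Field k]

/-- The action of the torus on the `i`-th copy of `SL₂`. -/
def leviAct (D : Datum ι Λ) (k : Type*) [Field k] (i : ι) : Torus Λ k →* MulAut SL(2, k) :=
  slConj.comp (MonoidHom.eval (Multiplicative.ofAdd (D.α i)))

lemma eta_conj_phi (i : ι) (t : Torus Λ k) (g : SL(2, k)) :
    eta D k t * phi D k i g * (eta D k t)⁻¹ = phi D k i (leviAct D k i t g) := by
  have hE : ∃ v, IsRealRootVec D.A v (lieE D.A i) := ⟨_, .simple i⟩
  have hF : ∃ v, IsRealRootVec D.A v (lieF D.A i) := by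
    have := (IsRealRootVec.simple (A := D.A) i).refl i |>.neg
    rw [reflLie_lieE D.diag, neg_neg] at this
    exact ⟨_, this⟩
  have hu : ∀ x, phi D k i (slUpper x) = PresentedGroup.mk _ (wordX D _ hE x) := fun x =>
    Grp.rel D (Rel.sl_upper i hE x)
  have hl : ∀ x, phi D k i (slLower x) = PresentedGroup.mk _ (wordX D _ hF x) := fun x =>
    Grp.rel D (Rel.sl_lower i hF x)
  have : (MulAut.conj (eta D k t)).toMonoidHom.comp (phi D k i) =
      (phi D k i).comp (leviAct D k i t).toMonoidHom := by
    refine SL2.hom_ext (fun x => ?_) fun x => ?_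
    · change eta D k t * phi D k i (slUpper x) * (eta D k t)⁻¹ =
        phi D k i (slConj (t.val (D.α i)) (slUpper x))
      rw [slConj_slUpper, hu, hu]
      exact Grp.rel D (Rel.torus_upper t i hE x)
    · change eta D k t * phi D k i (slLower x) * (eta D k t)⁻¹ =
        phi D k i (slConj (t.val (D.α i)) (slLower x))
      rw [slConj_slLower, hl, hl]
      exact Grp.rel D (Rel.torus_lower t i hF x)
  exact congrArg (fun f : SL(2, k) →* Grp D k => f g) this

/-- In a monic Lévi subgroup the torus and `SL₂` intersect in the diagonal matrices. -/
lemma eta_eq_phi_iff {i : ι} (hi : IsMonic D k i) (hη : Function.Injective (eta D k))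
    (t : Torus Λ k) (g : SL(2, k)) :
    eta D k t = phi D k i g ↔ ∃ r, t = coweightPow (D.h i) r ∧ g = slDiag r := by
  constructor
  · intro h
    obtain ⟨r, rfl⟩ : ∃ r, g = slDiag r :=
      exists_slDiag_of_conj (u := t.val (D.α i)) fun x => hi (by
        rw [map_mul, map_mul, map_inv, ← h, eta_conj_phi]
        rfl)
    exact ⟨r, hη (h.trans (phi_slDiag i r)), rfl⟩
  · rintro ⟨r, rfl, rfl⟩
    exact (phi_slDiag i r).symm

/-- A group generated by the torus and `SL₂` is isomorphic to the Lévi subgroup if the torus acts on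
`SL₂` as in the Lévi subgroup, and intersects it in the diagonal matrices. -/
lemma exists_levi_mulEquiv {i : ι} (hi : IsMonic D k i) (hη : Function.Injective (eta D k))
    {G' : Type*} [Group G'] {f' : SL(2, k) →* G'} {g' : Torus Λ k →* G'}
    (h' : ∀ t x, g' t * f' x * (g' t)⁻¹ = f' (slConj (t.val (D.α i)) x))
    (htop' : ∀ y, ∃ x t, y = f' x * g' t)
    (hker : ∀ t x, g' t = f' x ↔ ∃ r, t = coweightPow (D.h i) r ∧ x = slDiag r) :
    ∃ γ : levi D k i ≃* G', ∀ t, γ (etaLevi D k i t) = g' t := by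
  let f : SL(2, k) →* levi D k i := (phi D k i).codRestrict (levi D k i) fun x =>
    (le_sup_right : _ ≤ levi D k i) ⟨x, rfl⟩
  refine exists_mulEquiv_of_semidirect (leviAct D k i) (f := f) (g := etaLevi D k i)
    (fun t x => Subtype.ext (eta_conj_phi i t x)) h' ?_ ?_ fun t x => ?_
  · refine Subgroup.map_injective (levi D k i).subtype_injective ?_
    rw [Subgroup.map_sup, ← MonoidHom.range_comp, ← MonoidHom.range_comp, ← MonoidHom.range_eq_map,
      Subgroup.range_subtype]
    rfl
  · refine eq_top_iff.2 fun y _ => ?_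
    obtain ⟨x, t, rfl⟩ := htop' y
    exact mul_mem ((le_sup_right : _ ≤ g'.range ⊔ f'.range) ⟨x, rfl⟩)
      ((le_sup_left : _ ≤ g'.range ⊔ f'.range) ⟨t, rfl⟩)
  · rw [hker, ← eta_eq_phi_iff hi hη]
    exact Subtype.ext_iff

end Levi

/-! ### Lévi subgroups in rank two -/

section LatTorus

variable {k : Type*} [Field k]

lemma Torus.val_eq (x : Torus Lat k) (v : Lat) :
    x.val v = x.val (Pi.single 0 1) ^ v 0 * x.val (Pi.single 1 1) ^ v 1 := by
  rw [← Torus.val_zsmul, ← Torus.val_zsmul, ← Torus.val_add]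
  congr 1
  ext i
  fin_cases i <;> simp

instance finite_torus [Finite k] : Finite (Torus Lat k) :=
  Finite.of_injective (β := kˣ × kˣ) (fun x => (x.val (Pi.single 0 1), x.val (Pi.single 1 1)))
    fun x y h => Torus.ext_val fun v => by
      obtain ⟨h0, h1⟩ := Prod.mk_inj.1 h
      rw [Torus.val_eq x, Torus.val_eq y, h0, h1]

/-- The map `x ↦ x ∘ N` on the torus. -/
def torusPullback (N : Matrix (Fin 2) (Fin 2) ℤ) : Torus Lat k →* Torus Lat k :=
  MonoidHom.compHom' (AddMonoidHom.toMultiplicative (Matrix.mulVecLin N).toAddMonoidHom)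

lemma torusPullback_val (N : Matrix (Fin 2) (Fin 2) ℤ) (x : Torus Lat k) (v : Lat) :
    (torusPullback N x).val v = x.val (N *ᵥ v) := rfl

/-- If `q`-th roots in `kˣ` are unique and `N` is an integral matrix of determinant `q ^ 2`, then
`x ↦ (x ∘ N) ^ (1 / q)` is an automorphism of the torus. -/
lemma exists_torusEquiv [Finite k] {q : ℕ} (hq : Function.Injective fun u : kˣ => u ^ q)
    {N : Matrix (Fin 2) (Fin 2) ℤ} (hN : N.det = (q : ℤ) ^ 2) :
    ∃ γT : Torus Lat k ≃* Torus Lat k, ∀ x v, (γT x).val v ^ q = x.val (N *ᵥ v) := by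
  have hP : Function.Bijective (powMonoidHom q : Torus Lat k →* Torus Lat k) :=
    Finite.injective_iff_bijective.1 fun x y h => Torus.ext_val fun v =>
      hq (congrArg (fun z : Torus Lat k => z.val v) h)
  have hC : Function.Bijective (torusPullback N : Torus Lat k →* Torus Lat k) := by
    refine Finite.injective_iff_bijective.1 fun x y h => hP.1 (hP.1 (Torus.ext_val fun v => ?_))
    have h1 : ∀ z : Torus Lat k, ((z ^ q) ^ q).val v = (torusPullback N z).val (N.adjugate *ᵥ v) :=
      fun z => by
        rw [torusPullback_val, Matrix.mulVec_mulVec, Matrix.mul_adjugate, hN, Matrix.smul_mulVec,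
          Matrix.one_mulVec, Torus.val_zsmul]
        change (z.val v ^ q) ^ q = _
        rw [← pow_mul, ← sq, ← zpow_natCast, Nat.cast_pow]
    change ((x ^ q) ^ q).val v = ((y ^ q) ^ q).val v
    rw [h1, h1, h]
  refine ⟨(MulEquiv.ofBijective _ hC).trans (MulEquiv.ofBijective _ hP).symm, fun x v => ?_⟩
  have h1 := (MulEquiv.ofBijective _ hP).apply_symm_apply (torusPullback N x)
  exact congrArg (fun z : Torus Lat k => z.val v) h1

/-- The element of the torus with given values on the basis. -/
def torusMk (ζ τ : kˣ) : Torus Lat k :=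
  coweightPow (Pi.evalAddMonoidHom (fun _ : Fin 2 => ℤ) 0) ζ *
    coweightPow (Pi.evalAddMonoidHom (fun _ : Fin 2 => ℤ) 1) τ

lemma torusMk_val (ζ τ : kˣ) (v : Lat) : (torusMk ζ τ).val v = ζ ^ v 0 * τ ^ v 1 := rfl

lemma coe_etaSL (x : Torus Lat k) :
    etaSL x = (slDiag (x.val (Pi.single 0 1)), x.val (Pi.single 1 1)) := rfl

lemma coe_etaGL (x : Torus Lat k) : (etaGL x : Matrix (Fin 2) (Fin 2) k) =
    !![(x.val (Pi.single 0 1) : k), 0; 0, (x.val (Pi.single 1 1) : k)] := rfl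

lemma slDiag_conj (r : kˣ) (g : SL(2, k)) :
    slDiag r * g * (slDiag r)⁻¹ = slConj (r ^ 2) g := by
  rw [mul_inv_eq_iff_eq_mul]
  ext i j
  fin_cases i <;> fin_cases j <;>
    simp [coe_slDiag, coe_slConj, Matrix.SpecialLinearGroup.coe_mul, Matrix.mul_apply,
      Fin.sum_univ_two, -map_pow] <;> field_simp

end LatTorus

section LeviRankTwo

variable {a b : ℤ} {ha : 0 < a} {hb : 0 < b} {n m s t : Fin 2 → ℤ}
  {hA : !![s 0, t 0; s 1, t 1] * !![n 0, n 1; m 0, m 1] = !![2, -a; -b, 2]} {k : Type*} [Field k]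

lemma rankTwo_diag
    (hA : !![s 0, t 0; s 1, t 1] * !![n 0, n 1; m 0, m 1] = !![2, -a; -b, 2]) (i : Fin 2) :
    s i * n i + t i * m i = 2 := by
  have := congrFun (congrFun hA i) i
  fin_cases i <;> simpa [Matrix.mul_apply, Fin.sum_univ_two] using this

/-- A monic Lévi subgroup whose root is divisible by two is isomorphic to `SL₂(k) × kˣ`. -/
lemma exists_mulEquiv_split [Finite k] {i : Fin 2}
    (hi : IsMonic (rankTwo a b ha hb n m s t hA) k i) {p r : ℤ} (hp : n i = 2 * p)
    (hr : m i = 2 * r) :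
    ∃ (γ : levi (rankTwo a b ha hb n m s t hA) k i ≃* SL(2, k) × kˣ)
      (γT : Torus Lat k ≃* Torus Lat k),
      (∀ x, γ (etaLevi (rankTwo a b ha hb n m s t hA) k i x) = etaSL (γT x)) ∧
      ∀ x v, (γT x).val v = x.val (!![p, -t i; r, s i] *ᵥ v) := by
  have h2 : s i * p + t i * r = 1 := by
    have := rankTwo_diag hA i
    rw [hp, hr] at this
    linarith
  obtain ⟨γT, hγ⟩ := exists_torusEquiv (k := k) (q := 1) (N := !![p, -t i; r, s i])
    (fun u u' h => by simpa using h) (by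
      rw [Matrix.det_fin_two_of]
      push_cast
      linear_combination h2)
  simp only [pow_one] at hγ
  have h0 : ∀ x, (γT x).val (Pi.single 0 1) = x.val ![p, r] := fun x => by
    rw [hγ]
    congr 1
    ext j
    fin_cases j <;> simp
  have h1 : ∀ x, (γT x).val (Pi.single 1 1) = x.val ![-t i, s i] := fun x => by
    rw [hγ]
    congr 1
    ext j
    fin_cases j <;> simp
  suffices h : ∃ γ : levi (rankTwo a b ha hb n m s t hA) k i ≃* SL(2, k) × kˣ,
      ∀ x, γ (etaLevi (rankTwo a b ha hb n m s t hA) k i x) = etaSL (γT x) by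
    obtain ⟨γ, hγ'⟩ := h
    exact ⟨γ, γT, hγ', hγ⟩
  refine exists_levi_mulEquiv hi (rankTwo_eta_injective hi)
    (f' := MonoidHom.inl SL(2, k) kˣ) (g' := etaSL.comp γT.toMonoidHom) (fun x g => ?_)
    (fun y => ?_) fun x g => ?_
  · change etaSL (γT x) * (g, 1) * (etaSL (γT x))⁻¹ = (slConj (x.val ![n i, m i]) g, 1)
    rw [coe_etaSL, Prod.inv_mk, Prod.mk_mul_mk, Prod.mk_mul_mk, slDiag_conj, mul_one,
      mul_inv_cancel, h0]
    congr 2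
    rw [← zpow_natCast, ← Torus.val_zsmul]
    congr 2
    rw [hp, hr]
    ext j
    fin_cases j <;> simp
  · refine ⟨y.1, γT.symm (torusMk 1 y.2), ?_⟩
    change y = (y.1, 1) * etaSL (γT (γT.symm (torusMk 1 y.2)))
    rw [MulEquiv.apply_symm_apply, coe_etaSL, torusMk_val, torusMk_val]
    have hone : (slDiag 1 : SL(2, k)) = 1 := by
      ext i j
      fin_cases i <;> fin_cases j <;> simp [coe_slDiag]
    ext1 <;> simp [hone]
  · change etaSL (γT x) = (g, 1) ↔ _
    rw [coe_etaSL, h0, h1, Prod.mk_inj]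
    constructor
    · rintro ⟨rfl, hτ⟩
      refine ⟨_, Torus.ext_val fun v => ?_, rfl⟩
      -- Expand `v` in the basis `(p, r), (-t i, s i)` of the lattice.
      have hv : v = (s i * v 0 + t i * v 1) • ![p, r] + (p * v 1 - r * v 0) • ![-t i, s i] := by
        ext j
        fin_cases j
        · simp
          linear_combination (-v 0) * h2
        · simp
          linear_combination (-v 1) * h2
      rw [coweightPow_val, rankTwo_h]
      nth_rewrite 1 [hv]
      rw [Torus.val_add, Torus.val_zsmul, Torus.val_zsmul, hτ, one_zpow, mul_one]
    · rintro ⟨u, rfl, rfl⟩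
      rw [coweightPow_val, coweightPow_val, rankTwo_h, rankTwo_h]
      constructor
      · congr 1
        simp [h2]
      · have : s i * (![-t i, s i] : Lat) 0 + t i * (![-t i, s i] : Lat) 1 = 0 := by
          simp
          ring
        rw [this, zpow_zero]

/-- A monic Lévi subgroup is isomorphic to `GL₂(k)` if `q` times the matrix `M` is an integral
matrix `N` and `q`-th roots in `kˣ` are unique. -/
lemma exists_mulEquiv_nonsplit [Finite k] {i : Fin 2}
    (hi : IsMonic (rankTwo a b ha hb n m s t hA) k i) {q : ℕ}
    (hq : Function.Injective fun u : kˣ => u ^ q) {N : Matrix (Fin 2) (Fin 2) ℤ}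
    (h00 : 2 * N 0 0 = q * (n i - t i)) (h01 : 2 * N 0 1 = q * (-n i - t i))
    (h10 : 2 * N 1 0 = q * (m i + s i)) (h11 : 2 * N 1 1 = q * (-m i + s i)) :
    ∃ (γ : levi (rankTwo a b ha hb n m s t hA) k i ≃* GL (Fin 2) k)
      (γT : Torus Lat k ≃* Torus Lat k),
      (∀ x, γ (etaLevi (rankTwo a b ha hb n m s t hA) k i x) = etaGL (γT x)) ∧
      ∀ x v, (γT x).val v ^ q = x.val (N *ᵥ v) := by
  have h2 := rankTwo_diag hA i
  have hdet : N.det = (q : ℤ) ^ 2 := by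
    have : 4 * N.det = 4 * (q : ℤ) ^ 2 := by
      rw [Matrix.det_fin_two]
      linear_combination 2 * N 1 1 * h00 + q * (n i - t i) * h11 - 2 * N 1 0 * h01 -
        q * (-n i - t i) * h10 + 2 * (q : ℤ) ^ 2 * h2
    linarith
  obtain ⟨γT, hγ⟩ := exists_torusEquiv (k := k) hq hdet
  -- The ratio and the product of the diagonal entries.
  have hdiv : ∀ x, (γT x).val (Pi.single 0 1) = x.val ![n i, m i] * (γT x).val (Pi.single 1 1) :=
    fun x => by
      refine hq ?_
      change _ ^ q = (_ * _) ^ q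
      rw [mul_pow, hγ, hγ, ← zpow_natCast (x.val _), ← Torus.val_zsmul, ← Torus.val_add]
      congr 1
      ext j
      fin_cases j
      · simp
        linarith
      · simp
        linarith
  have hval : ∀ x v, (γT x).val (Pi.single 0 1) * (γT x).val (Pi.single 1 1) = 1 →
      x.val v = (γT x).val (Pi.single 0 1) ^ (s i * v 0 + t i * v 1) := fun x v h => by
    refine hq (hq ?_)
    change (_ ^ q) ^ q = (_ ^ q) ^ q
    -- The inverse of `N` up to the factor `q ^ 2` is the adjugate.
    have h3 : (x.val v ^ q) ^ q = (γT x).val (N.adjugate *ᵥ v) ^ q := by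
      rw [hγ, Matrix.mulVec_mulVec, Matrix.mul_adjugate, hdet, Matrix.smul_mulVec,
        Matrix.one_mulVec, Torus.val_zsmul, ← pow_mul, ← sq, ← zpow_natCast, Nat.cast_pow]
    rw [h3, Torus.val_eq, eq_inv_of_mul_eq_one_right h, inv_zpow, ← zpow_neg, ← zpow_add]
    congr 1
    rw [← zpow_natCast, ← zpow_mul]
    congr 1
    simp [Matrix.adjugate_fin_two, Matrix.vecHead, Matrix.vecTail]
    refine mul_left_cancel₀ (two_ne_zero (α := ℤ)) ?_
    linear_combination v 0 * h11 + v 0 * h10 - v 1 * h01 - v 1 * h00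
  have hcow : ∀ u : kˣ,
      (γT (coweightPow ((rankTwo a b ha hb n m s t hA).h i) u)).val (Pi.single 0 1) = u ∧
      (γT (coweightPow ((rankTwo a b ha hb n m s t hA).h i) u)).val (Pi.single 1 1) = u⁻¹ :=
    fun u => by
      constructor
      · refine hq ?_
        change _ ^ q = _ ^ q
        rw [hγ, coweightPow_val, rankTwo_h, ← zpow_natCast]
        congr 1
        simp
        refine mul_left_cancel₀ (two_ne_zero (α := ℤ)) ?_
        linear_combination s i * h00 + t i * h10 + q * h2
      · refine hq ?_
        change _ ^ q = _ ^ q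
        rw [hγ, coweightPow_val, rankTwo_h, inv_pow, ← zpow_natCast, ← zpow_neg]
        congr 1
        simp
        refine mul_left_cancel₀ (two_ne_zero (α := ℤ)) ?_
        linear_combination s i * h01 + t i * h11 - q * h2
  suffices h : ∃ γ : levi (rankTwo a b ha hb n m s t hA) k i ≃* GL (Fin 2) k,
      ∀ x, γ (etaLevi (rankTwo a b ha hb n m s t hA) k i x) = etaGL (γT x) by
    obtain ⟨γ, hγ'⟩ := h
    exact ⟨γ, γT, hγ', hγ⟩
  refine exists_levi_mulEquiv hi (rankTwo_eta_injective hi)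
    (f' := Matrix.SpecialLinearGroup.toGL) (g' := etaGL.comp γT.toMonoidHom) (fun x g => ?_)
    (fun y => ?_) fun x g => ?_
  · rw [mul_inv_eq_iff_eq_mul]
    change etaGL (γT x) * _ = Matrix.SpecialLinearGroup.toGL (slConj (x.val ![n i, m i]) g) *
      etaGL (γT x)
    ext1
    rw [Units.val_mul, Units.val_mul, coe_etaGL, hdiv]
    have hu := (x.val ![n i, m i]).mul_inv
    ext j l
    fin_cases j <;> fin_cases l <;>
      simp [coe_slConj, Matrix.mul_apply, Fin.sum_univ_two] <;> field_simp
  · have hy := Matrix.GeneralLinearGroup.val_det_apply y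
    rw [Matrix.det_fin_two] at hy
    set u := Matrix.GeneralLinearGroup.det y
    refine ⟨⟨!![y 0 0, y 0 1 * ((u⁻¹ : kˣ) : k); y 1 0, y 1 1 * ((u⁻¹ : kˣ) : k)], ?_⟩,
      γT.symm (torusMk 1 u), ?_⟩
    · rw [Matrix.det_fin_two_of]
      have hu := u.mul_inv
      linear_combination hu - ((u⁻¹ : kˣ) : k) * hy
    · change y = _ * etaGL (γT (γT.symm (torusMk 1 u)))
      rw [MulEquiv.apply_symm_apply]
      ext j l
      change y j l = (!![y 0 0, y 0 1 * ((u⁻¹ : kˣ) : k); y 1 0, y 1 1 * ((u⁻¹ : kˣ) : k)] *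
        (etaGL (torusMk 1 u) : Matrix (Fin 2) (Fin 2) k)) j l
      rw [coe_etaGL, torusMk_val, torusMk_val]
      fin_cases j <;> fin_cases l <;> simp [Matrix.mul_apply, Fin.sum_univ_two]
  · change etaGL (γT x) = _ ↔ _
    constructor
    · intro h
      have hent : ∀ j l, (!![((γT x).val (Pi.single 0 1) : k), 0; 0,
          ((γT x).val (Pi.single 1 1) : k)] : Matrix (Fin 2) (Fin 2) k) j l = g j l := fun j l => by
        rw [← coe_etaGL, h]
        rfl
      have hprod : (γT x).val (Pi.single 0 1) * (γT x).val (Pi.single 1 1) = 1 := Units.ext (by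
        have hg := g.2
        rw [Matrix.det_fin_two, ← hent, ← hent, ← hent, ← hent] at hg
        simpa using hg)
      refine ⟨(γT x).val (Pi.single 0 1), Torus.ext_val fun v => ?_, ?_⟩
      · rw [coweightPow_val, rankTwo_h]
        exact hval x v hprod
      · ext j l
        rw [← hent, eq_inv_of_mul_eq_one_right hprod]
        rfl
    · rintro ⟨u, rfl, rfl⟩
      ext1
      rw [coe_etaGL, (hcow u).1, (hcow u).2]
      rfl

end LeviRankTwo

/-! ### The matrices that induce the isomorphisms -/

section Matrices

variable {a b : ℤ} {ha : 0 < a} {hb : 0 < b} {n m s t : Fin 2 → ℤ}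
  {hA : !![s 0, t 0; s 1, t 1] * !![n 0, n 1; m 0, m 1] = !![2, -a; -b, 2]}

lemma omegaMatrix_rankTwo (i : Fin 2) : omegaMatrix (rankTwo a b ha hb n m s t hA) i =
    !![1 - (s i : ℚ) * n i, -(t i : ℚ) * n i; -(s i : ℚ) * m i, 1 - (t i : ℚ) * m i] := by
  ext r c
  rw [omegaMatrix, Matrix.of_apply, omega_apply, rankTwo_h, rankTwo_α]
  fin_cases r <;> fin_cases c <;> simp

lemma det_matSplit {n m s t : ℤ} (h : s * n + t * m = 2) : (matSplit n m s t).det = 1 := by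
  have h' : (s : ℚ) * n + t * m = 2 := by exact_mod_cast h
  rw [matSplit, Matrix.det_fin_two_of]
  linear_combination h' / 2

lemma det_matNonsplit {n m s t : ℤ} (h : s * n + t * m = 2) : (matNonsplit n m s t).det = 1 := by
  have h' : (s : ℚ) * n + t * m = 2 := by exact_mod_cast h
  rw [matNonsplit, Matrix.det_smul, Matrix.det_fin_two_of, Fintype.card_fin]
  linear_combination h' / 2

/-- For invertible `M`, the identity `M⁻¹ ω M = ω̄` may be checked in the form `ω M = M ω̄`. -/
lemma inv_mul_mul_eq {M W W' : Matrix (Fin 2) (Fin 2) ℚ} (hM : M.det = 1) (h : W * M = M * W') :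
    M⁻¹ * W * M = W' := by
  rw [mul_assoc, h, Matrix.nonsing_inv_mul_cancel_left _ _ (by rw [hM]; exact isUnit_one)]

lemma fin_two_eq {p q r u p' q' r' u' : ℚ} (hp : p = p') (hq : q = q') (hr : r = r')
    (hu : u = u') :
    !![p, q; r, u] = !![p', q'; r', u'] := by rw [hp, hq, hr, hu]

lemma matSplit_conj (i : Fin 2) :
    (matSplit (n i) (m i) (s i) (t i))⁻¹ * omegaMatrix (rankTwo a b ha hb n m s t hA) i *
      matSplit (n i) (m i) (s i) (t i) = omegaSL := by
  have h' : (s i : ℚ) * n i + t i * m i = 2 := by exact_mod_cast rankTwo_diag hA i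
  refine inv_mul_mul_eq (det_matSplit (rankTwo_diag hA i)) ?_
  rw [omegaMatrix_rankTwo, matSplit, omegaSL, Matrix.mul_fin_two, Matrix.mul_fin_two]
  refine fin_two_eq ?_ ?_ ?_ ?_
  · linear_combination (-(n i : ℚ) / 2) * h'
  · ring
  · linear_combination (-(m i : ℚ) / 2) * h'
  · ring

lemma matNonsplit_conj (i : Fin 2) :
    (matNonsplit (n i) (m i) (s i) (t i))⁻¹ * omegaMatrix (rankTwo a b ha hb n m s t hA) i *
      matNonsplit (n i) (m i) (s i) (t i) = omegaGL := by
  have h' : (s i : ℚ) * n i + t i * m i = 2 := by exact_mod_cast rankTwo_diag hA i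
  refine inv_mul_mul_eq (det_matNonsplit (rankTwo_diag hA i)) ?_
  rw [omegaMatrix_rankTwo, matNonsplit, omegaGL, mul_smul_comm, smul_mul_assoc, Matrix.mul_fin_two,
    Matrix.mul_fin_two]
  refine congrArg _ (fin_two_eq ?_ ?_ ?_ ?_)
  · linear_combination (-(n i : ℚ)) * h'
  · linear_combination (n i : ℚ) * h'
  · linear_combination (-(m i : ℚ)) * h'
  · linear_combination (m i : ℚ) * h'

/-- The integral matrix `N` with `N = q M`, in terms of its entries. -/
lemma matNonsplit_eq_map {n m s t : ℤ} {q : ℕ} {N : Matrix (Fin 2) (Fin 2) ℤ}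
    (h00 : 2 * N 0 0 = q * (n - t)) (h01 : 2 * N 0 1 = q * (-n - t))
    (h10 : 2 * N 1 0 = q * (m + s)) (h11 : 2 * N 1 1 = q * (-m + s)) :
    (q : ℚ) • matNonsplit n m s t = N.map (Int.cast : ℤ → ℚ) := by
  have h00' : 2 * (N 0 0 : ℚ) = q * (n - t) := by exact_mod_cast h00
  have h01' : 2 * (N 0 1 : ℚ) = q * (-n - t) := by exact_mod_cast h01
  have h10' : 2 * (N 1 0 : ℚ) = q * (m + s) := by exact_mod_cast h10
  have h11' : 2 * (N 1 1 : ℚ) = q * (-m + s) := by exact_mod_cast h11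
  ext r c
  fin_cases r <;> fin_cases c <;> simp [matNonsplit] <;> linarith

/-- If the coroot is primitive and the root is not divisible by two, then `M` is integral. -/
lemma exists_integral_of_isCoprime {n m s t : ℤ} (h : s * n + t * m = 2) (hst : IsCoprime s t)
    (hnm : ¬(Even n ∧ Even m)) : ∃ c d : ℤ, n = t + 2 * c ∧ m = s + 2 * d := by
  have hst' : ¬(Even s ∧ Even t) := fun ⟨h1, h2⟩ => by
    have := hst.isUnit_of_dvd' (even_iff_two_dvd.1 h1) (even_iff_two_dvd.1 h2)
    exact absurd (Int.isUnit_iff.1 this) (by norm_num)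
  have hpar : Even (s * n + t * m) := h ▸ even_two
  have hnt : Even (n - t) ∧ Even (m - s) := by
    simp only [Int.even_sub, Int.even_add, Int.even_mul] at hpar ⊢
    tauto
  obtain ⟨c, hc⟩ := hnt.1
  obtain ⟨d, hd⟩ := hnt.2
  exact ⟨c, d, by linarith, by linarith⟩

/-- If the coroot is not primitive, then it is divisible by two. -/
lemma even_of_not_isCoprime {n m s t : ℤ} (h : s * n + t * m = 2) (hst : ¬IsCoprime s t) :
    Even s ∧ Even t := by
  have hg : (Int.gcd s t : ℤ) ∣ 2 := h ▸ dvd_add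
    ((Int.gcd_dvd_left ..).mul_right _) ((Int.gcd_dvd_right ..).mul_right _)
  have hg' : Int.gcd s t ∣ 2 := by exact_mod_cast hg
  rcases (Nat.dvd_prime Nat.prime_two).1 hg' with h1 | h2
  · exact absurd (Int.isCoprime_iff_gcd_eq_one.2 h1) hst
  · have hs := Int.gcd_dvd_left s t
    have ht := Int.gcd_dvd_right s t
    rw [h2] at hs ht
    exact ⟨even_iff_two_dvd.2 hs, even_iff_two_dvd.2 ht⟩

end Matrices

end KacMoody

end

theorem mainTheorem7 (k : Type*) [Field k] [Finite k] (a b : ℤ) (ha : 0 < a) (hb : 0 < b)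
    (hab : 4 ≤ a * b) (n m s t : Fin 2 → ℤ)
    (hA : !![s 0, t 0; s 1, t 1] * !![n 0, n 1; m 0, m 1] = !![2, -a; -b, 2])
    (i : Fin 2)
    (hmonic : KacMoody.IsMonic (KacMoody.rankTwo a b ha hb n m s t hA) k i) :
    (Even (n i) ∧ Even (m i) →
      ∃ (γ : KacMoody.levi (KacMoody.rankTwo a b ha hb n m s t hA) k i ≃*
            Matrix.SpecialLinearGroup (Fin 2) k × kˣ)
        (γT : KacMoody.Torus KacMoody.Lat k ≃* KacMoody.Torus KacMoody.Lat k),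
        (∀ x, γ (KacMoody.etaLevi (KacMoody.rankTwo a b ha hb n m s t hA) k i x) =
          KacMoody.etaSL (γT x)) ∧
        KacMoody.InducedBy (KacMoody.matSplit (n i) (m i) (s i) (t i)) γT ∧
        (KacMoody.matSplit (n i) (m i) (s i) (t i)).det = 1 ∧
        (KacMoody.matSplit (n i) (m i) (s i) (t i))⁻¹ *
            KacMoody.omegaMatrix (KacMoody.rankTwo a b ha hb n m s t hA) i *
            KacMoody.matSplit (n i) (m i) (s i) (t i) = KacMoody.omegaSL) ∧
    (¬ (Even (n i) ∧ Even (m i)) →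
      ∃ (γ : KacMoody.levi (KacMoody.rankTwo a b ha hb n m s t hA) k i ≃*
            Matrix.GeneralLinearGroup (Fin 2) k)
        (γT : KacMoody.Torus KacMoody.Lat k ≃* KacMoody.Torus KacMoody.Lat k),
        (∀ x, γ (KacMoody.etaLevi (KacMoody.rankTwo a b ha hb n m s t hA) k i x) =
          KacMoody.etaGL (γT x)) ∧
        ((IsCoprime (s i) (t i) ∧
            KacMoody.InducedBy (KacMoody.matNonsplit (n i) (m i) (s i) (t i)) γT) ∨
          (CharP k 2 ∧ Even (s i) ∧ Even (t i) ∧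
            KacMoody.HalfInducedBy (KacMoody.matNonsplit (n i) (m i) (s i) (t i)) γT)) ∧
        (KacMoody.matNonsplit (n i) (m i) (s i) (t i)).det = 1 ∧
        (KacMoody.matNonsplit (n i) (m i) (s i) (t i))⁻¹ *
            KacMoody.omegaMatrix (KacMoody.rankTwo a b ha hb n m s t hA) i *
            KacMoody.matNonsplit (n i) (m i) (s i) (t i) = KacMoody.omegaGL) := by
  have h2 := KacMoody.rankTwo_diag hA i
  refine ⟨fun ⟨⟨p, hp⟩, ⟨r, hr⟩⟩ => ?_, fun hns => ?_⟩
  · obtain ⟨γ, γT, hγ, hT⟩ := KacMoody.exists_mulEquiv_split hmonic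
      (hp.trans (two_mul p).symm) (hr.trans (two_mul r).symm)
    refine ⟨γ, γT, hγ, ⟨_, ?_, hT⟩, KacMoody.det_matSplit h2, KacMoody.matSplit_conj i⟩
    ext j l
    fin_cases j <;> fin_cases l <;> simp [KacMoody.matSplit, hp, hr]
  · suffices h : ∃ (γ : KacMoody.levi (KacMoody.rankTwo a b ha hb n m s t hA) k i ≃*
            Matrix.GeneralLinearGroup (Fin 2) k)
        (γT : KacMoody.Torus KacMoody.Lat k ≃* KacMoody.Torus KacMoody.Lat k),
        (∀ x, γ (KacMoody.etaLevi (KacMoody.rankTwo a b ha hb n m s t hA) k i x) =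
          KacMoody.etaGL (γT x)) ∧
        ((IsCoprime (s i) (t i) ∧
            KacMoody.InducedBy (KacMoody.matNonsplit (n i) (m i) (s i) (t i)) γT) ∨
          (CharP k 2 ∧ Even (s i) ∧ Even (t i) ∧
            KacMoody.HalfInducedBy (KacMoody.matNonsplit (n i) (m i) (s i) (t i)) γT)) by
      obtain ⟨γ, γT, hγ, hT⟩ := h
      exact ⟨γ, γT, hγ, hT, KacMoody.det_matNonsplit h2, KacMoody.matNonsplit_conj i⟩
    by_cases hst : IsCoprime (s i) (t i)
    · obtain ⟨c, d, hc, hd⟩ := KacMoody.exists_integral_of_isCoprime h2 hst hns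
      have h00 : 2 * (!![c, -t i - c; s i + d, -d] : Matrix (Fin 2) (Fin 2) ℤ) 0 0 =
        (1 : ℕ) * (n i - t i) := by simp; linarith
      have h01 : 2 * (!![c, -t i - c; s i + d, -d] : Matrix (Fin 2) (Fin 2) ℤ) 0 1 =
        (1 : ℕ) * (-n i - t i) := by simp; linarith
      have h10 : 2 * (!![c, -t i - c; s i + d, -d] : Matrix (Fin 2) (Fin 2) ℤ) 1 0 =
        (1 : ℕ) * (m i + s i) := by simp; linarith
      have h11 : 2 * (!![c, -t i - c; s i + d, -d] : Matrix (Fin 2) (Fin 2) ℤ) 1 1 =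
        (1 : ℕ) * (-m i + s i) := by simp; linarith
      obtain ⟨γ, γT, hγ, hT⟩ := KacMoody.exists_mulEquiv_nonsplit hmonic
        (fun u u' h => by simpa using h) h00 h01 h10 h11
      refine ⟨γ, γT, hγ, Or.inl ⟨hst, _, ?_, fun x v => by rw [← hT, pow_one]⟩⟩
      simpa using KacMoody.matNonsplit_eq_map h00 h01 h10 h11
    · obtain ⟨hs, ht⟩ := KacMoody.even_of_not_isCoprime h2 hst
      have hchar : CharP k 2 := KacMoody.charP_two_of_isMonic hmonic fun v => by
        rw [KacMoody.rankTwo_h]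
        exact (hs.mul_right _).add (ht.mul_right _)
      have hq : Function.Injective fun u : kˣ => u ^ 2 := fun u u' h =>
        Units.ext (CharTwo.sq_injective (by simpa using congrArg (fun u : kˣ => (u : k)) h))
      have h00 : 2 * (!![n i - t i, -n i - t i; m i + s i, -m i + s i] :
        Matrix (Fin 2) (Fin 2) ℤ) 0 0 = (2 : ℕ) * (n i - t i) := rfl
      obtain ⟨γ, γT, hγ, hT⟩ := KacMoody.exists_mulEquiv_nonsplit hmonic hq h00 rfl rfl rfl
      exact ⟨γ, γT, hγ, Or.inr ⟨hchar, hs, ht, _,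
        KacMoody.matNonsplit_eq_map (q := 2) h00 rfl rfl rfl, hT⟩⟩
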